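/- Let $G\rightrightarrows G^{(0)}$ be a Lie groupoid (with $G$ and $G^{(0)}$ finite-dimensional, Hausdorff, second countable smooth manifolds) with range and source maps $r,s$, let $G^{(2)}=\{(\gamma,\eta)\in G\times G: s(\gamma)=r(\eta)\}$, with projections $p_1,p_2:G^{(2)}\to G$, and let $E\to G$ be a smooth real or complex vector bundle of finite rank, with scalar field $\mathbb{K}$. Suppose that $E$ has a multiplicative structure, i.e. a smooth bundle map $m:p_1^*E\otimes p_2^*E\to E$ covering the multiplication $G^{(2)}\to G$. Below, $C^\infty(G^{(0)})$ denotes the $\mathbb{K}$-valued smooth functions with its usual Fréchet topology, acting on sections over $G$ through $r$. Let $\mathcal{D}'_r(G,E)$ be the set of continuous $C^\infty(G^{(0)})$-module maps $C_c^\infty(G,E^*)\to C^\infty(G^{(0)})$, and $\mathcal{E}'_r(G,E)$ the set of continuous $C^\infty(G^{(0)})$-module maps $C^\infty(G,E^*)\to C^\infty(G^{(0)})$, where $C^\infty(G,E^*)$ has its Fréchet topology and $C^\infty_c(G,E^*)$ its inductive limit topology. Restriction to compactly supported sections embeds $\mathcal{E}'_r(G,E)$ in $\mathcal{D}'_r(G,E)$.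 For $u\in\mathcal{D}'_r(G,E)$ and $x\in G^{(0)}$, let $u^x$ be the induced distribution on $r^{-1}(x)$, determined by $\langle u^x,f|_{r^{-1}(x)}\rangle=\langle u,f\rangle(x)$; it is defined on restrictions of compactly supported smooth sections and, if $u\in\mathcal{E}'_r(G,E)$, on restrictions of all smooth sections. Call $u$ properly supported if $r$ and $s$ restrict to proper maps $\operatorname{supp}u\to G^{(0)}$. Let $u,v\in\mathcal{D}'_r(G,E)$, and suppose that at least one of them belongs to $\mathcal{E}'_r(G,E)$ and is properly supported. Then the convolution $u*v$ given by $$\langle u*v,\varphi\rangle(x)=\big\langle u^x(\gamma),\langle v^{s(\gamma)}(\eta),m^*\varphi(\gamma,\eta)\rangle\big\rangle,\qquad \varphi\in C_c^\infty(G,E^*),\ x\in G^{(0)},$$ is well defined and belongs to $\mathcal{D}'_r(G,E)$. Here $m^*\varphi(\gamma,\eta)\in E_\gamma^*\otimes E_\eta^*$ is the image of $\varphi(\gamma\eta)$ under the dual of $m:E_\gamma\otimes E_\eta\to E_{\gamma\eta}$. That is: for every $\varphi$ the inner pairings are defined for all $\gamma\in G$ and form a smooth section $\gamma\mapsto\langle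 v^{s(\gamma)}(\eta),m^*\varphi(\gamma,\eta)\rangle\in E_\gamma^*$ of $E^*$, the outer pairing of $u^x$ with its restriction to $r^{-1}(x)$ is defined for all $x$, and there is exactly one element $u*v$ of $\mathcal{D}'_r(G,E)$ satisfying the formula. -/

import Mathlib

open scoped Manifold ContDiff Topology
open Set Filter Bundle

noncomputable section

namespace FiberedConvolution

/-! ### Lie groupoids -/

section Groupoid

variable (EG : Type*) [NormedAddCommGroup EG] [NormedSpace ℝ EG]
  (EB : Type*) [NormedAddCommGroup EB] [NormedSpace ℝ EB]
  (G : Type*) [TopologicalSpace G] [ChartedSpace EG G]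
  (B : Type*) [TopologicalSpace B] [ChartedSpace EB B]

/-- A Lie groupoid `G ⇉ B` with manifold of arrows `G` (modelled on `EG`) and manifold of units `B`
(modelled on `EB`). A pair `(γ, η)` is composable when `s γ = r η`. The product is written as a
total function whose values on non-composable pairs are irrelevant: every axiom, and every later
definition, only uses it on composable pairs. The set of composable pairs is an embedded submanifold
of `G × G`, because `s` and `r` are submersions, and smoothness on it as a manifold is the same
as `ContMDiffOn` (local existence of all derivatives within the set). -/
structure LieGroupoid where
  /-- range map -/
  r : G → B
  /-- source map -/
  s : G → B
  /-- unit map -/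
  one : B → G
  /-- inversion -/
  inv : G → G
  /-- product, meaningful on composable pairs -/
  mul : G → G → G
  r_one : ∀ x, r (one x) = x
  s_one : ∀ x, s (one x) = x
  r_inv : ∀ γ, r (inv γ) = s γ
  s_inv : ∀ γ, s (inv γ) = r γ
  r_mul : ∀ γ η, s γ = r η → r (mul γ η) = r γ
  s_mul : ∀ γ η, s γ = r η → s (mul γ η) = s η
  mul_assoc : ∀ γ η ζ, s γ = r η → s η = r ζ → mul (mul γ η) ζ = mul γ (mul η ζ)
  one_mul : ∀ γ, mul (one (r γ)) γ = γ
  mul_one : ∀ γ, mul γ (one (s γ)) = γ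
  mul_inv : ∀ γ, mul γ (inv γ) = one (r γ)
  inv_mul : ∀ γ, mul (inv γ) γ = one (s γ)
  isSubmersion_r : Manifold.IsSubmersion 𝓘(ℝ, EG) 𝓘(ℝ, EB) ∞ r
  isSubmersion_s : Manifold.IsSubmersion 𝓘(ℝ, EG) 𝓘(ℝ, EB) ∞ s
  contMDiff_one : ContMDiff 𝓘(ℝ, EB) 𝓘(ℝ, EG) ∞ one
  contMDiff_inv : ContMDiff 𝓘(ℝ, EG) 𝓘(ℝ, EG) ∞ inv
  contMDiffOn_mul : ContMDiffOn (𝓘(ℝ, EG).prod 𝓘(ℝ, EG)) 𝓘(ℝ, EG) ∞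
    (fun p : G × G => mul p.1 p.2) {p | s p.1 = r p.2}

end Groupoid

/-! ### Sections of the dual bundle and their topologies

`𝕜` is `ℝ` or `ℂ`, and `E → M` is a smooth `𝕜`-vector bundle of finite rank over a manifold `M`
modelled on `EM`. The dual bundle `E*` has fibres `Module.Dual 𝕜 (E p)`. -/

section Sections

variable (𝕜 : Type*) [RCLike 𝕜]
  (EM : Type*) [NormedAddCommGroup EM] [NormedSpace ℝ EM]
  {M : Type*} [TopologicalSpace M] [ChartedSpace EM M]
  (F : Type*) [NormedAddCommGroup F] [NormedSpace ℝ F]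
  (E : M → Type*) [TopologicalSpace (TotalSpace F E)] [∀ p, TopologicalSpace (E p)]
  [FiberBundle F E] [∀ p, AddCommGroup (E p)] [∀ p, Module 𝕜 (E p)]

/-- The space `C^∞(M, E*)` of smooth sections of `E*`, that is, of families of linear forms
`f p : E p → 𝕜` such that the fibrewise linear function `(p, e) ↦ f p e` is smooth on the total
space of `E`. -/
def SmoothSections : Submodule 𝕜 (∀ p : M, Module.Dual 𝕜 (E p)) where
  carrier := {f | ContMDiff (𝓘(ℝ, EM).prod 𝓘(ℝ, F)) 𝓘(ℝ, 𝕜) ∞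
    (fun e : TotalSpace F E => f e.proj e.2)}
  add_mem' hf hg := hf.add hg
  zero_mem' := contMDiff_const
  smul_mem' c f hf := by
    have h : ContDiff ℝ ∞ (fun z : 𝕜 => c * z) := contDiff_const.mul contDiff_id
    exact h.contMDiff.comp hf

/-- The support of a section of `E*`. -/
def supp {𝕜 : Type*} [RCLike 𝕜] {M : Type*} [TopologicalSpace M] {E : M → Type*}
    [∀ p, AddCommGroup (E p)] [∀ p, Module 𝕜 (E p)] (f : ∀ p : M, Module.Dual 𝕜 (E p)) : Set M :=
  closure {p | f p ≠ 0}

/-- The space `C^∞_c(M, E*)` of smooth compactly supported sections of `E*`. -/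
def TestSections : Submodule 𝕜 (∀ p : M, Module.Dual 𝕜 (E p)) where
  carrier := {f | f ∈ SmoothSections 𝕜 EM F E ∧ ∃ K : Set M, IsCompact K ∧ supp f ⊆ K}
  add_mem' := by
    rintro f g ⟨hf, K, hK, hfK⟩ ⟨hg, L, hL, hgL⟩
    refine ⟨Submodule.add_mem _ hf hg, K ∪ L, hK.union hL, ?_⟩
    refine (closure_mono (t := {p | f p ≠ 0} ∪ {p | g p ≠ 0}) ?_).trans ?_
    · intro p hp
      by_contra h
      have h₁ : f p = 0 := by_contra fun h' => h (Or.inl h')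
      have h₂ : g p = 0 := by_contra fun h' => h (Or.inr h')
      exact hp (by simp [h₁, h₂])
    · rw [closure_union]
      exact union_subset_union hfK hgL
  zero_mem' := ⟨Submodule.zero_mem _, ∅, isCompact_empty, by simp [supp]⟩
  smul_mem' := by
    rintro c f ⟨hf, K, hK, hfK⟩
    refine ⟨Submodule.smul_mem _ c hf, K, hK, (closure_mono ?_).trans hfK⟩
    intro p hp h
    exact hp (by simp [h])

/-- A compactly supported smooth section, seen as a smooth section. -/
def TestSections.toSmooth (f : TestSections 𝕜 EM F E) : SmoothSections 𝕜 EM F E :=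
  ⟨f.1, f.2.1⟩

/-- The open subset of `EM` on which the chart of `M` at `p₀` and the trivialization of `E` at `p₀`
provide coordinates. -/
def coordDomain (p₀ : M) : Set EM :=
  (chartAt EM p₀).target ∩ (chartAt EM p₀).symm ⁻¹' (trivializationAt F E p₀).baseSet

/-- The component of the section `f` of `E*` along the vector `v` of the model fibre, in the chart
of `M` and the trivialization of `E` at `p₀`. -/
def coordRep (f : ∀ p : M, Module.Dual 𝕜 (E p)) (p₀ : M) (v : F) (y : EM) : 𝕜 :=
  f ((chartAt EM p₀).symm y) ((trivializationAt F E p₀).symm ((chartAt EM p₀).symm y) v)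

/-- The usual (Fréchet) topology of `C^∞(M, E*)`: uniform convergence of all derivatives of all
components, on the compact subsets of the coordinate domains. -/
@[reducible]
def smoothTopology : TopologicalSpace (SmoothSections 𝕜 EM F E) :=
  ⨅ (p₀ : M) (v : F) (k : ℕ), TopologicalSpace.induced
    (fun f => UniformOnFun.ofFun {K | IsCompact K ∧ K ⊆ coordDomain EM F E p₀}
      (iteratedFDeriv ℝ k (coordRep 𝕜 EM F E f.1 p₀ v))) inferInstance

/-- The topology of the inductive limit of the spaces `C^∞_K(M, E*)`, `K ⊆ M` compact, in the
category of topological spaces. -/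
@[reducible]
def preTestTopology : TopologicalSpace (TestSections 𝕜 EM F E) :=
  ⨆ (K : Set M) (_ : IsCompact K), TopologicalSpace.coinduced
    (Subtype.val : {f : TestSections 𝕜 EM F E // supp f.1 ⊆ K} → TestSections 𝕜 EM F E)
    (TopologicalSpace.induced (fun f => TestSections.toSmooth 𝕜 EM F E f.1)
      (smoothTopology 𝕜 EM F E))

/-- The usual (LF) topology of `C^∞_c(M, E*)`: the finest locally convex vector space topology for
which the inclusions of the spaces `C^∞_K(M, E*)`, `K ⊆ M` compact, are continuous. -/
@[reducible]
def testTopology : TopologicalSpace (TestSections 𝕜 EM F E) :=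
  sInf {t | preTestTopology 𝕜 EM F E ≤ t ∧
    @IsTopologicalAddGroup (TestSections 𝕜 EM F E) t _ ∧
    @ContinuousSMul ℝ (TestSections 𝕜 EM F E) _ _ t ∧
    @LocallyConvexSpace ℝ (TestSections 𝕜 EM F E) _ _ _ _ t}

end Sections

/-! ### Fibered distributions -/

section Functions

variable (𝕜 : Type*) [RCLike 𝕜]
  (EB : Type*) [NormedAddCommGroup EB] [NormedSpace ℝ EB]
  (B : Type*) [TopologicalSpace B] [ChartedSpace EB B]

/-- The usual (Fréchet) topology of `C^∞(B, 𝕜)`: uniform convergence of all derivatives on the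
compact subsets of the chart domains. -/
@[reducible]
def functionTopology : TopologicalSpace C^∞⟮𝓘(ℝ, EB), B; 𝓘(ℝ, 𝕜), 𝕜⟯ :=
  ⨅ (x₀ : B) (k : ℕ), TopologicalSpace.induced
    (fun h => UniformOnFun.ofFun {K | IsCompact K ∧ K ⊆ (chartAt EB x₀).target}
      (iteratedFDeriv ℝ k (fun y => h ((chartAt EB x₀).symm y)))) inferInstance

end Functions

section ModuleMaps

variable {𝕜 : Type*} [RCLike 𝕜]
  {EB : Type*} [NormedAddCommGroup EB] [NormedSpace ℝ EB]
  {B : Type*} [TopologicalSpace B] [ChartedSpace EB B]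
  {M : Type*} {E : M → Type*} [∀ p, AddCommGroup (E p)] [∀ p, Module 𝕜 (E p)]

/-- `u`, defined on a space `T` of sections of `E*`, is a `C^∞(B)`-module map to `C^∞(B)`, where a
function `h` on `B` acts on sections as the multiplication by `h ∘ r`. -/
structure IsModuleMap (r : M → B) {T : Submodule 𝕜 (∀ p : M, Module.Dual 𝕜 (E p))}
    (u : T → C^∞⟮𝓘(ℝ, EB), B; 𝓘(ℝ, 𝕜), 𝕜⟯) : Prop where
  map_add : ∀ (f g : T) (x : B), u (f + g) x = u f x + u g x
  map_smul : ∀ (h : C^∞⟮𝓘(ℝ, EB), B; 𝓘(ℝ, 𝕜), 𝕜⟯) (f f' : T),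
    (∀ p, f'.1 p = h (r p) • f.1 p) → ∀ x, u f' x = h x * u f x

end ModuleMaps

section Distributions

variable (𝕜 : Type*) [RCLike 𝕜]
  (EB : Type*) [NormedAddCommGroup EB] [NormedSpace ℝ EB]
  {B : Type*} [TopologicalSpace B] [ChartedSpace EB B]
  (EM : Type*) [NormedAddCommGroup EM] [NormedSpace ℝ EM]
  {M : Type*} [TopologicalSpace M] [ChartedSpace EM M]
  (F : Type*) [NormedAddCommGroup F] [NormedSpace ℝ F]
  (E : M → Type*) [TopologicalSpace (TotalSpace F E)] [∀ p, TopologicalSpace (E p)]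
  [FiberBundle F E] [∀ p, AddCommGroup (E p)] [∀ p, Module 𝕜 (E p)]

/-- The space `𝓓'_r(M, E)` of `r`-fibered distributions on `M` with coefficients in `E`, for a
submersion `r : M → B`: continuous `C^∞(B)`-module maps `C^∞_c(M, E*) → C^∞(B)`. -/
@[ext]
structure FiberedDistribution (r : M → B) where
  toFun : TestSections 𝕜 EM F E → C^∞⟮𝓘(ℝ, EB), B; 𝓘(ℝ, 𝕜), 𝕜⟯
  isModuleMap : IsModuleMap r toFun
  continuous : Continuous[testTopology 𝕜 EM F E, functionTopology 𝕜 EB B] toFun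

/-- The space `𝓔'_r(M, E)` of `r`-fibered (fibrewise) compactly supported distributions on `M` with
coefficients in `E`: continuous `C^∞(B)`-module maps `C^∞(M, E*) → C^∞(B)`. -/
@[ext]
structure CompactFiberedDistribution (r : M → B) where
  toFun : SmoothSections 𝕜 EM F E → C^∞⟮𝓘(ℝ, EB), B; 𝓘(ℝ, 𝕜), 𝕜⟯
  isModuleMap : IsModuleMap r toFun
  continuous : Continuous[smoothTopology 𝕜 EM F E, functionTopology 𝕜 EB B] toFun

variable {𝕜 EB EM F E}
variable {r : M → B}

/-- `U ∈ 𝓔'_r(M, E)` extends `u ∈ 𝓓'_r(M, E)`. The inclusion of `𝓔'_r(M, E)` in `𝓓'_r(M, E)` is the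
restriction to compactly supported sections, so this says that `u` is the image of `U`. -/
def CompactFiberedDistribution.Extends (U : CompactFiberedDistribution 𝕜 EB EM F E r)
    (u : FiberedDistribution 𝕜 EB EM F E r) : Prop :=
  ∀ f : TestSections 𝕜 EM F E, U.toFun (TestSections.toSmooth 𝕜 EM F E f) = u.toFun f

/-- `u ∈ 𝓓'_r(M, E)` belongs to `𝓔'_r(M, E)`. -/
def FiberedDistribution.MemCompact (u : FiberedDistribution 𝕜 EB EM F E r) : Prop :=
  ∃ U : CompactFiberedDistribution 𝕜 EB EM F E r, U.Extends u

/-- The support of `u`: the complement of the largest open set such that `u` vanishes on the test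
sections supported in it. -/
def FiberedDistribution.support (u : FiberedDistribution 𝕜 EB EM F E r) : Set M :=
  {p | ∀ V : Set M, IsOpen V → p ∈ V →
    ∃ f : TestSections 𝕜 EM F E, supp f.1 ⊆ V ∧ u.toFun f ≠ 0}

/-- The restriction of a section to the fibre of `r` over `x`. -/
def restrictFiber (r : M → B) (x : B) (f : ∀ p : M, Module.Dual 𝕜 (E p)) :
    ∀ p : {p : M // r p = x}, Module.Dual 𝕜 (E p.1) :=
  fun p => f p.1

/-- `⟨u^x, g⟩` is well defined and equal to `c`, where `u^x` is the distribution induced by `u` on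
the fibre over `x`, characterized by `⟨u^x, f|_{r⁻¹(x)}⟩ = (u f)(x)` for all `f` in the domain `T`
of `u`: the section `g` over the fibre is the restriction of at least one `f` in `T`, and all these
`f` give the value `c`. -/
def HasFiberValue (r : M → B) {T : Submodule 𝕜 (∀ p : M, Module.Dual 𝕜 (E p))}
    (u : T → C^∞⟮𝓘(ℝ, EB), B; 𝓘(ℝ, 𝕜), 𝕜⟯) (x : B)
    (g : ∀ p : {p : M // r p = x}, Module.Dual 𝕜 (E p.1)) (c : 𝕜) : Prop :=
  (∃ f : T, restrictFiber r x f.1 = g) ∧ ∀ f : T, restrictFiber r x f.1 = g → u f x = c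

/-- `⟨u^x, g⟩` is well defined and equal to `c`, either because `g` is the restriction of a
compactly supported smooth section, or because `u` belongs to `𝓔'_r(M, E)` and `g` is the
restriction of a smooth section. -/
def FiberedDistribution.Pairs (u : FiberedDistribution 𝕜 EB EM F E r) (x : B)
    (g : ∀ p : {p : M // r p = x}, Module.Dual 𝕜 (E p.1)) (c : 𝕜) : Prop :=
  HasFiberValue r u.toFun x g c ∨
    ∃ U : CompactFiberedDistribution 𝕜 EB EM F E r, U.Extends u ∧ HasFiberValue r U.toFun x g c

end Distributions

/-! ### Multiplicative bundles and convolution -/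

section Convolution

variable (𝕜 : Type*) [RCLike 𝕜]
  {EG : Type*} [NormedAddCommGroup EG] [NormedSpace ℝ EG]
  {EB : Type*} [NormedAddCommGroup EB] [NormedSpace ℝ EB]
  {G : Type*} [TopologicalSpace G] [ChartedSpace EG G]
  {B : Type*} [TopologicalSpace B] [ChartedSpace EB B]
  (F : Type*) [NormedAddCommGroup F] [NormedSpace ℝ F]
  (E : G → Type*) [TopologicalSpace (TotalSpace F E)] [∀ γ, TopologicalSpace (E γ)]
  [FiberBundle F E] [∀ γ, AddCommGroup (E γ)] [∀ γ, Module 𝕜 (E γ)]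
  (𝒢 : LieGroupoid EG EB G B)

/-- A multiplicative structure on `E → G`: a smooth bundle map `p₁^* E ⊗ p₂^* E → E` over the
multiplication of composable pairs, given through the corresponding fibrewise bilinear maps
`E γ × E η → E (γη)`. As for the product of the groupoid, the values of `mulMap γ η` for
non-composable `(γ, η)` are irrelevant. -/
structure MultiplicativeStructure where
  mulMap : ∀ γ η : G, E γ →ₗ[𝕜] E η →ₗ[𝕜] E (𝒢.mul γ η)
  contMDiffOn_mulMap : ContMDiffOn
    ((𝓘(ℝ, EG).prod 𝓘(ℝ, F)).prod (𝓘(ℝ, EG).prod 𝓘(ℝ, F))) (𝓘(ℝ, EG).prod 𝓘(ℝ, F)) ∞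
    (fun q : TotalSpace F E × TotalSpace F E =>
      (⟨𝒢.mul q.1.proj q.2.proj, mulMap q.1.proj q.2.proj q.1.2 q.2.2⟩ : TotalSpace F E))
    {q | 𝒢.s q.1.proj = 𝒢.r q.2.proj}

variable {𝕜 F E 𝒢}

/-- A distribution on `G` is properly supported when `r` and `s` are proper maps on its support. -/
def IsProperlySupported (u : FiberedDistribution 𝕜 EB EG F E 𝒢.r) : Prop :=
  IsProperMap (fun γ : u.support => 𝒢.r γ) ∧ IsProperMap (fun γ : u.support => 𝒢.s γ)

/-- For `e ∈ E γ`, the contraction with `e` of `m^* φ (γ, ·)`: the section of `E*` over the fibre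
`r⁻¹(s γ)` whose value at `η` is the linear form `e' ↦ φ(γη)(m(e ⊗ e'))`. -/
def mulPullback (m : MultiplicativeStructure 𝕜 F E 𝒢) (φ : ∀ γ : G, Module.Dual 𝕜 (E γ))
    (γ : G) (e : E γ) : ∀ η : {η : G // 𝒢.r η = 𝒢.s γ}, Module.Dual 𝕜 (E η.1) :=
  fun η => (φ (𝒢.mul γ η.1)).comp (m.mulMap γ η.1 e)

/-- `w` is given by the convolution formula
`⟨w, φ⟩(x) = ⟨u^x(γ), ⟨v^{s(γ)}(η), m^* φ (γ, η)⟩⟩` for all `φ` in `C^∞_c(G, E*)`, all pairings in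
it being well defined: the inner pairings are the values `ψ γ ∈ (E γ)*` of a smooth section `ψ` of
`E*`, and `u^x` is paired with the restriction of `ψ` to the fibre `r⁻¹(x)`. -/
def IsConvolution (m : MultiplicativeStructure 𝕜 F E 𝒢)
    (u v w : FiberedDistribution 𝕜 EB EG F E 𝒢.r) : Prop :=
  ∀ φ : TestSections 𝕜 EG F E, ∃ ψ : SmoothSections 𝕜 EG F E,
    (∀ (γ : G) (e : E γ), v.Pairs (𝒢.s γ) (mulPullback m φ.1 γ e) (ψ.1 γ e)) ∧
    ∀ x : B, u.Pairs x (restrictFiber 𝒢.r x ψ.1) (w.toFun φ x)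

end Convolution

end FiberedConvolution

end

/-!
The convolution formula rests on two facts: the value `(u f)(x)` depends only on the
restriction of `f` to the fibre `r⁻¹(x)`, and fibered distributions map families of sections that
are smooth in parameters to families of functions that are smooth in the same parameters.

*Parameters.* The topologies of the spaces of sections enter only through families of sections
`c t`, with `t` in an arbitrary topological space `T`, whose components are smooth with derivatives
jointly continuous in `t` and the point (`ParamSmoothOn`, `SmoothFamily`). A map from `T` to the
smooth sections is continuous if and only if it is such a family (`continuous_smoothTopology_iff`,
and `continuous_functionTopology_iff` for functions on the base). Hence a distribution maps smooth
families to smooth families (`FiberedDistribution.paramSmoothOn_eval`), and a module map on test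
sections is continuous as soon as it does so for the tautological families of sections supported in
a compact set (`continuous_testTopology_functionTopology`). If a section depends *smoothly* on
additional variables, so does its pairing, jointly with the point of the base: difference quotients
form, together with their limit, a continuous family (`paramSmoothOn_diffQuotient`), so that one may
differentiate under the pairing (`FiberedDistribution.paramSmoothOn_eval_localSection_prod`).

*Locality.* Let the test section `f` vanish on `r⁻¹(x₀)`. Away from this fibre, `f` does not change
when it is multiplied by `h ∘ r`, for some `h` with `h x₀ = 0`. Near the fibre, use coordinates
`(y, z)` in which `r` is the projection to `y`, contract `f` to the fibre over `y₁ = y(x₀)` by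
`f_τ(y, z) = f(y₁ + τ (y - y₁), z)`, and cut off. The derivative of `f_τ` in `τ` is a combination of
the components of `y - y₁`, which are functions on the base, so the derivative of `(u f_τ)(x₀)`
vanishes by linearity over such functions, and `(u f)(x₀) = (u f_0)(x₀) = 0`
(`FiberedDistribution.eval_eq_zero_of_restrict`). By density of the test sections, the same holds
for distributions defined on all smooth sections.

*Inner pairing.* Let `φ` be supported near `ζ₁`, and let `γ` be near `γ₁`. If `r γ₁ ≠ r ζ₁`, the
section `m^* φ (γ, ·)` vanishes. Otherwise it is supported near `η₁ = γ₁⁻¹ ζ₁`, and the local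
projections to the fibres `r⁻¹(s γ)` given by a submersion chart at `η₁` extend it to a test section
depending smoothly on `γ` (`exists_local_extension`). A partition of unity yields extensions for all
test sections `φ`, and the inner pairings form a smooth section of `E*`, depending smoothly on `φ`
(`smoothFamily_innerPairing`).

*Outer pairing.* If `u` is defined on all smooth sections, it can be applied to this section. If `s`
is proper on the support of `v`, the section of inner pairings is supported in the compact set of
the products `ζ η⁻¹` with `ζ ∈ supp φ`, `η ∈ supp v` and `s η = s ζ`
(`exists_supp_innerPairing_subset`), so that every `u` can be applied to it. Uniqueness holds since
the values of both pairings are unique (`FiberedDistribution.Pairs.unique`).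
-/

set_option linter.unusedSectionVars false

open scoped Manifold ContDiff Topology
open Set Filter Bundle

namespace FiberedConvolution

/-! ### Smooth functions depending continuously on a parameter -/

section ParamSmooth

/-- `f t a` is `n` times differentiable in `a`, with derivatives up to order `n` that are jointly
continuous in `(t, a) ∈ O`. The parameter `t` ranges over an arbitrary topological space. The
derivatives are encoded as iterated directional derivatives. -/
def ParamContDiffOn {T A H : Type*} [TopologicalSpace T]
    [NormedAddCommGroup A] [NormedSpace ℝ A] [NormedAddCommGroup H] [NormedSpace ℝ H] :
    ℕ → (T → A → H) → Set (T × A) → Prop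
  | 0, f, O => ContinuousOn (fun p : T × A => f p.1 p.2) O
  | n + 1, f, O => ContinuousOn (fun p : T × A => f p.1 p.2) O ∧
      (∀ p ∈ O, DifferentiableAt ℝ (f p.1) p.2) ∧
      ∀ w : A, ParamContDiffOn n (fun t a => fderiv ℝ (f t) a w) O

/-- `f t a` is smooth in `a`, with all derivatives jointly continuous in `(t, a) ∈ O`. -/
def ParamSmoothOn {T A H : Type*} [TopologicalSpace T]
    [NormedAddCommGroup A] [NormedSpace ℝ A] [NormedAddCommGroup H] [NormedSpace ℝ H]
    (f : T → A → H) (O : Set (T × A)) : Prop :=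
  ∀ n, ParamContDiffOn n f O

variable {T A A' H H' H'' : Type*} [TopologicalSpace T]
  [NormedAddCommGroup A] [NormedSpace ℝ A] [NormedAddCommGroup A'] [NormedSpace ℝ A']
  [NormedAddCommGroup H] [NormedSpace ℝ H] [NormedAddCommGroup H'] [NormedSpace ℝ H']
  [NormedAddCommGroup H''] [NormedSpace ℝ H'']
  {f g : T → A → H} {O O' : Set (T × A)} {n : ℕ}

theorem slice_mem_nhds {T A : Type*} [TopologicalSpace T] [TopologicalSpace A] {O : Set (T × A)}
    (hO : IsOpen O) {t : T} {a : A} (h : (t, a) ∈ O) :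
    {x | (t, x) ∈ O} ∈ 𝓝 a :=
  (hO.preimage (Continuous.prodMk_right t)).mem_nhds h

theorem ParamContDiffOn.continuousOn (h : ParamContDiffOn n f O) :
    ContinuousOn (fun p : T × A => f p.1 p.2) O := by
  cases n with
  | zero => exact h
  | succ n => exact h.1

theorem ParamContDiffOn.of_succ (h : ParamContDiffOn (n + 1) f O) : ParamContDiffOn n f O := by
  induction n generalizing f with
  | zero => exact h.1
  | succ n ih => exact ⟨h.1, h.2.1, fun w => ih (h.2.2 w)⟩

theorem ParamContDiffOn.mono (h : ParamContDiffOn n f O) (hO : O' ⊆ O) :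
    ParamContDiffOn n f O' := by
  induction n generalizing f with
  | zero => exact ContinuousOn.mono h hO
  | succ n ih => exact ⟨h.1.mono hO, fun p hp => h.2.1 p (hO hp), fun w => ih (h.2.2 w)⟩

theorem ParamContDiffOn.congr (h : ParamContDiffOn n f O) (hO : IsOpen O)
    (he : ∀ t a, (t, a) ∈ O → g t a = f t a) : ParamContDiffOn n g O := by
  induction n generalizing f g with
  | zero => exact ContinuousOn.congr h fun p hp => he p.1 p.2 hp
  | succ n ih =>
    have ev : ∀ t a, (t, a) ∈ O → g t =ᶠ[𝓝 a] f t := fun t a hp => by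
      filter_upwards [slice_mem_nhds hO hp] with x hx using he t x hx
    refine ⟨h.1.congr fun p hp => he p.1 p.2 hp, fun p hp => ?_, fun w => ?_⟩
    · exact (h.2.1 p hp).congr_of_eventuallyEq (ev p.1 p.2 hp)
    · refine ih (h.2.2 w) fun t a hp => ?_
      rw [(ev t a hp).fderiv_eq]

theorem ParamContDiffOn.of_forall_mem
    (h : ∀ p ∈ O, ∃ V : Set (T × A), IsOpen V ∧ p ∈ V ∧ ParamContDiffOn n f V) :
    ParamContDiffOn n f O := by
  have hc : ∀ m, (∀ p ∈ O, ∃ V : Set (T × A), IsOpen V ∧ p ∈ V ∧ ParamContDiffOn m f V) →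
      ContinuousOn (fun p : T × A => f p.1 p.2) O := fun m h p hp => by
    obtain ⟨V, hV, hpV, hf⟩ := h p hp
    exact (hf.continuousOn.continuousAt (hV.mem_nhds hpV)).continuousWithinAt
  induction n generalizing f with
  | zero => exact hc 0 h
  | succ n ih =>
    refine ⟨hc _ h, fun p hp => ?_, fun w => ih (fun p hp => ?_) ?_⟩
    · obtain ⟨V, hV, hpV, hf⟩ := h p hp
      exact hf.2.1 p hpV
    · obtain ⟨V, hV, hpV, hf⟩ := h p hp
      exact ⟨V, hV, hpV, hf.2.2 w⟩
    · intro m h' p hp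
      obtain ⟨V, hV, hpV, hf⟩ := h' p hp
      exact (hf.continuousOn.continuousAt (hV.mem_nhds hpV)).continuousWithinAt

theorem ParamContDiffOn.add (hf : ParamContDiffOn n f O) (hg : ParamContDiffOn n g O)
    (hO : IsOpen O) : ParamContDiffOn n (fun t a => f t a + g t a) O := by
  induction n generalizing f g with
  | zero => exact ContinuousOn.add hf hg
  | succ n ih =>
    refine ⟨hf.1.add hg.1, fun p hp => (hf.2.1 p hp).add (hg.2.1 p hp), fun w => ?_⟩
    refine (ih (hf.2.2 w) (hg.2.2 w)).congr hO fun t a hp => ?_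
    rw [fderiv_fun_add (hf.2.1 _ hp) (hg.2.1 _ hp)]
    rfl

/-- A bounded bilinear expression in two families is as differentiable as the families. -/
theorem ParamContDiffOn.bilinear (b : H →L[ℝ] H' →L[ℝ] H'') {g : T → A → H'}
    (hf : ParamContDiffOn n f O) (hg : ParamContDiffOn n g O) (hO : IsOpen O) :
    ParamContDiffOn n (fun t a => b (f t a) (g t a)) O := by
  have hc : ∀ {f : T → A → H} {g : T → A → H'}, ContinuousOn (fun p : T × A => f p.1 p.2) O →
      ContinuousOn (fun p : T × A => g p.1 p.2) O →
      ContinuousOn (fun p : T × A => b (f p.1 p.2) (g p.1 p.2)) O := fun hf hg =>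
    (b.continuous.comp_continuousOn hf).clm_apply hg
  induction n generalizing f g with
  | zero => exact hc hf hg
  | succ n ih =>
    have hd : ∀ p ∈ O, HasFDerivAt (fun a => b (f p.1 a) (g p.1 a)) _ p.2 := fun p hp =>
      b.hasFDerivAt_of_bilinear (hf.2.1 p hp).hasFDerivAt (hg.2.1 p hp).hasFDerivAt
    refine ⟨hc hf.1 hg.1, fun p hp => (hd p hp).differentiableAt, fun w => ?_⟩
    refine ((ih hf.of_succ (hg.2.2 w)).add (ih (hf.2.2 w) hg.of_succ) hO).congr hO
      fun t a hp => ?_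
    rw [(hd _ hp).fderiv]
    simp

theorem ParamContDiffOn.of_contDiffOn {g : A → H} {Ω : Set A} (hg : ContDiffOn ℝ ∞ g Ω)
    (hΩ : IsOpen Ω) (hO : ∀ p ∈ O, p.2 ∈ Ω) : ParamContDiffOn n (fun _ : T => g) O := by
  have hc : ∀ {g : A → H}, ContDiffOn ℝ ∞ g Ω → ContinuousOn (fun p : T × A => g p.2) O :=
    fun hg => hg.continuousOn.comp continuousOn_snd hO
  induction n generalizing g with
  | zero => exact hc hg
  | succ n ih =>
    refine ⟨hc hg, fun p hp => ?_, fun w => ih ?_⟩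
    · exact (hg.contDiffAt (hΩ.mem_nhds (hO p hp))).differentiableAt (by simp)
    · exact (hg.fderiv_of_isOpen hΩ (m := ∞) (by simp)).clm_apply contDiffOn_const

theorem ParamContDiffOn.zero : ParamContDiffOn n (fun (_ : T) (_ : A) => (0 : H)) O :=
  of_contDiffOn (g := fun _ => 0) (Ω := univ) contDiffOn_const isOpen_univ (by simp)

theorem ParamContDiffOn.sum {ι : Type*} {s : Finset ι} {f : ι → T → A → H}
    (hf : ∀ i ∈ s, ParamContDiffOn n (f i) O) (hO : IsOpen O) :
    ParamContDiffOn n (fun t a => ∑ i ∈ s, f i t a) O := by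
  classical
  induction s using Finset.induction_on with
  | empty => simpa using ParamContDiffOn.zero
  | insert i s hi ih =>
    simp only [Finset.sum_insert hi]
    exact (hf i (by simp)).add (ih fun j hj => hf j (by simp [hj])) hO

/-- Composition with a smooth map that does not depend on the parameter. -/
theorem ParamContDiffOn.comp [FiniteDimensional ℝ A] {φ : A' → A} {Ω : Set A'}
    {V : Set (T × A')} (hf : ParamContDiffOn n f O) (hφ : ContDiffOn ℝ ∞ φ Ω) (hΩ : IsOpen Ω)
    (hV : IsOpen V) (h : ∀ p ∈ V, p.2 ∈ Ω ∧ (p.1, φ p.2) ∈ O) :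
    ParamContDiffOn n (fun t a => f t (φ a)) V := by
  have hc : ∀ {f : T → A → H}, ContinuousOn (fun p : T × A => f p.1 p.2) O →
      ContinuousOn (fun p : T × A' => f p.1 (φ p.2)) V := fun hf =>
    hf.comp (f := fun p : T × A' => (p.1, φ p.2))
      (continuousOn_fst.prodMk (hφ.continuousOn.comp continuousOn_snd fun p hp => (h p hp).1))
      fun p hp => (h p hp).2
  induction n generalizing f with
  | zero => exact hc hf
  | succ n ih =>
    have hφd : ∀ p ∈ V, DifferentiableAt ℝ φ p.2 := fun p hp =>
      (hφ.contDiffAt (hΩ.mem_nhds (h p hp).1)).differentiableAt (by simp)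
    have hd : ∀ p ∈ V, HasFDerivAt (fun a => f p.1 (φ a)) _ p.2 := fun p hp =>
      (hf.2.1 _ (h p hp).2).hasFDerivAt.comp p.2 (hφd p hp).hasFDerivAt
    refine ⟨hc hf.1, fun p hp => (hd p hp).differentiableAt, fun w => ?_⟩
    let b := Module.finBasis ℝ A
    have hcoef : ∀ i, ContDiffOn ℝ ∞ (fun a => b.equivFunL (fderiv ℝ φ a w) i) Ω := fun i => by
      have h1 : ContDiffOn ℝ ∞ (fun a => fderiv ℝ φ a w) Ω :=
        (hφ.fderiv_of_isOpen hΩ (m := ∞) (by simp)).clm_apply contDiffOn_const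
      exact (((ContinuousLinearMap.proj i : (Fin _ → ℝ) →L[ℝ] ℝ).comp
        (b.equivFunL : A →L[ℝ] Fin _ → ℝ)).contDiff.comp_contDiffOn h1)
    refine (ParamContDiffOn.sum (s := Finset.univ) (fun i _ =>
      ParamContDiffOn.bilinear (ContinuousLinearMap.lsmul ℝ ℝ : ℝ →L[ℝ] H →L[ℝ] H)
        (ParamContDiffOn.of_contDiffOn (T := T) (hcoef i) hΩ fun p hp => (h p hp).1)
        (ih (hf.2.2 (b i))) hV) hV).congr hV fun t a hp => ?_
    rw [(hd _ hp).fderiv]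
    conv_lhs => rw [ContinuousLinearMap.comp_apply, ← b.sum_equivFun (fderiv ℝ φ a w), map_sum]
    simp

/-- A smooth variable may be regarded as a parameter. -/
theorem ParamContDiffOn.curry {f : T → A' × A → H} {O : Set (T × (A' × A))}
    {V : Set ((T × A') × A)} (hf : ParamContDiffOn n f O)
    (h : ∀ p ∈ V, (p.1.1, (p.1.2, p.2)) ∈ O) (hV : IsOpen V) :
    ParamContDiffOn n (fun (s : T × A') a => f s.1 (s.2, a)) V := by
  have hc : ∀ {f : T → A' × A → H}, ContinuousOn (fun p : T × (A' × A) => f p.1 p.2) O →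
      ContinuousOn (fun p : (T × A') × A => f p.1.1 (p.1.2, p.2)) V := fun hf =>
    hf.comp (f := fun p : (T × A') × A => (p.1.1, (p.1.2, p.2))) (by fun_prop) h
  induction n generalizing f with
  | zero => exact hc hf
  | succ n ih =>
    have hd : ∀ p ∈ V, HasFDerivAt (fun a => f p.1.1 (p.1.2, a))
        ((fderiv ℝ (f p.1.1) (p.1.2, p.2)).comp (ContinuousLinearMap.inr ℝ A' A)) p.2 :=
      fun p hp => (hf.2.1 _ (h p hp)).hasFDerivAt.comp p.2 (hasFDerivAt_prodMk_right p.1.2 p.2)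
    refine ⟨hc hf.1, fun p hp => (hd p hp).differentiableAt, fun w => ?_⟩
    refine (ih (hf.2.2 (0, w))).congr hV fun t a hp => ?_
    rw [(hd _ hp).fderiv]
    simp

theorem ParamContDiffOn.contDiffOn [FiniteDimensional ℝ A] (hf : ParamContDiffOn n f O)
    (hO : IsOpen O) (t : T) : ContDiffOn ℝ n (f t) {a | (t, a) ∈ O} := by
  have hs : IsOpen {a | (t, a) ∈ O} := hO.preimage (Continuous.prodMk_right t)
  induction n generalizing f with
  | zero =>
    rw [Nat.cast_zero, contDiffOn_zero]
    exact ContinuousOn.comp (f := fun a : A => (t, a)) hf (by fun_prop) fun a ha => ha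
  | succ n ih =>
    have := (contDiffOn_succ_iff_fderiv_of_isOpen (𝕜 := ℝ) (n := (n : WithTop ℕ∞)) (f := f t) hs).2
      ⟨fun a ha => (hf.2.1 _ ha).differentiableWithinAt, by simp,
        contDiffOn_clm_apply.2 fun w => ih (hf.2.2 w)⟩
    exact_mod_cast this

theorem ParamSmoothOn.contDiffOn [FiniteDimensional ℝ A] (hf : ParamSmoothOn f O)
    (hO : IsOpen O) (t : T) : ContDiffOn ℝ ∞ (f t) {a | (t, a) ∈ O} :=
  contDiffOn_infty.2 fun n => (hf n).contDiffOn hO t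

theorem ParamSmoothOn.fderiv_apply (hf : ParamSmoothOn f O) (w : A) :
    ParamSmoothOn (fun t a => fderiv ℝ (f t) a w) O := fun n => (hf (n + 1)).2.2 w

theorem ParamSmoothOn.differentiableAt (hf : ParamSmoothOn f O) {t : T} {a : A}
    (h : (t, a) ∈ O) : DifferentiableAt ℝ (f t) a := (hf 1).2.1 _ h

theorem ParamSmoothOn.continuousOn (hf : ParamSmoothOn f O) :
    ContinuousOn (fun p : T × A => f p.1 p.2) O := hf 0

end ParamSmooth

/-! ### Iterated derivatives and difference quotients of families -/

section ParamSmooth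

variable {T A P H : Type*} [TopologicalSpace T]
  [NormedAddCommGroup A] [NormedSpace ℝ A] [NormedAddCommGroup P] [NormedSpace ℝ P]
  [NormedAddCommGroup H] [NormedSpace ℝ H]
  {f : T → A → H} {O : Set (T × A)}

/-- A family of continuous multilinear maps on a finite-dimensional space is continuous as soon as
all its evaluations are. -/
theorem continuousOn_multilinear_of_apply [FiniteDimensional ℝ A] {X : Type*} [TopologicalSpace X]
    {k : ℕ} {F : X → ContinuousMultilinearMap ℝ (fun _ : Fin k => A) H} {S : Set X}
    (h : ∀ v : Fin k → A, ContinuousOn (fun x => F x v) S) : ContinuousOn F S := by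
  induction k with
  | zero =>
    have := (continuousMultilinearCurryFin0 ℝ A H).symm.continuous.comp_continuousOn (h 0)
    refine this.congr fun x hx => ?_
    ext v
    simp [Subsingleton.elim v 0]
  | succ k ih =>
    have h1 : ContinuousOn (fun x => (F x).curryLeft) S :=
      continuousOn_clm_apply.2 fun w => ih fun v => by
        simpa using h (Fin.cons w v)
    have := (continuousMultilinearCurryLeftEquiv ℝ (fun _ : Fin (k + 1) => A)
      H).symm.continuous.comp_continuousOn h1
    exact this.congr fun x hx => ((continuousMultilinearCurryLeftEquiv ℝ (fun _ : Fin (k + 1) => A)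
      H).symm_apply_apply (F x)).symm

theorem iteratedFDeriv_fderiv_apply {φ : A → H} {s : Set A} (hs : IsOpen s)
    (hφ : ContDiffOn ℝ ∞ φ s) {a : A} (ha : a ∈ s) (k : ℕ) (v : Fin k → A) (w : A) :
    iteratedFDeriv ℝ k (fun x => fderiv ℝ φ x w) a v =
      iteratedFDeriv ℝ (k + 1) φ a (Fin.snoc v w) := by
  have hd := hφ.fderiv_of_isOpen hs (m := ∞) (by simp)
  rw [iteratedFDeriv_succ_apply_right, ← iteratedFDerivWithin_of_isOpen k hs ha,
    ← iteratedFDerivWithin_of_isOpen k hs ha,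
    iteratedFDerivWithin_clm_apply_const_apply hs.uniqueDiffOn hd (by exact_mod_cast le_top) ha]
  simp

theorem ParamSmoothOn.continuousOn_iteratedFDeriv [FiniteDimensional ℝ A]
    (hf : ParamSmoothOn f O) (hO : IsOpen O) (k : ℕ) :
    ContinuousOn (fun p : T × A => iteratedFDeriv ℝ k (f p.1) p.2) O := by
  refine continuousOn_multilinear_of_apply fun v => ?_
  induction k generalizing f with
  | zero => simpa using hf.continuousOn
  | succ k ih =>
    refine (ih (hf.fderiv_apply (v (Fin.last k))) (Fin.init v)).congr fun p hp => ?_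
    have hs : IsOpen {a | (p.1, a) ∈ O} := hO.preimage (Continuous.prodMk_right p.1)
    simp [iteratedFDeriv_fderiv_apply hs (hf.contDiffOn hO p.1) hp]

/-- Joint continuity of the iterated derivatives may be checked on evaluations, which are iterated
directional derivatives. -/
theorem ParamSmoothOn.of_iteratedFDeriv [FiniteDimensional ℝ A] (hO : IsOpen O)
    (hf : ∀ t, ContDiffOn ℝ ∞ (f t) {a | (t, a) ∈ O})
    (h : ∀ k, ContinuousOn (fun p : T × A => iteratedFDeriv ℝ k (f p.1) p.2) O) :
    ParamSmoothOn f O := by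
  have hev : ∀ {k : ℕ} (v : Fin k → A), Continuous
      (fun F : ContinuousMultilinearMap ℝ (fun _ : Fin k => A) H => F v) := fun v =>
    continuous_eval_const v
  intro n
  induction n generalizing f with
  | zero => exact ((hev 0).comp_continuousOn (h 0)).congr fun p hp => by simp
  | succ n ih =>
    have hs : ∀ t, IsOpen {a | (t, a) ∈ O} := fun t => hO.preimage (Continuous.prodMk_right t)
    refine ⟨((hev 0).comp_continuousOn (h 0)).congr fun p hp => by simp, fun p hp => ?_,
      fun w => ih (fun t => ?_) fun k => ?_⟩
    · exact ((hf p.1).contDiffAt ((hs p.1).mem_nhds hp)).differentiableAt (by simp)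
    · exact ((hf t).fderiv_of_isOpen (hs t) (m := ∞) (by simp)).clm_apply contDiffOn_const
    · refine continuousOn_multilinear_of_apply fun v => ?_
      refine ((hev (Fin.snoc v w : Fin (k + 1) → A)).comp_continuousOn (h (k + 1))).congr
        fun p hp => ?_
      exact iteratedFDeriv_fderiv_apply (hs p.1) (hf p.1) hp k v w

theorem fderiv_fderiv_apply_comm {φ : A → H} (hφ : ContDiff ℝ ∞ φ) (x u v : A) :
    fderiv ℝ (fun y => fderiv ℝ φ y u) x v = fderiv ℝ (fun y => fderiv ℝ φ y v) x u := by
  have hd : DifferentiableAt ℝ (fderiv ℝ φ) x :=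
    ((hφ.fderiv_right (m := ∞) (by simp)).differentiable (by simp)) x
  have hsymm : IsSymmSndFDerivAt ℝ φ x :=
    hφ.contDiffAt.isSymmSndFDerivAt (by simpa using! ENat.LEInfty.out)
  rw [fderiv_clm_apply hd (differentiableAt_const _),
    fderiv_clm_apply hd (differentiableAt_const _)]
  simpa using hsymm.eq v u

/-- The difference quotient, with step `h`, of `f t (y, a)` in the variable `y` along `δ`, completed
at `h = 0` by the derivative. The step is regarded as a part of the parameter. -/
noncomputable def diffQuotient (f : T → P × A → H) (δ : P) (s : ℝ × T × P) (a : A) : H :=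
  if s.1 = 0 then fderiv ℝ (f s.2.1) (s.2.2, a) (δ, 0)
  else s.1⁻¹ • (f s.2.1 (s.2.2 + s.1 • δ, a) - f s.2.1 (s.2.2, a))

theorem continuous_diffQuotient {f : T → P × A → H} (hf : ParamSmoothOn f univ) (δ : P) :
    Continuous (fun p : (ℝ × T × P) × A => diffQuotient f δ p.1 p.2) := by
  have hf0 : Continuous (fun p : T × (P × A) => f p.1 p.2) :=
    continuousOn_univ.1 hf.continuousOn
  have hf1 : Continuous (fun p : T × (P × A) => fderiv ℝ (f p.1) p.2 (δ, 0)) :=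
    continuousOn_univ.1 (hf.fderiv_apply (δ, 0)).continuousOn
  rw [continuous_iff_continuousAt]
  rintro ⟨⟨h₀, t₀, y₀⟩, a₀⟩
  by_cases hh : h₀ = 0
  · subst hh
    set c := fderiv ℝ (f t₀) (y₀, a₀) (δ, 0) with hc
    rw [ContinuousAt, Metric.tendsto_nhds]
    intro ε hε
    -- the derivative is close to `c` along the whole segment from `y` to `y + h • δ`
    have key : ∀ᶠ p : (ℝ × T × P) × A in 𝓝 ((0, t₀, y₀), a₀), ∀ θ ∈ Icc (0 : ℝ) 1,
        dist (fderiv ℝ (f p.1.2.1) (p.1.2.2 + (θ * p.1.1) • δ, p.2) (δ, 0)) c < ε / 2 := by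
      refine isCompact_Icc.eventually_forall_of_forall_eventually fun θ _ => ?_
      have hcont : Continuous (fun z : ((ℝ × T × P) × A) × ℝ =>
          fderiv ℝ (f z.1.1.2.1) (z.1.1.2.2 + (z.2 * z.1.1.1) • δ, z.1.2) (δ, 0)) :=
        hf1.comp (f := fun z : ((ℝ × T × P) × A) × ℝ =>
          (z.1.1.2.1, (z.1.1.2.2 + (z.2 * z.1.1.1) • δ, z.1.2))) (by fun_prop)
      have := hcont.tendsto (((0, t₀, y₀), a₀), θ)
      rw [Metric.tendsto_nhds] at this
      simpa [hc] using this (ε / 2) (half_pos hε)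
    filter_upwards [key] with p hp
    obtain ⟨⟨h, t, y⟩, a⟩ := p
    simp only [diffQuotient, if_true]
    rw [← hc]
    split_ifs with h0
    · subst h0
      have := hp 0 (by simp)
      simp only [mul_zero, zero_smul, add_zero] at this
      linarith
    · have hder : ∀ θ ∈ Icc (0 : ℝ) 1, HasDerivWithinAt
          (fun θ : ℝ => f t (y + (θ * h) • δ, a) - θ • h • c)
          (h • (fderiv ℝ (f t) (y + (θ * h) • δ, a) (δ, 0) - c)) (Icc 0 1) θ := fun θ _ => by
        have h1 : HasDerivAt (fun θ : ℝ => (y + (θ * h) • δ, a)) (h • ((δ, 0) : P × A)) θ := by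
          have : HasDerivAt (fun θ : ℝ => y + (θ * h) • δ) (h • δ) θ := by
            simpa using (((hasDerivAt_id θ).mul_const h).smul_const δ).const_add y
          simpa using this.prodMk (hasDerivAt_const θ a)
        have hd := (hf.differentiableAt (mem_univ (t, (y + (θ * h) • δ, a)))).hasFDerivAt
        have h2 := (hd.comp_hasDerivAt θ h1).sub ((hasDerivAt_id θ).smul_const (h • c))
        rw [map_smul, one_smul, ← smul_sub] at h2
        exact h2.hasDerivWithinAt
      have hbound := norm_image_sub_le_of_norm_deriv_le_segment_01' hder (C := |h| * (ε / 2))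
        fun θ hθ => by
          rw [norm_smul, Real.norm_eq_abs]
          have := (hp θ (Ico_subset_Icc_self hθ)).le
          rw [dist_eq_norm] at this
          exact mul_le_mul_of_nonneg_left this (abs_nonneg h)
      have hpos : 0 < |h| := abs_pos.2 h0
      have heq : h⁻¹ • (f t (y + h • δ, a) - f t (y, a)) - c =
          h⁻¹ • ((f t (y + ((1 : ℝ) * h) • δ, a) - (1 : ℝ) • h • c) -
            (f t (y + ((0 : ℝ) * h) • δ, a) - (0 : ℝ) • h • c)) := by
        simp only [one_mul, zero_mul, zero_smul, add_zero, sub_zero, one_smul]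
        rw [sub_right_comm, smul_sub _ _ (h • c), smul_smul, inv_mul_cancel₀ h0, one_smul]
      rw [dist_eq_norm, heq, norm_smul, norm_inv, Real.norm_eq_abs]
      calc |h|⁻¹ * _ ≤ |h|⁻¹ * (|h| * (ε / 2)) := by gcongr
        _ = ε / 2 := by field_simp
        _ < ε := by linarith
  · have hev : (fun p : (ℝ × T × P) × A => diffQuotient f δ p.1 p.2) =ᶠ[𝓝 ((h₀, t₀, y₀), a₀)]
        fun p => p.1.1⁻¹ • (f p.1.2.1 (p.1.2.2 + p.1.1 • δ, p.2) - f p.1.2.1 (p.1.2.2, p.2)) := by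
      have : ∀ᶠ p : (ℝ × T × P) × A in 𝓝 ((h₀, t₀, y₀), a₀), p.1.1 ≠ 0 :=
        (continuous_fst.fst.continuousAt (x := ((h₀, t₀, y₀), a₀))).eventually_ne hh
      filter_upwards [this] with p hp
      simp [diffQuotient, hp]
    refine ContinuousAt.congr ?_ hev.symm
    have c1 : Continuous fun p : (ℝ × T × P) × A => f p.1.2.1 (p.1.2.2 + p.1.1 • δ, p.2) :=
      hf0.comp (f := fun p : (ℝ × T × P) × A => (p.1.2.1, (p.1.2.2 + p.1.1 • δ, p.2)))
        (by fun_prop)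
    have c2 : Continuous fun p : (ℝ × T × P) × A => f p.1.2.1 (p.1.2.2, p.2) :=
      hf0.comp (f := fun p : (ℝ × T × P) × A => (p.1.2.1, (p.1.2.2, p.2))) (by fun_prop)
    exact (continuous_fst.fst.continuousAt.inv₀ hh).smul (c1.sub c2).continuousAt

/-- Difference quotients converge to the derivative together with all their derivatives in the
remaining variables. -/
theorem paramSmoothOn_diffQuotient [FiniteDimensional ℝ P] [FiniteDimensional ℝ A]
    {f : T → P × A → H} (hf : ParamSmoothOn f univ) (δ : P) :
    ParamSmoothOn (diffQuotient f δ) univ := by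
  intro n
  induction n generalizing f with
  | zero => exact (continuous_diffQuotient hf δ).continuousOn
  | succ n ih =>
    have hsm : ∀ t, ContDiff ℝ ∞ (f t) := fun t => by
      simpa [contDiffOn_univ] using hf.contDiffOn isOpen_univ t
    have hd : ∀ (F : P × A → H), Differentiable ℝ F → ∀ (y : P) (a : A),
        HasFDerivAt (fun a => F (y, a))
          ((fderiv ℝ F (y, a)).comp (ContinuousLinearMap.inr ℝ P A)) a := fun F hF y a =>
      (hF (y, a)).hasFDerivAt.comp a (hasFDerivAt_prodMk_right y a)
    have hmain : ∀ (s : ℝ × T × P) (a : A), ∃ D : A →L[ℝ] H,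
        HasFDerivAt (diffQuotient f δ s) D a ∧
        ∀ w, D w = diffQuotient (fun t x => fderiv ℝ (f t) x (0, w)) δ s a := by
      intro s a
      by_cases h0 : s.1 = 0
      · have hq : diffQuotient f δ s = fun a => fderiv ℝ (f s.2.1) (s.2.2, a) (δ, 0) := by
          ext a; simp [diffQuotient, h0]
        have hF : ContDiff ℝ ∞ (fun x => fderiv ℝ (f s.2.1) x (δ, 0)) :=
          ((hsm s.2.1).fderiv_right (m := ∞) (by simp)).clm_apply contDiff_const
        refine ⟨_, hq ▸ hd _ (hF.differentiable (by simp)) s.2.2 a, fun w => ?_⟩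
        simp only [diffQuotient, h0, if_true, ContinuousLinearMap.comp_apply,
          ContinuousLinearMap.inr_apply]
        exact fderiv_fderiv_apply_comm (hsm s.2.1) _ _ _
      · have hq : diffQuotient f δ s = fun a =>
            s.1⁻¹ • (f s.2.1 (s.2.2 + s.1 • δ, a) - f s.2.1 (s.2.2, a)) := by
          ext a; simp [diffQuotient, h0]
        have hF := (hsm s.2.1).differentiable (by simp)
        have hD := HasFDerivAt.const_smul (R := ℝ)
          ((hd _ hF (s.2.2 + s.1 • δ) a).sub (hd _ hF s.2.2 a)) s.1⁻¹
        refine ⟨_, hD.congr_of_eventuallyEq (Eventually.of_forall fun a => congrFun hq a),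
          fun w => ?_⟩
        simp [diffQuotient, h0]
    refine ⟨(continuous_diffQuotient hf δ).continuousOn, fun p _ => ?_, fun w => ?_⟩
    · obtain ⟨D, hD, -⟩ := hmain p.1 p.2
      exact hD.differentiableAt
    · refine (ih (hf.fderiv_apply (0, w))).congr isOpen_univ fun s a _ => ?_
      obtain ⟨D, hD, hw⟩ := hmain s a
      rw [hD.fderiv, hw]

/-- A class of continuous functions whose directional derivatives are sums of two members of the
class consists of smooth functions. -/
theorem paramSmoothOn_of_class (𝓕 : Set (T → A → H)) (hO : IsOpen O)
    (hc : ∀ f ∈ 𝓕, ContinuousOn (fun p : T × A => f p.1 p.2) O)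
    (hd : ∀ f ∈ 𝓕, ∀ p ∈ O, DifferentiableAt ℝ (f p.1) p.2)
    (hw : ∀ f ∈ 𝓕, ∀ w : A, ∃ g₁ ∈ 𝓕, ∃ g₂ ∈ 𝓕, ∀ t a, (t, a) ∈ O →
      fderiv ℝ (f t) a w = g₁ t a + g₂ t a) (hf : f ∈ 𝓕) : ParamSmoothOn f O := by
  intro n
  induction n generalizing f with
  | zero => exact hc f hf
  | succ n ih =>
    refine ⟨hc f hf, hd f hf, fun w => ?_⟩
    obtain ⟨g₁, h₁, g₂, h₂, he⟩ := hw f hf w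
    exact ((ih h₁).add (ih h₂) hO).congr hO he

/-- Continuity for the topology of uniform convergence on the compact subsets of an open set is
joint continuity. -/
theorem continuous_uniformOnFun_iff {T A : Type*} [TopologicalSpace T] [TopologicalSpace A]
    [LocallyCompactSpace A] {Y : Type*} [UniformSpace Y] {Ω : Set A} (hΩ : IsOpen Ω)
    {φ : T → A → Y} (hφ : ∀ t, ContinuousOn (φ t) Ω) :
    Continuous (fun t => UniformOnFun.ofFun {K | IsCompact K ∧ K ⊆ Ω} (φ t)) ↔
      ContinuousOn (fun p : T × A => φ p.1 p.2) (univ ×ˢ Ω) := by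
  constructor
  · rintro h ⟨t, a⟩ ⟨-, ha⟩
    obtain ⟨K, hK, haK, hKΩ⟩ := exists_compact_subset hΩ ha
    have h1 := UniformOnFun.tendsto_iff_tendstoUniformlyOn.1 (h.tendsto t) K ⟨hK, hKΩ⟩
    refine ContinuousAt.continuousWithinAt ?_
    have h2 : ContinuousAt (φ t) a := (hφ t).continuousAt (hΩ.mem_nhds ha)
    rw [ContinuousAt, Uniform.tendsto_nhds_right] at h2 ⊢
    intro V hV
    obtain ⟨W, hW, hWV⟩ := comp_mem_uniformity_sets hV
    have h3 := h1 W hW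
    have h4 : ∀ᶠ x in 𝓝 a, x ∈ K ∧ (φ t a, φ t x) ∈ W :=
      (Filter.eventually_of_mem (isOpen_interior.mem_nhds haK) fun x hx => interior_subset hx).and
        (h2 hW)
    rw [nhds_prod_eq]
    rw [Filter.mem_map]
    filter_upwards [h3.prod_mk h4] with p hp
    exact hWV ⟨_, hp.2.2, hp.1 _ hp.2.1⟩
  · intro h
    rw [UniformOnFun.continuous_rng_iff]
    rintro K ⟨hK, hKΩ⟩
    have : CompactSpace K := isCompact_iff_compactSpace.1 hK
    let ψ : T → C(K, Y) := fun t => ⟨_, ((hφ t).mono hKΩ).domRestrict⟩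
    have hψ : Continuous ψ := ContinuousMap.continuous_of_continuous_uncurry ψ
      (h.comp_continuous (f := fun p : T × K => (p.1, (p.2 : A))) (by fun_prop)
        fun p => ⟨mem_univ _, hKΩ p.2.2⟩)
    exact (ContinuousMap.continuous_iff_continuous_uniformFun ψ).1 hψ

end ParamSmooth

/-! ### Smooth families of sections of the dual bundle -/

section Families

variable {𝕜 : Type*} [RCLike 𝕜]
  {EM : Type*} [NormedAddCommGroup EM] [NormedSpace ℝ EM] [FiniteDimensional ℝ EM]
  {M : Type*} [TopologicalSpace M] [ChartedSpace EM M] [IsManifold 𝓘(ℝ, EM) ∞ M]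
  {F : Type*} [NormedAddCommGroup F] [NormedSpace ℝ F] [NormedSpace 𝕜 F] [IsScalarTower ℝ 𝕜 F]
  [FiniteDimensional ℝ F]
  {E : M → Type*} [TopologicalSpace (TotalSpace F E)] [∀ p, TopologicalSpace (E p)]
  [FiberBundle F E] [∀ p, AddCommGroup (E p)] [∀ p, Module ℝ (E p)] [∀ p, Module 𝕜 (E p)]
  [VectorBundle 𝕜 F E] [VectorBundle ℝ F E] [ContMDiffVectorBundle ∞ F E 𝓘(ℝ, EM)]
  {T A : Type*} [TopologicalSpace T]
  [NormedAddCommGroup A] [NormedSpace ℝ A]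

variable (𝕜 EM F E) in
/-- `c` is a family of sections of `E*`, smooth on `M` and depending continuously on the parameter
together with all derivatives: all its components in the preferred coordinates have this
property. -/
def SmoothFamily (c : T → ∀ p : M, Module.Dual 𝕜 (E p)) : Prop :=
  ∀ (p₀ : M) (v : F), ParamSmoothOn (fun t => coordRep 𝕜 EM F E (c t) p₀ v)
    (univ ×ˢ coordDomain EM F E p₀)

theorem isOpen_coordDomain (p₀ : M) : IsOpen (coordDomain EM F E p₀) :=
  (chartAt EM p₀).isOpen_inter_preimage_symm (trivializationAt F E p₀).open_baseSet

theorem contMDiffOn_chartAt_symm_coordDomain (p₀ : M) :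
    ContMDiffOn 𝓘(ℝ, EM) 𝓘(ℝ, EM) ∞ (chartAt EM p₀).symm (coordDomain EM F E p₀) :=
  (contMDiffOn_chart_symm (I := 𝓘(ℝ, EM)) (x := p₀)).mono inter_subset_left

/-- The local section of the bundle which is constant in a trivialization is smooth. -/
theorem contMDiffOn_symm_comp {e : Trivialization F (π F E)} [MemTrivializationAtlas e]
    {EN : Type*} [NormedAddCommGroup EN] [NormedSpace ℝ EN] {N : Type*} [TopologicalSpace N]
    [ChartedSpace EN N] {q : N → M} {S : Set N} (hq : ContMDiffOn 𝓘(ℝ, EN) 𝓘(ℝ, EM) ∞ q S)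
    (hS : ∀ x ∈ S, q x ∈ e.baseSet) (v : F) :
    ContMDiffOn 𝓘(ℝ, EN) (𝓘(ℝ, EM).prod 𝓘(ℝ, F)) ∞
      (fun x => (⟨q x, e.symm (q x) v⟩ : TotalSpace F E)) S := by
  have h1 : ContMDiffOn 𝓘(ℝ, EN) (𝓘(ℝ, EM).prod 𝓘(ℝ, F)) ∞ (fun x => (q x, v)) S :=
    hq.prodMk contMDiffOn_const
  refine ((e.contMDiffOn_symm (IB := 𝓘(ℝ, EM)) (n := ∞)).comp h1 fun x hx => ?_).congr
    fun x hx => ?_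
  · simpa [e.target_eq] using hS x hx
  · exact e.mk_symm (hS x hx) v

theorem _root_.ContMDiffAt.mul_rclike {EN : Type*} [NormedAddCommGroup EN] [NormedSpace ℝ EN]
    {HN : Type*} [TopologicalSpace HN] {I : ModelWithCorners ℝ EN HN} {N : Type*}
    [TopologicalSpace N] [ChartedSpace HN N] {f g : N → 𝕜} {x : N}
    (hf : ContMDiffAt I 𝓘(ℝ, 𝕜) ∞ f x) (hg : ContMDiffAt I 𝓘(ℝ, 𝕜) ∞ g x) :
    ContMDiffAt I 𝓘(ℝ, 𝕜) ∞ (fun y => f y * g y) x := by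
  have h : ContDiff ℝ ∞ (fun z : 𝕜 × 𝕜 => z.1 * z.2) := contDiff_mul
  exact h.contMDiff.contMDiffAt.comp x (hf.prodMk_space hg)

variable (𝕜 F) in
theorem finiteDimensional_fiber : FiniteDimensional 𝕜 F := FiniteDimensional.right ℝ 𝕜 F

theorem contDiff_dual (l : F →ₗ[𝕜] 𝕜) : ContDiff ℝ ∞ l :=
  (LinearMap.toContinuousLinearMap (l.restrictScalars ℝ)).contDiff

/-- A section of `E*` is expressed through its components in a trivialization. -/
theorem apply_eq_sum_coord {ι : Type*} [Fintype ι] (b : Module.Basis ι 𝕜 F)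
    (e : Trivialization F (π F E)) [e.IsLinear 𝕜] {p : M} (hp : p ∈ e.baseSet)
    (l : Module.Dual 𝕜 (E p)) (z : E p) :
    l z = ∑ j, b.coord j (e ⟨p, z⟩).2 * l (e.symm p (b j)) := by
  have h1 : z = e.symmₗ 𝕜 p (e ⟨p, z⟩).2 := by
    rw [e.symmₗ_apply hp]; exact (e.symm_apply_apply_mk hp z).symm
  conv_lhs => rw [h1, ← b.sum_repr (e ⟨p, z⟩).2, map_sum, map_sum]
  refine Finset.sum_congr rfl fun j _ => ?_
  rw [map_smul, map_smul, e.symmₗ_apply hp]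
  rfl

theorem apply_eq_sum_coordRep {ι : Type*} [Fintype ι] (b : Module.Basis ι 𝕜 F)
    (f : ∀ p : M, Module.Dual 𝕜 (E p)) (p₀ : M) {z : TotalSpace F E}
    (h1 : z.proj ∈ (chartAt EM p₀).source) (h2 : z.proj ∈ (trivializationAt F E p₀).baseSet) :
    f z.proj z.2 = ∑ j, b.coord j (trivializationAt F E p₀ z).2 *
      coordRep 𝕜 EM F E f p₀ (b j) (chartAt EM p₀ z.proj) := by
  rw [apply_eq_sum_coord b (trivializationAt F E p₀) h2 (f z.proj) z.2]
  simp only [coordRep]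
  rw [(chartAt EM p₀).left_inv h1]

theorem contDiffOn_coordRep {f : ∀ p : M, Module.Dual 𝕜 (E p)}
    (hf : f ∈ SmoothSections 𝕜 EM F E) (p₀ : M) (v : F) :
    ContDiffOn ℝ ∞ (coordRep 𝕜 EM F E f p₀ v) (coordDomain EM F E p₀) := by
  rw [← contMDiffOn_iff_contDiffOn]
  have hf' : ContMDiff (𝓘(ℝ, EM).prod 𝓘(ℝ, F)) 𝓘(ℝ, 𝕜) ∞
    (fun e : TotalSpace F E => f e.proj e.2) := hf
  exact hf'.comp_contMDiffOn (contMDiffOn_symm_comp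
    (contMDiffOn_chartAt_symm_coordDomain (F := F) (E := E) p₀) (fun y hy => hy.2) v)

theorem contMDiffOn_trivialization_snd (e : Trivialization F (π F E)) [MemTrivializationAtlas e] :
    ContMDiffOn (𝓘(ℝ, EM).prod 𝓘(ℝ, F)) 𝓘(ℝ, F) ∞ (fun z : TotalSpace F E => (e z).2) e.source :=
  contMDiff_snd.comp_contMDiffOn (e.contMDiffOn (IB := 𝓘(ℝ, EM)) (n := ∞))

/-- Smoothness of a section, as a function on the total space of the bundle, follows from the
smoothness of its components. -/
theorem mem_smoothSections_of_contDiffOn {f : ∀ p : M, Module.Dual 𝕜 (E p)}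
    (hf : ∀ p₀ v, ContDiffOn ℝ ∞ (coordRep 𝕜 EM F E f p₀ v) (coordDomain EM F E p₀)) :
    f ∈ SmoothSections 𝕜 EM F E := by
  intro z₀
  have := finiteDimensional_fiber 𝕜 F
  let b := Module.finBasis 𝕜 F
  set e := trivializationAt F E z₀.proj
  set φ := chartAt EM z₀.proj
  have hz1 : z₀.proj ∈ φ.source := mem_chart_source _ _
  have hz2 : z₀.proj ∈ e.baseSet := mem_baseSet_trivializationAt F E z₀.proj
  have hU : {z : TotalSpace F E | z.proj ∈ φ.source ∩ e.baseSet} ∈ 𝓝 z₀ :=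
    ((φ.open_source.inter e.open_baseSet).preimage (FiberBundle.continuous_proj F E)).mem_nhds
      ⟨hz1, hz2⟩
  have hsum : ContMDiffAt (𝓘(ℝ, EM).prod 𝓘(ℝ, F)) 𝓘(ℝ, 𝕜) ∞ (fun z : TotalSpace F E =>
      ∑ j, b.coord j (e z).2 * coordRep 𝕜 EM F E f z₀.proj (b j) (φ z.proj)) z₀ := by
    refine ContMDiffAt.sum fun j _ => ContMDiffAt.mul_rclike ?_ ?_
    · exact (contDiff_dual (b.coord j)).contMDiff.contMDiffAt.comp z₀
        ((contMDiffOn_trivialization_snd e).contMDiffAt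
          (e.open_source.mem_nhds (e.mem_source.2 hz2)))
    · have h1 : ContMDiffAt 𝓘(ℝ, EM) 𝓘(ℝ, 𝕜) ∞ (coordRep 𝕜 EM F E f z₀.proj (b j))
          (φ z₀.proj) :=
        ((hf z₀.proj (b j)).contDiffAt ((isOpen_coordDomain z₀.proj).mem_nhds
          ⟨φ.map_source hz1, by rw [mem_preimage, φ.left_inv hz1]; exact hz2⟩)).contMDiffAt
      have h2 : ContMDiffAt (𝓘(ℝ, EM).prod 𝓘(ℝ, F)) 𝓘(ℝ, EM) ∞
          (fun z : TotalSpace F E => φ z.proj) z₀ :=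
        ((contMDiffOn_chart (I := 𝓘(ℝ, EM)) (x := z₀.proj)).contMDiffAt
          (φ.open_source.mem_nhds hz1)).comp z₀ (contMDiff_proj E z₀)
      exact h1.comp z₀ h2
  refine hsum.congr_of_eventuallyEq ?_
  filter_upwards [hU] with z hz
  exact apply_eq_sum_coordRep b f z₀.proj hz.1 hz.2

theorem SmoothFamily.mem_smoothSections {c : T → ∀ p : M, Module.Dual 𝕜 (E p)}
    (hc : SmoothFamily 𝕜 EM F E c) (t : T) : c t ∈ SmoothSections 𝕜 EM F E :=
  mem_smoothSections_of_contDiffOn fun p₀ v => by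
    simpa using (hc p₀ v).contDiffOn (isOpen_univ.prod (isOpen_coordDomain p₀)) t

theorem SmoothFamily.mul {c : T → ∀ p : M, Module.Dual 𝕜 (E p)}
    (hc : SmoothFamily 𝕜 EM F E c) {ρ : M → 𝕜} (hρ : ContMDiff 𝓘(ℝ, EM) 𝓘(ℝ, 𝕜) ∞ ρ) :
    SmoothFamily 𝕜 EM F E (fun t p => ρ p • c t p) := fun p₀ v n => by
  have h1 : ContDiffOn ℝ ∞ (fun y => ρ ((chartAt EM p₀).symm y)) (coordDomain EM F E p₀) := by
    rw [← contMDiffOn_iff_contDiffOn]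
    exact hρ.comp_contMDiffOn (contMDiffOn_chartAt_symm_coordDomain p₀)
  exact ParamContDiffOn.bilinear (ContinuousLinearMap.mul ℝ 𝕜)
    (ParamContDiffOn.of_contDiffOn h1 (isOpen_coordDomain p₀) fun p hp => hp.2) (hc p₀ v n)
    (isOpen_univ.prod (isOpen_coordDomain p₀))

theorem smoothFamily_const {f : ∀ p : M, Module.Dual 𝕜 (E p)} (hf : f ∈ SmoothSections 𝕜 EM F E) :
    SmoothFamily 𝕜 EM F E (fun _ : T => f) := fun p₀ v _ =>
  ParamContDiffOn.of_contDiffOn (contDiffOn_coordRep hf p₀ v) (isOpen_coordDomain p₀)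
    fun _ hp => hp.2

/-- Evaluation of a smooth family along a smooth map into the total space of the bundle. -/
theorem SmoothFamily.eval {c : T → ∀ p : M, Module.Dual 𝕜 (E p)}
    (hc : SmoothFamily 𝕜 EM F E c) {q : A → TotalSpace F E} {Ω : Set A} (hΩ : IsOpen Ω)
    (hq : ContMDiffOn 𝓘(ℝ, A) (𝓘(ℝ, EM).prod 𝓘(ℝ, F)) ∞ q Ω) :
    ParamSmoothOn (fun t a => c t (q a).proj (q a).2) (univ ×ˢ Ω) := by
  intro n
  have := finiteDimensional_fiber 𝕜 F
  let b := Module.finBasis 𝕜 F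
  refine ParamContDiffOn.of_forall_mem ?_
  rintro ⟨t₀, a₀⟩ ⟨-, ha₀⟩
  set e := trivializationAt F E (q a₀).proj
  set φ := chartAt EM (q a₀).proj
  let Ω' := Ω ∩ q ⁻¹' {z : TotalSpace F E | z.proj ∈ φ.source ∩ e.baseSet}
  have hΩ' : IsOpen Ω' := hq.continuousOn.isOpen_inter_preimage hΩ
    ((φ.open_source.inter e.open_baseSet).preimage (FiberBundle.continuous_proj F E))
  have hq' : ContMDiffOn 𝓘(ℝ, A) (𝓘(ℝ, EM).prod 𝓘(ℝ, F)) ∞ q Ω' := hq.mono inter_subset_left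
  have h1 : ContDiffOn ℝ ∞ (fun a => φ (q a).proj) Ω' := by
    rw [← contMDiffOn_iff_contDiffOn]
    exact (contMDiffOn_chart (I := 𝓘(ℝ, EM)) (x := (q a₀).proj)).comp
      ((contMDiff_proj E).comp_contMDiffOn hq') fun a ha => ha.2.1
  have h2 : ∀ j, ContDiffOn ℝ ∞ (fun a => b.coord j (e (q a)).2) Ω' := fun j => by
    rw [← contMDiffOn_iff_contDiffOn]
    exact (contDiff_dual (b.coord j)).contMDiff.comp_contMDiffOn
      ((contMDiffOn_trivialization_snd e).comp hq' fun a ha => e.mem_source.2 ha.2.2)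
  have hV : IsOpen (univ ×ˢ Ω' : Set (T × A)) := isOpen_univ.prod hΩ'
  refine ⟨univ ×ˢ Ω', hV, ⟨mem_univ _, ha₀, mem_chart_source _ _,
    mem_baseSet_trivializationAt F E _⟩, ?_⟩
  refine (ParamContDiffOn.sum (s := Finset.univ) (fun j _ =>
    ParamContDiffOn.bilinear (ContinuousLinearMap.mul ℝ 𝕜)
      (ParamContDiffOn.of_contDiffOn (T := T) (h2 j) hΩ' fun p hp => hp.2)
      ((hc (q a₀).proj (b j) n).comp h1 hΩ' hV fun p hp => ⟨hp.2, mem_univ _,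
        φ.map_source hp.2.2.1, ?_⟩) hV) hV).congr hV fun t a ha => ?_
  · rw [mem_preimage, φ.left_inv hp.2.2.1]; exact hp.2.2.2
  · exact apply_eq_sum_coordRep b (c t) (q a₀).proj ha.2.2.1 ha.2.2.2

/-- A map into the space of smooth sections is continuous exactly when it is a smooth family. -/
theorem continuous_smoothTopology_iff (c : T → SmoothSections 𝕜 EM F E) :
    Continuous[_, smoothTopology 𝕜 EM F E] c ↔ SmoothFamily 𝕜 EM F E (fun t => (c t).1) := by
  have hsm : ∀ p₀ v t, ContDiffOn ℝ ∞ (coordRep 𝕜 EM F E (c t).1 p₀ v)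
      (coordDomain EM F E p₀) := fun p₀ v t => contDiffOn_coordRep (c t).2 p₀ v
  have hO : ∀ p₀, IsOpen (univ ×ˢ coordDomain EM F E p₀ : Set (T × EM)) := fun p₀ =>
    isOpen_univ.prod (isOpen_coordDomain p₀)
  have hder : ∀ p₀ v k t, ContinuousOn (iteratedFDeriv ℝ k (coordRep 𝕜 EM F E (c t).1 p₀ v))
      (coordDomain EM F E p₀) := fun p₀ v k t =>
    ((hsm p₀ v t).continuousOn_iteratedFDerivWithin (m := k) (by exact_mod_cast le_top)
      (isOpen_coordDomain p₀).uniqueDiffOn).congr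
      fun y hy => (iteratedFDerivWithin_of_isOpen k (isOpen_coordDomain p₀) hy).symm
  have hiff : Continuous[_, smoothTopology 𝕜 EM F E] c ↔ ∀ p₀ v k, ContinuousOn
      (fun p : T × EM => iteratedFDeriv ℝ k (coordRep 𝕜 EM F E (c p.1).1 p₀ v) p.2)
      (univ ×ˢ coordDomain EM F E p₀) := by
    simp only [continuous_iInf_rng, continuous_induced_rng]
    refine forall_congr' fun p₀ => forall_congr' fun v => forall_congr' fun k => ?_
    exact continuous_uniformOnFun_iff (isOpen_coordDomain p₀) (hder p₀ v k)
  rw [hiff]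
  refine forall_congr' fun p₀ => forall_congr' fun v => ⟨fun h => ?_, fun h k => ?_⟩
  · exact ParamSmoothOn.of_iteratedFDeriv (hO p₀) (fun t => by simpa using hsm p₀ v t) h
  · exact h.continuousOn_iteratedFDeriv (hO p₀) k

end Families

/-! ### Distributions applied to smooth families -/

section Functions

variable {𝕜 : Type*} [RCLike 𝕜]
  {EB : Type*} [NormedAddCommGroup EB] [NormedSpace ℝ EB] [FiniteDimensional ℝ EB]
  {B : Type*} [TopologicalSpace B] [ChartedSpace EB B] [IsManifold 𝓘(ℝ, EB) ∞ B]
  {T : Type*} [TopologicalSpace T]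

theorem contDiffOn_comp_chartAt_symm (h : C^∞⟮𝓘(ℝ, EB), B; 𝓘(ℝ, 𝕜), 𝕜⟯) (x₀ : B) :
    ContDiffOn ℝ ∞ (fun y => h ((chartAt EB x₀).symm y)) (chartAt EB x₀).target := by
  rw [← contMDiffOn_iff_contDiffOn]
  exact h.contMDiff.comp_contMDiffOn (contMDiffOn_chart_symm (I := 𝓘(ℝ, EB)) (x := x₀))

theorem continuousOn_iteratedFDeriv_comp_chartAt_symm (h : C^∞⟮𝓘(ℝ, EB), B; 𝓘(ℝ, 𝕜), 𝕜⟯) (x₀ : B)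
    (k : ℕ) : ContinuousOn (iteratedFDeriv ℝ k (fun y => h ((chartAt EB x₀).symm y)))
      (chartAt EB x₀).target :=
  ((contDiffOn_comp_chartAt_symm h x₀).continuousOn_iteratedFDerivWithin (m := k)
    (by exact_mod_cast le_top) (chartAt EB x₀).open_target.uniqueDiffOn).congr
    fun _ hy => (iteratedFDerivWithin_of_isOpen k (chartAt EB x₀).open_target hy).symm

/-- A map into the space of smooth functions on the base is continuous exactly when it is a smooth
family. -/
theorem continuous_functionTopology_iff {c : T → C^∞⟮𝓘(ℝ, EB), B; 𝓘(ℝ, 𝕜), 𝕜⟯} :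
    Continuous[_, functionTopology 𝕜 EB B] c ↔ ∀ x₀ : B,
      ParamSmoothOn (fun t y => c t ((chartAt EB x₀).symm y)) (univ ×ˢ (chartAt EB x₀).target) := by
  have hO : ∀ x₀ : B, IsOpen (univ ×ˢ (chartAt EB x₀).target : Set (T × EB)) := fun x₀ =>
    isOpen_univ.prod (chartAt EB x₀).open_target
  have hiff : Continuous[_, functionTopology 𝕜 EB B] c ↔ ∀ (x₀ : B) k, ContinuousOn
      (fun p : T × EB => iteratedFDeriv ℝ k (fun y => c p.1 ((chartAt EB x₀).symm y)) p.2)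
      (univ ×ˢ (chartAt EB x₀).target) := by
    simp only [continuous_iInf_rng, continuous_induced_rng]
    refine forall_congr' fun x₀ => forall_congr' fun k => ?_
    exact continuous_uniformOnFun_iff (chartAt EB x₀).open_target
      fun t => continuousOn_iteratedFDeriv_comp_chartAt_symm (c t) x₀ k
  rw [hiff]
  refine forall_congr' fun x₀ => ⟨fun h => ?_, fun h k => ?_⟩
  · exact ParamSmoothOn.of_iteratedFDeriv (hO x₀)
      (fun t => by simpa using contDiffOn_comp_chartAt_symm (c t) x₀) h
  · exact h.continuousOn_iteratedFDeriv (hO x₀) k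

end Functions

section Distributions

variable {𝕜 : Type*} [RCLike 𝕜]
  {EB : Type*} [NormedAddCommGroup EB] [NormedSpace ℝ EB] [FiniteDimensional ℝ EB]
  {B : Type*} [TopologicalSpace B] [ChartedSpace EB B] [IsManifold 𝓘(ℝ, EB) ∞ B]
  {EM : Type*} [NormedAddCommGroup EM] [NormedSpace ℝ EM] [FiniteDimensional ℝ EM]
  {M : Type*} [TopologicalSpace M] [ChartedSpace EM M] [IsManifold 𝓘(ℝ, EM) ∞ M]
  {F : Type*} [NormedAddCommGroup F] [NormedSpace ℝ F] [NormedSpace 𝕜 F] [IsScalarTower ℝ 𝕜 F]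
  [FiniteDimensional ℝ F]
  {E : M → Type*} [TopologicalSpace (TotalSpace F E)] [∀ p, TopologicalSpace (E p)]
  [FiberBundle F E] [∀ p, AddCommGroup (E p)] [∀ p, Module ℝ (E p)] [∀ p, Module 𝕜 (E p)]
  [VectorBundle 𝕜 F E] [VectorBundle ℝ F E] [ContMDiffVectorBundle ∞ F E 𝓘(ℝ, EM)]
  {T : Type*} [TopologicalSpace T] {r : M → B}

variable (𝕜 EM F E) in
/-- The space `C^∞_K(M, E*)` of smooth sections supported in `K`, with the topology of
`C^∞(M, E*)`. -/
def SectionsSupportedIn (K : Set M) : Type _ := {f : TestSections 𝕜 EM F E // supp f.1 ⊆ K}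

noncomputable instance (K : Set M) : TopologicalSpace (SectionsSupportedIn 𝕜 EM F E K) :=
  TopologicalSpace.induced (fun f => TestSections.toSmooth 𝕜 EM F E f.1) (smoothTopology 𝕜 EM F E)

/-- The tautological family, parametrized by the sections supported in `K` themselves. -/
theorem smoothFamily_sectionsSupportedIn (K : Set M) :
    SmoothFamily 𝕜 EM F E (fun f : SectionsSupportedIn 𝕜 EM F E K => f.1.1) :=
  (continuous_smoothTopology_iff fun f : SectionsSupportedIn 𝕜 EM F E K =>
    TestSections.toSmooth 𝕜 EM F E f.1).1 continuous_induced_dom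

theorem continuous_val_testTopology {K : Set M} (hK : IsCompact K) :
    Continuous[_, testTopology 𝕜 EM F E]
      (fun f : SectionsSupportedIn 𝕜 EM F E K => (f.1 : TestSections 𝕜 EM F E)) := by
  rw [continuous_iff_coinduced_le]
  refine le_trans ?_ (le_sInf fun t ht => ht.1 : preTestTopology 𝕜 EM F E ≤ _)
  exact le_iSup₂_of_le K hK le_rfl

/-- A real-linear map from the test sections to a locally convex space is continuous as soon as its
restrictions to the spaces of sections with support in a given compact set are. -/
theorem continuous_testTopology_of_linear {V : Type*} [AddCommGroup V] [Module ℝ V]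
    [TopologicalSpace V] [IsTopologicalAddGroup V] [ContinuousSMul ℝ V] [LocallyConvexSpace ℝ V]
    (l : TestSections 𝕜 EM F E →ₗ[ℝ] V)
    (hl : ∀ K : Set M, IsCompact K →
      Continuous (fun f : SectionsSupportedIn 𝕜 EM F E K => l f.1)) :
    Continuous[testTopology 𝕜 EM F E, _] l := by
  rw [continuous_iff_le_induced]
  refine sInf_le ⟨iSup₂_le fun K hK => ?_, topologicalAddGroup_induced l,
    continuousSMul_induced l, LocallyConvexSpace.induced l⟩
  rw [← continuous_iff_coinduced_le, continuous_induced_rng]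
  exact hl K hK

/-- Continuity on the test sections follows from smooth dependence on the sections supported in a
compact set: the topology of the target is induced by real-linear maps to spaces of continuous
functions on compact sets, which are locally convex. -/
theorem continuous_testTopology_functionTopology
    {w : TestSections 𝕜 EM F E → C^∞⟮𝓘(ℝ, EB), B; 𝓘(ℝ, 𝕜), 𝕜⟯}
    (hadd : ∀ f g x, w (f + g) x = w f x + w g x)
    (hsmul : ∀ (a : ℝ) f x, w (a • f) x = a • w f x)
    (hw : ∀ (K : Set M), IsCompact K → ∀ x₀ : B, ParamSmoothOn
      (fun (f : SectionsSupportedIn 𝕜 EM F E K) y => w f.1 ((chartAt EB x₀).symm y))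
      (univ ×ˢ (chartAt EB x₀).target)) :
    Continuous[testTopology 𝕜 EM F E, functionTopology 𝕜 EB B] w := by
  let := testTopology 𝕜 EM F E
  simp only [continuous_iInf_rng, continuous_induced_rng]
  intro x₀ k
  rw [UniformOnFun.continuous_rng_iff]
  rintro L ⟨hL, hLt⟩
  have : CompactSpace L := isCompact_iff_compactSpace.1 hL
  have hat : ∀ f, ∀ y ∈ L, ContDiffAt ℝ k (fun y => w f ((chartAt EB x₀).symm y)) y :=
    fun f y hy => ((contDiffOn_comp_chartAt_symm (w f) x₀).contDiffAt
      ((chartAt EB x₀).open_target.mem_nhds (hLt hy))).of_le (by exact_mod_cast le_top)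
  let l : TestSections 𝕜 EM F E →ₗ[ℝ] C(L, ContinuousMultilinearMap ℝ (fun _ : Fin k => EB) 𝕜) :=
    { toFun := fun f =>
        ⟨_, ((continuousOn_iteratedFDeriv_comp_chartAt_symm (w f) x₀ k).mono hLt).domRestrict⟩
      map_add' := fun f g => by
        ext1 y
        have h1 : (fun y => w (f + g) ((chartAt EB x₀).symm y)) =
            (fun y => w f ((chartAt EB x₀).symm y)) + fun y => w g ((chartAt EB x₀).symm y) :=
          funext fun y => hadd f g _
        have h2 := iteratedFDeriv_add_apply (hat f y y.2) (hat g y y.2)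
        rw [← h1] at h2
        exact h2
      map_smul' := fun a f => by
        ext1 y
        have h1 : (fun y => w (a • f) ((chartAt EB x₀).symm y)) =
            a • fun y => w f ((chartAt EB x₀).symm y) :=
          funext fun y => hsmul a f _
        have h2 := iteratedFDeriv_const_smul_apply (a := a) (hat f y y.2)
        rw [← h1] at h2
        exact h2 }
  refine (ContinuousMap.continuous_iff_continuous_uniformFun l).1
    (continuous_testTopology_of_linear l fun K hK => ?_)
  refine ContinuousMap.continuous_of_continuous_uncurry _ ?_
  exact ((hw K hK x₀).continuousOn_iteratedFDeriv (isOpen_univ.prod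
    (chartAt EB x₀).open_target) k).comp_continuous
    (f := fun p : SectionsSupportedIn 𝕜 EM F E K × L => (p.1, (p.2 : EB))) (by fun_prop)
    fun p => ⟨mem_univ _, hLt p.2.2⟩

open scoped Classical in
/-- The value of a fibered distribution on a section of `E*`, set to `0` for sections that are not
smooth and compactly supported. -/
noncomputable def FiberedDistribution.eval (u : FiberedDistribution 𝕜 EB EM F E r)
    (f : ∀ p : M, Module.Dual 𝕜 (E p)) (x : B) : 𝕜 :=
  if h : f ∈ TestSections 𝕜 EM F E then u.toFun ⟨f, h⟩ x else 0

theorem FiberedDistribution.eval_of_mem (u : FiberedDistribution 𝕜 EB EM F E r)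
    {f : ∀ p : M, Module.Dual 𝕜 (E p)} (hf : f ∈ TestSections 𝕜 EM F E) (x : B) :
    u.eval f x = u.toFun ⟨f, hf⟩ x := dif_pos hf

theorem FiberedDistribution.eval_coe (u : FiberedDistribution 𝕜 EB EM F E r)
    (f : TestSections 𝕜 EM F E) (x : B) : u.eval f.1 x = u.toFun f x := dif_pos f.2

theorem FiberedDistribution.eval_add (u : FiberedDistribution 𝕜 EB EM F E r)
    {f g : ∀ p : M, Module.Dual 𝕜 (E p)} (hf : f ∈ TestSections 𝕜 EM F E)
    (hg : g ∈ TestSections 𝕜 EM F E) (x : B) : u.eval (f + g) x = u.eval f x + u.eval g x := by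
  rw [u.eval_of_mem hf, u.eval_of_mem hg, u.eval_of_mem (Submodule.add_mem _ hf hg)]
  exact u.isModuleMap.map_add ⟨f, hf⟩ ⟨g, hg⟩ x

theorem FiberedDistribution.eval_mul (u : FiberedDistribution 𝕜 EB EM F E r)
    {f g : ∀ p : M, Module.Dual 𝕜 (E p)} (hf : f ∈ TestSections 𝕜 EM F E)
    (hg : g ∈ TestSections 𝕜 EM F E) {h : B → 𝕜} (hh : ContMDiff 𝓘(ℝ, EB) 𝓘(ℝ, 𝕜) ∞ h)
    (hfg : ∀ p, g p = h (r p) • f p) (x : B) : u.eval g x = h x * u.eval f x := by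
  rw [u.eval_of_mem hf, u.eval_of_mem hg]
  exact u.isModuleMap.map_smul ⟨h, hh⟩ ⟨f, hf⟩ ⟨g, hg⟩ hfg x

theorem FiberedDistribution.eval_smul (u : FiberedDistribution 𝕜 EB EM F E r)
    {f : ∀ p : M, Module.Dual 𝕜 (E p)} (hf : f ∈ TestSections 𝕜 EM F E) (a : 𝕜) (x : B) :
    u.eval (a • f) x = a * u.eval f x :=
  u.eval_mul hf (Submodule.smul_mem _ a hf) (h := fun _ => a) contMDiff_const (fun _ => rfl) x

theorem FiberedDistribution.eval_zero (u : FiberedDistribution 𝕜 EB EM F E r) (x : B) :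
    u.eval 0 x = 0 := by
  simpa using u.eval_smul (Submodule.zero_mem _) 0 x

theorem FiberedDistribution.eval_sum (u : FiberedDistribution 𝕜 EB EM F E r) {ι : Type*}
    (s : Finset ι) {f : ι → ∀ p : M, Module.Dual 𝕜 (E p)}
    (hf : ∀ i ∈ s, f i ∈ TestSections 𝕜 EM F E) (x : B) :
    u.eval (∑ i ∈ s, f i) x = ∑ i ∈ s, u.eval (f i) x := by
  classical
  induction s using Finset.induction_on with
  | empty => simpa using u.eval_zero x
  | insert i s hi ih =>
    have hs : ∀ j ∈ s, f j ∈ TestSections 𝕜 EM F E := fun j hj => hf j (by simp [hj])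
    rw [Finset.sum_insert hi, Finset.sum_insert hi, u.eval_add (hf i (by simp))
      (Submodule.sum_mem _ hs), ih hs]

theorem SmoothFamily.mem_testSections {c : T → ∀ p : M, Module.Dual 𝕜 (E p)}
    (hc : SmoothFamily 𝕜 EM F E c) {K : Set M} (hK : IsCompact K) (hcK : ∀ t, supp (c t) ⊆ K)
    (t : T) : c t ∈ TestSections 𝕜 EM F E :=
  ⟨hc.mem_smoothSections t, K, hK, hcK t⟩

/-- A fibered distribution maps smooth families of sections with supports in a fixed compact set to
smooth families of functions. -/
theorem FiberedDistribution.paramSmoothOn_eval (u : FiberedDistribution 𝕜 EB EM F E r)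
    {c : T → ∀ p : M, Module.Dual 𝕜 (E p)} (hc : SmoothFamily 𝕜 EM F E c) {K : Set M}
    (hK : IsCompact K) (hcK : ∀ t, supp (c t) ⊆ K) (x₀ : B) :
    ParamSmoothOn (fun t y => u.eval (c t) ((chartAt EB x₀).symm y))
      (univ ×ˢ (chartAt EB x₀).target) := by
  have hmem := hc.mem_testSections hK hcK
  let C : T → SectionsSupportedIn 𝕜 EM F E K := fun t => ⟨⟨c t, hmem t⟩, hcK t⟩
  have hC : Continuous C := by
    refine continuous_induced_rng.2 ?_
    exact (continuous_smoothTopology_iff fun t =>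
      TestSections.toSmooth 𝕜 EM F E ⟨c t, hmem t⟩).2 hc
  have h1 : Continuous[_, functionTopology 𝕜 EB B] (fun t => u.toFun ⟨c t, hmem t⟩) := by
    let := testTopology 𝕜 EM F E
    let := functionTopology 𝕜 EB B
    exact u.continuous.comp ((continuous_val_testTopology hK).comp hC)
  simpa only [u.eval_of_mem (hmem _)] using continuous_functionTopology_iff.1 h1 x₀

theorem CompactFiberedDistribution.paramSmoothOn_eval
    (u : CompactFiberedDistribution 𝕜 EB EM F E r)
    {c : T → ∀ p : M, Module.Dual 𝕜 (E p)} (hc : SmoothFamily 𝕜 EM F E c) (x₀ : B) :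
    ParamSmoothOn (fun t y => u.toFun ⟨c t, hc.mem_smoothSections t⟩ ((chartAt EB x₀).symm y))
      (univ ×ˢ (chartAt EB x₀).target) := by
  have h1 : Continuous[_, smoothTopology 𝕜 EM F E]
      (fun t => (⟨c t, hc.mem_smoothSections t⟩ : SmoothSections 𝕜 EM F E)) :=
    (continuous_smoothTopology_iff _).2 hc
  have h2 : Continuous[_, functionTopology 𝕜 EB B]
      (fun t => u.toFun ⟨c t, hc.mem_smoothSections t⟩) := by
    let := smoothTopology 𝕜 EM F E
    let := functionTopology 𝕜 EB B
    exact u.continuous.comp h1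
  exact continuous_functionTopology_iff.1 h2 x₀

end Distributions

/-! ### Distributions applied to sections given in local coordinates -/

/-- A function with line derivatives in all directions, given by a continuous family of continuous
linear maps, is differentiable. -/
theorem hasFDerivAt_of_hasLineDerivAt {P H : Type*} [NormedAddCommGroup P] [NormedSpace ℝ P]
    [NormedAddCommGroup H] [NormedSpace ℝ H] {g : P → H} {G : P → P →L[ℝ] H} {y₀ : P}
    (hg : ∀ y δ, HasLineDerivAt ℝ g (G y δ) y δ) (hG : ContinuousAt G y₀) :
    HasFDerivAt g (G y₀) y₀ := by
  rw [hasFDerivAt_iff_isLittleO_nhds_zero, Asymptotics.isLittleO_iff]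
  intro ε hε
  obtain ⟨ρ, hρ, hb⟩ := Metric.continuousAt_iff.1 hG ε hε
  filter_upwards [Metric.ball_mem_nhds (0 : P) hρ] with k hk
  rw [mem_ball_zero_iff] at hk
  have hder : ∀ θ ∈ Icc (0 : ℝ) 1, HasDerivWithinAt (fun θ : ℝ => g (y₀ + θ • k) - θ • G y₀ k)
      (G (y₀ + θ • k) k - G y₀ k) (Icc 0 1) θ := fun θ _ => by
    have h1 : HasDerivAt (fun τ : ℝ => g (y₀ + τ • k)) (G (y₀ + θ • k) k) θ := by
      have h2 : HasDerivAt (fun t : ℝ => g (y₀ + θ • k + t • k)) (G (y₀ + θ • k) k) (θ - θ) := by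
        rw [sub_self]; exact hg (y₀ + θ • k) k
      have h3 := h2.comp_sub_const θ θ
      refine h3.congr_of_eventuallyEq (Eventually.of_forall fun τ => ?_)
      simp only [add_assoc, ← add_smul]
      congr 3
      ring
    have h4 := h1.sub ((hasDerivAt_id θ).smul_const (G y₀ k))
    rw [one_smul] at h4
    exact h4.hasDerivWithinAt
  have := norm_image_sub_le_of_norm_deriv_le_segment_01' hder (C := ε * ‖k‖) fun θ hθ => by
    rw [← sub_apply]
    refine ((G (y₀ + θ • k) - G y₀).le_opNorm k).trans ?_
    gcongr
    have h5 : dist (y₀ + θ • k) y₀ < ρ := by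
      rw [dist_eq_norm, add_sub_cancel_left, norm_smul, Real.norm_eq_abs, abs_of_nonneg hθ.1]
      exact (mul_le_of_le_one_left (norm_nonneg _) hθ.2.le).trans_lt hk
    simpa [dist_eq_norm] using (hb h5).le
  simpa [sub_right_comm] using this

section LocalSections

variable {𝕜 : Type*} [RCLike 𝕜]
  {EB : Type*} [NormedAddCommGroup EB] [NormedSpace ℝ EB] [FiniteDimensional ℝ EB]
  {B : Type*} [TopologicalSpace B] [ChartedSpace EB B] [IsManifold 𝓘(ℝ, EB) ∞ B]
  {EM : Type*} [NormedAddCommGroup EM] [NormedSpace ℝ EM] [FiniteDimensional ℝ EM]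
  {M : Type*} [TopologicalSpace M] [T2Space M] [ChartedSpace EM M] [IsManifold 𝓘(ℝ, EM) ∞ M]
  {F : Type*} [NormedAddCommGroup F] [NormedSpace ℝ F] [NormedSpace 𝕜 F] [IsScalarTower ℝ 𝕜 F]
  [FiniteDimensional ℝ F]
  {E : M → Type*} [TopologicalSpace (TotalSpace F E)] [∀ p, TopologicalSpace (E p)]
  [FiberBundle F E] [∀ p, AddCommGroup (E p)] [∀ p, Module ℝ (E p)] [∀ p, Module 𝕜 (E p)]
  [VectorBundle 𝕜 F E] [VectorBundle ℝ F E] [ContMDiffVectorBundle ∞ F E 𝓘(ℝ, EM)]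
  {T P : Type*} [TopologicalSpace T] [NormedAddCommGroup P] [NormedSpace ℝ P]
  [FiniteDimensional ℝ P] {r : M → B}
  {χ : OpenPartialHomeomorph M EM} {e : Trivialization F (π F E)} [MemTrivializationAtlas e]
  {l : F →ₗ[𝕜] 𝕜} {L : Set EM}

open scoped Classical in
/-- The section of `E*` with coordinate function `f` in the chart `χ`, times the linear form `l` in
the trivialization `e`, extended by zero. -/
noncomputable def localSection (χ : OpenPartialHomeomorph M EM) (e : Trivialization F (π F E))
    [MemTrivializationAtlas e] (l : F →ₗ[𝕜] 𝕜) (f : EM → 𝕜) (p : M) : Module.Dual 𝕜 (E p) :=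
  if p ∈ χ.source then f (χ p) • l.comp (e.linearMapAt 𝕜 p) else 0

theorem localSection_apply {f : EM → 𝕜} {p : M} (hp : p ∈ χ.source) (hpe : p ∈ e.baseSet)
    (z : E p) : localSection χ e l f p z = f (χ p) * l (e ⟨p, z⟩).2 := by
  simp [localSection, hp, hpe]

theorem localSection_add (f g : EM → 𝕜) :
    localSection χ e l (f + g) = localSection χ e l f + localSection χ e l g := by
  ext p z
  by_cases hp : p ∈ χ.source <;> simp [localSection, hp, add_mul]

theorem localSection_smul (a : 𝕜) (f : EM → 𝕜) :
    localSection χ e l (a • f) = a • localSection χ e l f := by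
  ext p z
  by_cases hp : p ∈ χ.source <;> simp [localSection, hp, mul_assoc]

/-- The part of the target of the chart `χ` above which the trivialization `e` is defined. -/
def boxDomain (χ : OpenPartialHomeomorph M EM) (e : Trivialization F (π F E)) : Set EM :=
  χ.target ∩ χ.symm ⁻¹' e.baseSet

theorem isOpen_boxDomain : IsOpen (boxDomain χ e) :=
  χ.isOpen_inter_preimage_symm e.open_baseSet

theorem isCompact_image_symm (hL : IsCompact L) (hLD : L ⊆ boxDomain χ e) :
    IsCompact (χ.symm '' L) :=
  hL.image_of_continuousOn (χ.continuousOn_symm.mono fun _ ha => (hLD ha).1)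

theorem localSection_eq_zero {f : EM → 𝕜} (hf : ∀ a, a ∉ L → f a = 0) {p : M}
    (hp : p ∉ χ.symm '' L) : localSection χ e l f p = 0 := by
  by_cases h : p ∈ χ.source
  · have : χ p ∉ L := fun h' => hp ⟨χ p, h', χ.left_inv h⟩
    simp [localSection, h, hf _ this]
  · simp [localSection, h]

theorem supp_localSection_subset (hL : IsCompact L) (hLD : L ⊆ boxDomain χ e) {f : EM → 𝕜}
    (hf : ∀ a, a ∉ L → f a = 0) : supp (localSection χ e l f) ⊆ χ.symm '' L := by
  refine closure_minimal (fun p hp => ?_) (isCompact_image_symm hL hLD).isClosed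
  by_contra h
  exact hp (localSection_eq_zero hf h)

theorem smoothFamily_localSection (hχ : χ ∈ IsManifold.maximalAtlas 𝓘(ℝ, EM) ∞ M)
    (hL : IsCompact L) (hLD : L ⊆ boxDomain χ e) {f : T → EM → 𝕜} (hf : ParamSmoothOn f univ)
    (hfL : ∀ t a, a ∉ L → f t a = 0) :
    SmoothFamily 𝕜 EM F E (fun t => localSection χ e l (f t)) := by
  intro p₀ v n
  refine ParamContDiffOn.of_forall_mem ?_
  rintro ⟨t₀, y₀⟩ ⟨-, hy₀⟩
  have hcont := (contMDiffOn_chartAt_symm_coordDomain (EM := EM) (F := F) (E := E) p₀).continuousOn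
  have hD := isOpen_coordDomain (EM := EM) (F := F) (E := E) p₀
  by_cases hq : (chartAt EM p₀).symm y₀ ∈ χ.source ∩ e.baseSet
  · let Ω := coordDomain EM F E p₀ ∩ (chartAt EM p₀).symm ⁻¹' (χ.source ∩ e.baseSet)
    have hΩ : IsOpen Ω := hcont.isOpen_inter_preimage hD (χ.open_source.inter e.open_baseSet)
    have hV : IsOpen (univ ×ˢ Ω : Set (T × EM)) := isOpen_univ.prod hΩ
    have hsymm : ContMDiffOn 𝓘(ℝ, EM) 𝓘(ℝ, EM) ∞ (chartAt EM p₀).symm Ω :=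
      (contMDiffOn_chartAt_symm_coordDomain (F := F) (E := E) p₀).mono inter_subset_left
    have h1 : ContDiffOn ℝ ∞ (fun y => χ ((chartAt EM p₀).symm y)) Ω := by
      rw [← contMDiffOn_iff_contDiffOn]
      exact (contMDiffOn_of_mem_maximalAtlas hχ).comp hsymm fun y hy => hy.2.1
    have h2 : ContDiffOn ℝ ∞ (fun y => l (e ⟨(chartAt EM p₀).symm y,
        (trivializationAt F E p₀).symm ((chartAt EM p₀).symm y) v⟩).2) Ω := by
      rw [← contMDiffOn_iff_contDiffOn]
      refine (contDiff_dual l).contMDiff.comp_contMDiffOn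
        ((contMDiffOn_trivialization_snd e).comp (contMDiffOn_symm_comp hsymm
          (fun y hy => hy.1.2) v) fun y hy => e.mem_source.2 hy.2.2)
    refine ⟨univ ×ˢ Ω, hV, ⟨mem_univ _, hy₀, hq⟩, ?_⟩
    refine (ParamContDiffOn.bilinear (ContinuousLinearMap.mul ℝ 𝕜)
      ((hf n).comp h1 hΩ hV fun p hp => ⟨hp.2, mem_univ _⟩)
      (ParamContDiffOn.of_contDiffOn (T := T) h2 hΩ fun p hp => hp.2) hV).congr hV
      fun t y hy => ?_
    exact localSection_apply hy.2.2.1 hy.2.2.2 _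
  · let Ω := coordDomain EM F E p₀ ∩ (chartAt EM p₀).symm ⁻¹' (χ.symm '' L)ᶜ
    have hΩ : IsOpen Ω := hcont.isOpen_inter_preimage hD
      (isCompact_image_symm hL hLD).isClosed.isOpen_compl
    have hV : IsOpen (univ ×ˢ Ω : Set (T × EM)) := isOpen_univ.prod hΩ
    refine ⟨univ ×ˢ Ω, hV, ⟨mem_univ _, hy₀, ?_⟩, ?_⟩
    · rintro ⟨a, ha, hae⟩
      refine hq ⟨?_, ?_⟩
      · rw [← hae]; exact χ.map_target (hLD ha).1
      · rw [← hae]; exact (hLD ha).2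
    · refine (ParamContDiffOn.zero (H := 𝕜)).congr hV fun t y hy => ?_
      simp only [coordRep]
      rw [localSection_eq_zero (hfL t) hy.2.2]
      rfl

theorem localSection_mem_testSections (hχ : χ ∈ IsManifold.maximalAtlas 𝓘(ℝ, EM) ∞ M)
    (hL : IsCompact L) (hLD : L ⊆ boxDomain χ e) {f : EM → 𝕜} (hf : ContDiff ℝ ∞ f)
    (hfL : ∀ a, a ∉ L → f a = 0) : localSection χ e l f ∈ TestSections 𝕜 EM F E :=
  (smoothFamily_localSection (T := Unit) (f := fun _ => f) hχ hL hLD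
    (fun _ => ParamContDiffOn.of_contDiffOn hf.contDiffOn isOpen_univ (by simp))
    fun _ => hfL).mem_testSections (isCompact_image_symm hL hLD)
    (fun _ => supp_localSection_subset hL hLD hfL) ()

namespace FiberedDistribution

variable (u : FiberedDistribution 𝕜 EB EM F E r)

/-- The values of a distribution on sections with coordinate function `f t` are smooth, and depend
continuously on the parameter. -/
theorem paramSmoothOn_eval_localSection (hχ : χ ∈ IsManifold.maximalAtlas 𝓘(ℝ, EM) ∞ M)
    (hL : IsCompact L) (hLD : L ⊆ boxDomain χ e) {f : T → EM → 𝕜} (hf : ParamSmoothOn f univ)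
    (hfL : ∀ t a, a ∉ L → f t a = 0) (x₀ : B) :
    ParamSmoothOn (fun t y => u.eval (localSection χ e l (f t)) ((chartAt EB x₀).symm y))
      (univ ×ˢ (chartAt EB x₀).target) :=
  u.paramSmoothOn_eval (smoothFamily_localSection hχ hL hLD hf hfL) (isCompact_image_symm hL hLD)
    (fun t => supp_localSection_subset hL hLD (hfL t)) x₀

variable (χ e l) in
/-- Iterated derivatives, in a chart of the base, of the value of a distribution on the section with
coordinate function `f`. -/
noncomputable def localDeriv (x₀ : B) (k : ℕ) (v : Fin k → EB) (f : EM → 𝕜) (x : EB) : 𝕜 :=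
  iteratedFDeriv ℝ k (fun y => u.eval (localSection χ e l f) ((chartAt EB x₀).symm y)) x v

theorem contDiffOn_eval_localSection (hχ : χ ∈ IsManifold.maximalAtlas 𝓘(ℝ, EM) ∞ M)
    (hL : IsCompact L) (hLD : L ⊆ boxDomain χ e) {f : EM → 𝕜} (hf : ContDiff ℝ ∞ f)
    (hfL : ∀ a, a ∉ L → f a = 0) (x₀ : B) :
    ContDiffOn ℝ ∞ (fun y => u.eval (localSection χ e l f) ((chartAt EB x₀).symm y))
      (chartAt EB x₀).target := by
  simpa using (u.paramSmoothOn_eval_localSection (T := Unit) (f := fun _ => f) hχ hL hLD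
    (fun _ => ParamContDiffOn.of_contDiffOn hf.contDiffOn isOpen_univ (by simp))
    (fun _ => hfL) x₀).contDiffOn (isOpen_univ.prod (chartAt EB x₀).open_target) ()

theorem localDeriv_add (hχ : χ ∈ IsManifold.maximalAtlas 𝓘(ℝ, EM) ∞ M)
    (hL : IsCompact L) (hLD : L ⊆ boxDomain χ e) {f g : EM → 𝕜} (hf : ContDiff ℝ ∞ f)
    (hfL : ∀ a, a ∉ L → f a = 0) (hg : ContDiff ℝ ∞ g) (hgL : ∀ a, a ∉ L → g a = 0) (x₀ : B)
    (k : ℕ) (v : Fin k → EB) {x : EB} (hx : x ∈ (chartAt EB x₀).target) :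
    u.localDeriv χ e l x₀ k v (f + g) x =
      u.localDeriv χ e l x₀ k v f x + u.localDeriv χ e l x₀ k v g x := by
  have hx' := (chartAt EB x₀).open_target.mem_nhds hx
  have h1 := ((u.contDiffOn_eval_localSection (l := l) hχ hL hLD hf hfL x₀).contDiffAt hx').of_le
    (m := k) (by exact_mod_cast le_top)
  have h2 := ((u.contDiffOn_eval_localSection (l := l) hχ hL hLD hg hgL x₀).contDiffAt hx').of_le
    (m := k) (by exact_mod_cast le_top)
  have h3 : (fun y => u.eval (localSection χ e l (f + g)) ((chartAt EB x₀).symm y)) =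
      (fun y => u.eval (localSection χ e l f) ((chartAt EB x₀).symm y)) +
        fun y => u.eval (localSection χ e l g) ((chartAt EB x₀).symm y) := by
    ext y
    rw [localSection_add, u.eval_add (localSection_mem_testSections hχ hL hLD hf hfL)
      (localSection_mem_testSections hχ hL hLD hg hgL)]
    rfl
  simp only [localDeriv]
  rw [h3, iteratedFDeriv_add_apply h1 h2]
  rfl

theorem localDeriv_smul (hχ : χ ∈ IsManifold.maximalAtlas 𝓘(ℝ, EM) ∞ M)
    (hL : IsCompact L) (hLD : L ⊆ boxDomain χ e) {f : EM → 𝕜} (hf : ContDiff ℝ ∞ f)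
    (hfL : ∀ a, a ∉ L → f a = 0) (c : ℝ) (x₀ : B)
    (k : ℕ) (v : Fin k → EB) {x : EB} (hx : x ∈ (chartAt EB x₀).target) :
    u.localDeriv χ e l x₀ k v (c • f) x = c • u.localDeriv χ e l x₀ k v f x := by
  have hx' := (chartAt EB x₀).open_target.mem_nhds hx
  have h1 := ((u.contDiffOn_eval_localSection (l := l) hχ hL hLD hf hfL x₀).contDiffAt hx').of_le
    (m := k) (by exact_mod_cast le_top)
  have h3 : (fun y => u.eval (localSection χ e l (c • f)) ((chartAt EB x₀).symm y)) =
      c • fun y => u.eval (localSection χ e l f) ((chartAt EB x₀).symm y) := by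
    ext y
    have : c • f = (c : 𝕜) • f := by ext; simp [RCLike.real_smul_eq_coe_mul]
    rw [this, localSection_smul, u.eval_smul (localSection_mem_testSections hχ hL hLD hf hfL)]
    simp [RCLike.real_smul_eq_coe_mul]
  simp only [localDeriv]
  rw [h3, iteratedFDeriv_const_smul_apply h1]
  rfl

theorem continuousOn_localDeriv (hχ : χ ∈ IsManifold.maximalAtlas 𝓘(ℝ, EM) ∞ M)
    (hL : IsCompact L) (hLD : L ⊆ boxDomain χ e) {f : T → EM → 𝕜} (hf : ParamSmoothOn f univ)
    (hfL : ∀ t a, a ∉ L → f t a = 0) (x₀ : B) (k : ℕ) (v : Fin k → EB) :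
    ContinuousOn (fun p : T × EB => u.localDeriv χ e l x₀ k v (f p.1) p.2)
      (univ ×ˢ (chartAt EB x₀).target) :=
  (continuous_eval_const v).comp_continuousOn
    ((u.paramSmoothOn_eval_localSection hχ hL hLD hf hfL x₀).continuousOn_iteratedFDeriv
      (isOpen_univ.prod (chartAt EB x₀).open_target) k)

end FiberedDistribution

end LocalSections

/-! ### Differentiation under the pairing -/

section LocalSections

variable {𝕜 : Type*} [RCLike 𝕜]
  {EB : Type*} [NormedAddCommGroup EB] [NormedSpace ℝ EB] [FiniteDimensional ℝ EB]
  {B : Type*} [TopologicalSpace B] [ChartedSpace EB B] [IsManifold 𝓘(ℝ, EB) ∞ B]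
  {EM : Type*} [NormedAddCommGroup EM] [NormedSpace ℝ EM] [FiniteDimensional ℝ EM]
  {M : Type*} [TopologicalSpace M] [T2Space M] [ChartedSpace EM M] [IsManifold 𝓘(ℝ, EM) ∞ M]
  {F : Type*} [NormedAddCommGroup F] [NormedSpace ℝ F] [NormedSpace 𝕜 F] [IsScalarTower ℝ 𝕜 F]
  [FiniteDimensional ℝ F]
  {E : M → Type*} [TopologicalSpace (TotalSpace F E)] [∀ p, TopologicalSpace (E p)]
  [FiberBundle F E] [∀ p, AddCommGroup (E p)] [∀ p, Module ℝ (E p)] [∀ p, Module 𝕜 (E p)]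
  [VectorBundle 𝕜 F E] [VectorBundle ℝ F E] [ContMDiffVectorBundle ∞ F E 𝓘(ℝ, EM)]
  {T P : Type*} [TopologicalSpace T] [NormedAddCommGroup P] [NormedSpace ℝ P]
  [FiniteDimensional ℝ P] {r : M → B}
  {χ : OpenPartialHomeomorph M EM} {e : Trivialization F (π F E)} [MemTrivializationAtlas e]
  {l : F →ₗ[𝕜] 𝕜} {L : Set EM}

theorem ParamSmoothOn.contDiff {A H : Type*} [NormedAddCommGroup A] [NormedSpace ℝ A]
    [FiniteDimensional ℝ A] [NormedAddCommGroup H] [NormedSpace ℝ H] {f : T → A → H}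
    (hf : ParamSmoothOn f univ) (t : T) : ContDiff ℝ ∞ (f t) := by
  simpa [contDiffOn_univ] using hf.contDiffOn isOpen_univ t

theorem ParamSmoothOn.contDiff_slice {f : T → P × EM → 𝕜} (hf : ParamSmoothOn f univ) (t : T)
    (y : P) : ContDiff ℝ ∞ (fun a => f t (y, a)) :=
  (hf.contDiff t).comp (contDiff_const.prodMk contDiff_id)

theorem fderiv_eq_zero_of_notMem (hL : IsCompact L) {f : P × EM → 𝕜}
    (hfL : ∀ y a, a ∉ L → f (y, a) = 0) {y : P} {a : EM} (ha : a ∉ L) :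
    fderiv ℝ f (y, a) = 0 := by
  have : f =ᶠ[𝓝 (y, a)] fun _ => 0 := by
    filter_upwards [(hL.isClosed.isOpen_compl.preimage continuous_snd).mem_nhds
      (show (y, a) ∈ Prod.snd ⁻¹' Lᶜ from ha)] with p hp using hfL p.1 p.2 hp
  rw [this.fderiv_eq]
  simp

namespace FiberedDistribution

variable (u : FiberedDistribution 𝕜 EB EM F E r)

/-- Distributions may be differentiated under the pairing, with respect to a parameter on which the
section depends smoothly. -/
theorem hasLineDerivAt_localDeriv (hχ : χ ∈ IsManifold.maximalAtlas 𝓘(ℝ, EM) ∞ M)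
    (hL : IsCompact L) (hLD : L ⊆ boxDomain χ e) {f : T → P × EM → 𝕜} (hf : ParamSmoothOn f univ)
    (hfL : ∀ t y a, a ∉ L → f t (y, a) = 0) (x₀ : B) (k : ℕ) (v : Fin k → EB) {x : EB}
    (hx : x ∈ (chartAt EB x₀).target) (t : T) (y δ : P) :
    HasLineDerivAt ℝ (fun y => u.localDeriv χ e l x₀ k v (fun a => f t (y, a)) x)
      (u.localDeriv χ e l x₀ k v (fun a => fderiv ℝ (f t) (y, a) (δ, 0)) x) y δ := by
  have hq := paramSmoothOn_diffQuotient hf δ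
  have hqL : ∀ s a, a ∉ L → diffQuotient f δ s a = 0 := fun s a ha => by
    simp only [diffQuotient]
    rw [fderiv_eq_zero_of_notMem hL (hfL s.2.1) ha, hfL _ _ _ ha, hfL _ _ _ ha]
    simp
  have hc : Continuous (fun h : ℝ => u.localDeriv χ e l x₀ k v (diffQuotient f δ (h, t, y)) x) :=
    (u.continuousOn_localDeriv (l := l) hχ hL hLD hq hqL x₀ k v).comp_continuous
      (f := fun h : ℝ => ((h, t, y), x)) (by fun_prop) fun h => ⟨mem_univ _, hx⟩
  rw [HasLineDerivAt, hasDerivAt_iff_tendsto_slope_zero]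
  have h0 : diffQuotient f δ (0, t, y) = fun a => fderiv ℝ (f t) (y, a) (δ, 0) := by
    ext a; simp [diffQuotient]
  have h1 := (hc.tendsto 0).mono_left (nhdsWithin_le_nhds (s := {0}ᶜ))
  rw [h0] at h1
  refine h1.congr' ?_
  filter_upwards [self_mem_nhdsWithin] with h hh
  have h2 : diffQuotient f δ (h, t, y) =
      h⁻¹ • ((fun a => f t (y + h • δ, a)) + (-1 : ℝ) • fun a => f t (y, a)) := by
    ext a
    have : h ≠ 0 := hh
    simp [diffQuotient, this, sub_eq_add_neg]
  have s1 := hf.contDiff_slice t (y + h • δ)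
  have s2 := hf.contDiff_slice t y
  have z2 : ∀ a, a ∉ L → ((-1 : ℝ) • fun a => f t (y, a)) a = 0 := fun a ha => by
    simp [hfL t y a ha]
  have s3 : ContDiff ℝ ∞ ((-1 : ℝ) • fun a => f t (y, a)) := contDiff_const.smul s2
  have s4 : ContDiff ℝ ∞ ((fun a => f t (y + h • δ, a)) + (-1 : ℝ) • fun a => f t (y, a)) :=
    s1.add s3
  rw [h2, u.localDeriv_smul hχ hL hLD s4 (fun a ha => by simp [hfL t _ a ha]) _ _ _ _ hx,
    u.localDeriv_add hχ hL hLD s1 (hfL t _) s3 z2 _ _ _ hx,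
    u.localDeriv_smul hχ hL hLD s2 (hfL t _) _ _ _ _ hx]
  simp [sub_eq_add_neg]

theorem hasFDerivAt_localDeriv (hχ : χ ∈ IsManifold.maximalAtlas 𝓘(ℝ, EM) ∞ M)
    (hL : IsCompact L) (hLD : L ⊆ boxDomain χ e) {f : EM → 𝕜} (hf : ContDiff ℝ ∞ f)
    (hfL : ∀ a, a ∉ L → f a = 0) (x₀ : B) (k : ℕ) (v : Fin k → EB) {x : EB}
    (hx : x ∈ (chartAt EB x₀).target) : ∃ D : EB →L[ℝ] 𝕜,
      HasFDerivAt (u.localDeriv χ e l x₀ k v f) D x ∧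
      ∀ w, D w = u.localDeriv χ e l x₀ (k + 1) (Fin.cons w v) f x := by
  have h1 : DifferentiableAt ℝ (iteratedFDeriv ℝ k
      (fun y => u.eval (localSection χ e l f) ((chartAt EB x₀).symm y))) x :=
    ((u.contDiffOn_eval_localSection (l := l) hχ hL hLD hf hfL x₀).contDiffAt
      ((chartAt EB x₀).open_target.mem_nhds hx)).differentiableAt_iteratedFDeriv
        (by exact_mod_cast ENat.natCast_lt_top k)
  refine ⟨_, (ContinuousMultilinearMap.apply ℝ (fun _ : Fin k => EB) 𝕜 v).hasFDerivAt.comp x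
    h1.hasFDerivAt, fun w => ?_⟩
  simp only [localDeriv]
  rw [iteratedFDeriv_succ_apply_left]
  simp

/-- The value `⟨u, f_y⟩(x)` of a distribution on a family of sections is a smooth function of
`(y, x)` if the family depends smoothly on `y`. -/
theorem paramSmoothOn_eval_localSection_prod (hχ : χ ∈ IsManifold.maximalAtlas 𝓘(ℝ, EM) ∞ M)
    (hL : IsCompact L) (hLD : L ⊆ boxDomain χ e) {f : T → P × EM → 𝕜} (hf : ParamSmoothOn f univ)
    (hfL : ∀ t y a, a ∉ L → f t (y, a) = 0) (x₀ : B) :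
    ParamSmoothOn (fun t (p : P × EB) =>
      u.eval (localSection χ e l (fun a => f t (p.1, a))) ((chartAt EB x₀).symm p.2))
      (univ ×ˢ (univ ×ˢ (chartAt EB x₀).target)) := by
  have hW := (chartAt EB x₀).open_target
  have hO : IsOpen (univ ×ˢ (univ ×ˢ (chartAt EB x₀).target) : Set (T × (P × EB))) :=
    isOpen_univ.prod (isOpen_univ.prod hW)
  let 𝓕 : Set (T → P × EB → 𝕜) := {g | ∃ f : T → P × EM → 𝕜, ParamSmoothOn f univ ∧
    (∀ t y a, a ∉ L → f t (y, a) = 0) ∧ ∃ (k : ℕ) (v : Fin k → EB),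
      g = fun t p => u.localDeriv χ e l x₀ k v (fun a => f t (p.1, a)) p.2}
  have hcont : ∀ f : T → P × EM → 𝕜, ParamSmoothOn f univ →
      (∀ t y a, a ∉ L → f t (y, a) = 0) → ∀ (k : ℕ) (v : Fin k → EB),
      ContinuousOn (fun p : T × (P × EB) =>
        u.localDeriv χ e l x₀ k v (fun a => f p.1 (p.2.1, a)) p.2.2)
        (univ ×ˢ (univ ×ˢ (chartAt EB x₀).target)) := by
    intro f hf hfL k v
    have h1 : ParamSmoothOn (fun (s : T × P) a => f s.1 (s.2, a)) univ := fun n =>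
      (hf n).curry (by simp) isOpen_univ
    exact (u.continuousOn_localDeriv hχ hL hLD h1 (fun s => hfL s.1 s.2) x₀ k v).comp
      (f := fun p : T × (P × EB) => ((p.1, p.2.1), p.2.2)) (by fun_prop)
      fun p hp => ⟨mem_univ _, hp.2.2⟩
  -- the derivative in the direction `(δ, w)` is a sum of two functions of the same form
  have hderiv : ∀ f : T → P × EM → 𝕜, ParamSmoothOn f univ →
      (∀ t y a, a ∉ L → f t (y, a) = 0) → ∀ (k : ℕ) (v : Fin k → EB) (t : T) (y : P) (x : EB),
      x ∈ (chartAt EB x₀).target → ∃ D : P × EB →L[ℝ] 𝕜,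
        HasFDerivAt (fun p : P × EB => u.localDeriv χ e l x₀ k v (fun a => f t (p.1, a)) p.2) D
          (y, x) ∧ ∀ w, D w =
            u.localDeriv χ e l x₀ k v (fun a => fderiv ℝ (f t) (y, a) (w.1, 0)) x +
            u.localDeriv χ e l x₀ (k + 1) (Fin.cons w.2 v) (fun a => f t (y, a)) x := by
    intro f hf hfL k v t y x hx
    classical
    have hfd : ∀ δ : P, ParamSmoothOn (fun t a => fderiv ℝ (f t) a (δ, 0)) univ := fun δ =>
      hf.fderiv_apply (δ, 0)
    have hfdL : ∀ (δ : P) t y a, a ∉ L → fderiv ℝ (f t) (y, a) (δ, 0) = 0 := fun δ t y a ha => by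
      rw [fderiv_eq_zero_of_notMem hL (hfL t) ha]; rfl
    let f₁ : P → EB → P →L[ℝ] 𝕜 := fun y x => if hx : x ∈ (chartAt EB x₀).target then
      LinearMap.toContinuousLinearMap
        { toFun := fun δ => u.localDeriv χ e l x₀ k v (fun a => fderiv ℝ (f t) (y, a) (δ, 0)) x
          map_add' := fun δ δ' => by
            rw [← u.localDeriv_add hχ hL hLD ((hfd δ).contDiff_slice t y) (hfdL δ t y)
              ((hfd δ').contDiff_slice t y) (hfdL δ' t y) _ _ _ hx]
            congr 1
            ext a
            rw [Pi.add_apply, ← map_add]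
            simp
          map_smul' := fun c δ => by
            rw [RingHom.id_apply, ← u.localDeriv_smul hχ hL hLD ((hfd δ).contDiff_slice t y)
              (hfdL δ t y) _ _ _ _ hx]
            congr 1
            ext a
            rw [Pi.smul_apply, ← map_smul]
            simp } else 0
    have hf₁ : ∀ y, ∀ x ∈ (chartAt EB x₀).target, ∀ δ, f₁ y x δ =
        u.localDeriv χ e l x₀ k v (fun a => fderiv ℝ (f t) (y, a) (δ, 0)) x := by
      intro y x hx δ
      simp only [f₁, dif_pos hx]
      rfl
    have cf₁ : ContinuousOn (fun p : P × EB => f₁ p.1 p.2)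
        (univ ×ˢ (chartAt EB x₀).target) := by
      refine continuousOn_clm_apply.2 fun δ => ?_
      refine ((hcont _ (hfd δ) (hfdL δ) k v).comp (f := fun p : P × EB => (t, p))
        (by fun_prop) fun p hp => ⟨mem_univ _, mem_univ _, hp.2⟩).congr
        fun p hp => hf₁ p.1 p.2 hp.2 δ
    let f₂ : P → EB → EB →L[ℝ] 𝕜 := fun y x =>
      fderiv ℝ (u.localDeriv χ e l x₀ k v (fun a => f t (y, a))) x
    have hf₂ : ∀ y, ∀ x ∈ (chartAt EB x₀).target,
        HasFDerivAt (u.localDeriv χ e l x₀ k v (fun a => f t (y, a))) (f₂ y x) x ∧ ∀ w, f₂ y x w =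
          u.localDeriv χ e l x₀ (k + 1) (Fin.cons w v) (fun a => f t (y, a)) x := by
      intro y x hx
      obtain ⟨D, hD, hw⟩ := u.hasFDerivAt_localDeriv (l := l) hχ hL hLD (hf.contDiff_slice t y)
        (hfL t y) x₀ k v hx
      have : f₂ y x = D := hD.fderiv
      rw [this]
      exact ⟨hD, hw⟩
    have cf₂ : ContinuousOn (fun p : P × EB => f₂ p.1 p.2)
        (univ ×ˢ (chartAt EB x₀).target) := by
      refine continuousOn_clm_apply.2 fun w => ?_
      refine ((hcont _ hf hfL (k + 1) (Fin.cons w v)).comp (f := fun p : P × EB => (t, p))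
        (by fun_prop) fun p hp => ⟨mem_univ _, mem_univ _, hp.2⟩).congr
        fun p hp => (hf₂ p.1 p.2 hp.2).2 w
    have hN : (univ ×ˢ (chartAt EB x₀).target : Set (P × EB)) ∈ 𝓝 (y, x) :=
      (isOpen_univ.prod hW).mem_nhds ⟨mem_univ _, hx⟩
    have := hasStrictFDerivAt_uncurry_coprod (u := (y, x)) (f₁ := f₁) (f₂ := f₂)
      (f := fun y x => u.localDeriv χ e l x₀ k v (fun a => f t (y, a)) x) (by
        filter_upwards [hN] with p hp
        have hp2 : p.2 ∈ (chartAt EB x₀).target := hp.2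
        refine hasFDerivAt_of_hasLineDerivAt (G := fun y => f₁ y p.2) (fun y δ => ?_) ?_
        · rw [hf₁ y p.2 hp2]
          exact u.hasLineDerivAt_localDeriv hχ hL hLD hf hfL x₀ k v hp2 t y δ
        · have := cf₁.continuousAt (x := p) ((isOpen_univ.prod hW).mem_nhds hp)
          exact this.comp (f := fun y : P => (y, p.2)) (x := p.1) (by fun_prop)) (by
        filter_upwards [hN] with p hp
        exact (hf₂ p.1 p.2 hp.2).1) (cf₁.continuousAt hN) (cf₂.continuousAt hN)
    refine ⟨_, this.hasFDerivAt, fun w => ?_⟩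
    have e1 : (f₁.uncurry (y, x)) w.1 = _ := hf₁ y x hx w.1
    have e2 : (f₂.uncurry (y, x)) w.2 = _ := (hf₂ y x hx).2 w.2
    rw [ContinuousLinearMap.coprod_apply]
    exact congrArg₂ _ e1 e2
  refine paramSmoothOn_of_class 𝓕 hO ?_ ?_ ?_ ⟨f, hf, hfL, 0, Fin.elim0, ?_⟩
  · rintro g ⟨f, hf, hfL, k, v, rfl⟩
    exact hcont f hf hfL k v
  · rintro g ⟨f, hf, hfL, k, v, rfl⟩ ⟨t, y, x⟩ ⟨-, -, hx⟩
    obtain ⟨D, hD, -⟩ := hderiv f hf hfL k v t y x hx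
    exact hD.differentiableAt
  · rintro g ⟨f, hf, hfL, k, v, rfl⟩ w
    refine ⟨_, ⟨fun t a => fderiv ℝ (f t) a (w.1, 0), hf.fderiv_apply _, fun t y a ha => ?_, k, v,
      rfl⟩, _, ⟨f, hf, hfL, k + 1, Fin.cons w.2 v, rfl⟩, ?_⟩
    · change fderiv ℝ (f t) (y, a) (w.1, 0) = 0
      rw [fderiv_eq_zero_of_notMem hL (hfL t) ha]; rfl
    · rintro t ⟨y, x⟩ ⟨-, -, hx⟩
      obtain ⟨D, hD, hw⟩ := hderiv f hf hfL k v t y x hx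
      rw [hD.fderiv, hw]
  · ext t p
    simp [localDeriv]

end FiberedDistribution

end LocalSections

/-! ### Cutoff functions and finite partitions of unity -/

section Cutoff

variable (𝕜 : Type*) [RCLike 𝕜]
  {EM : Type*} [NormedAddCommGroup EM] [NormedSpace ℝ EM] [FiniteDimensional ℝ EM]
  {M : Type*} [TopologicalSpace M] [T2Space M] [SecondCountableTopology M]
  [ChartedSpace EM M] [IsManifold 𝓘(ℝ, EM) ∞ M]

theorem contMDiff_ofReal {ρ : M → ℝ} (hρ : ContMDiff 𝓘(ℝ, EM) 𝓘(ℝ, ℝ) ∞ ρ) :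
    ContMDiff 𝓘(ℝ, EM) 𝓘(ℝ, 𝕜) ∞ (fun p => (ρ p : 𝕜)) :=
  (RCLike.ofRealCLM (K := 𝕜)).contDiff.contMDiff.comp hρ

variable (EM) in
/-- A compact set in an open set has a smooth cutoff function. -/
theorem exists_cutoff {K U : Set M} (hK : IsCompact K) (hU : IsOpen U) (hKU : K ⊆ U) :
    ∃ (K' : Set M) (ρ : M → 𝕜), IsCompact K' ∧ K' ⊆ U ∧ ContMDiff 𝓘(ℝ, EM) 𝓘(ℝ, 𝕜) ∞ ρ ∧
      (∀ᶠ p in 𝓝ˢ K, ρ p = 1) ∧ ∀ p, p ∉ K' → ρ p = 0 := by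
  have : LocallyCompactSpace M := Manifold.locallyCompact_of_finiteDimensional 𝓘(ℝ, EM)
  obtain ⟨K', hK', hKK', hK'U⟩ := exists_compact_between hK hU hKU
  obtain ⟨ρ, h1, h0, -⟩ := exists_contMDiffMap_one_nhds_of_subset_interior 𝓘(ℝ, EM)
    (n := (⊤ : ℕ∞)) hK.isClosed hKK'
  refine ⟨K', fun p => (ρ p : 𝕜), hK', hK'U, contMDiff_ofReal 𝕜 ρ.contMDiff, ?_, fun p hp => ?_⟩
  · filter_upwards [h1] with p hp
    simp [hp]
  · simp [h0 p hp]

variable (EM) in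
/-- A finite smooth partition of unity near a compact set. -/
theorem exists_finite_partition {K : Set M} (hK : IsCompact K) {N : M → Set M}
    (hN : ∀ p ∈ K, N p ∈ 𝓝 p) : ∃ (s : Finset M) (ρ : M → M → 𝕜), (∀ i ∈ s, i ∈ K) ∧
      (∀ i, ContMDiff 𝓘(ℝ, EM) 𝓘(ℝ, 𝕜) ∞ (ρ i)) ∧ (∀ i ∈ s, tsupport (ρ i) ⊆ N i) ∧
      ∀ p ∈ K, ∑ i ∈ s, ρ i p = 1 := by
  classical
  have : LocallyCompactSpace M := Manifold.locallyCompact_of_finiteDimensional 𝓘(ℝ, EM)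
  obtain ⟨s, hs, hcov⟩ := hK.elim_nhds_subcover (fun p => interior (N p))
    fun p hp => interior_mem_nhds.2 (hN p hp)
  obtain ⟨f, hf⟩ := SmoothPartitionOfUnity.exists_isSubordinate 𝓘(ℝ, EM) hK.isClosed
    (fun i : s => interior (N i)) (fun _ => isOpen_interior) (by
      intro p hp
      obtain ⟨i, hi, hpi⟩ := mem_iUnion₂.1 (hcov hp)
      exact mem_iUnion.2 ⟨⟨i, hi⟩, hpi⟩)
  refine ⟨s, fun i p => if h : i ∈ s then (f ⟨i, h⟩ p : 𝕜) else 0, hs, fun i => ?_, fun i hi => ?_,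
    fun p hp => ?_⟩
  · by_cases h : i ∈ s
    · simpa [h] using contMDiff_ofReal 𝕜 (f ⟨i, h⟩).contMDiff
    · simpa [h] using contMDiff_const
  · refine Subset.trans ?_ ((hf ⟨i, hi⟩).trans interior_subset)
    refine closure_mono fun p hp => ?_
    simpa [hi] using hp
  · have h1 := f.sum_eq_one hp
    rw [finsum_eq_sum_of_fintype] at h1
    rw [← Finset.sum_coe_sort s]
    simp only [Subtype.coe_eta, Finset.coe_mem, dite_true]
    exact_mod_cast congrArg (RCLike.ofReal (K := 𝕜)) h1

end Cutoff

/-! ### Density of the test sections -/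

section Density

variable {𝕜 : Type*} [RCLike 𝕜]
  {EB : Type*} [NormedAddCommGroup EB] [NormedSpace ℝ EB] [FiniteDimensional ℝ EB]
  {B : Type*} [TopologicalSpace B] [ChartedSpace EB B] [IsManifold 𝓘(ℝ, EB) ∞ B]
  {EM : Type*} [NormedAddCommGroup EM] [NormedSpace ℝ EM] [FiniteDimensional ℝ EM]
  {M : Type*} [TopologicalSpace M] [ChartedSpace EM M] [IsManifold 𝓘(ℝ, EM) ∞ M]
  {F : Type*} [NormedAddCommGroup F] [NormedSpace ℝ F] [NormedSpace 𝕜 F] [IsScalarTower ℝ 𝕜 F]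
  [FiniteDimensional ℝ F]
  {E : M → Type*} [TopologicalSpace (TotalSpace F E)] [∀ p, TopologicalSpace (E p)]
  [FiberBundle F E] [∀ p, AddCommGroup (E p)] [∀ p, Module ℝ (E p)] [∀ p, Module 𝕜 (E p)]
  [VectorBundle 𝕜 F E] [VectorBundle ℝ F E] [ContMDiffVectorBundle ∞ F E 𝓘(ℝ, EM)]
  {r : M → B}

theorem eq_zero_of_notMem_supp {f : ∀ p : M, Module.Dual 𝕜 (E p)} {p : M} (hp : p ∉ supp f) :
    f p = 0 := by
  by_contra h
  exact hp (subset_closure h)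

theorem supp_mul_subset (ρ : M → 𝕜) (f : ∀ p : M, Module.Dual 𝕜 (E p)) :
    supp (fun p => ρ p • f p) ⊆ tsupport ρ ∩ supp f := by
  refine subset_inter (closure_mono fun p hp => ?_) (closure_mono fun p hp => ?_)
  · intro h; exact hp (by simp [h])
  · intro h; exact hp (by simp [h])

theorem sum_mul_eq {s : Finset M} {ρ : M → M → 𝕜} {K : Set M}
    (hsum : ∀ p ∈ K, ∑ i ∈ s, ρ i p = 1) {f : ∀ p : M, Module.Dual 𝕜 (E p)} (hf : supp f ⊆ K) :
    ∑ i ∈ s, (fun p => ρ i p • f p) = f := by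
  ext p z
  simp only [Finset.sum_apply, ← Finset.sum_smul]
  by_cases hp : p ∈ K
  · rw [hsum p hp, one_smul]
  · rw [eq_zero_of_notMem_supp fun h => hp (hf h), smul_zero]

theorem mul_mem_smoothSections {f : ∀ p : M, Module.Dual 𝕜 (E p)}
    (hf : f ∈ SmoothSections 𝕜 EM F E) {ρ : M → 𝕜} (hρ : ContMDiff 𝓘(ℝ, EM) 𝓘(ℝ, 𝕜) ∞ ρ) :
    (fun p => ρ p • f p) ∈ SmoothSections 𝕜 EM F E :=
  ((smoothFamily_const (T := Unit) hf).mul hρ).mem_smoothSections ()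

theorem mul_mem_testSections {f : ∀ p : M, Module.Dual 𝕜 (E p)}
    (hf : f ∈ TestSections 𝕜 EM F E) {ρ : M → 𝕜} (hρ : ContMDiff 𝓘(ℝ, EM) 𝓘(ℝ, 𝕜) ∞ ρ) :
    (fun p => ρ p • f p) ∈ TestSections 𝕜 EM F E := by
  obtain ⟨hs, K, hK, hfK⟩ := hf
  exact ⟨mul_mem_smoothSections hs hρ, K, hK, ((supp_mul_subset ρ f).trans inter_subset_right).trans
    hfK⟩

theorem mul_mem_testSections_of_compact [T2Space M] {f : ∀ p : M, Module.Dual 𝕜 (E p)}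
    (hf : f ∈ SmoothSections 𝕜 EM F E) {ρ : M → 𝕜} (hρ : ContMDiff 𝓘(ℝ, EM) 𝓘(ℝ, 𝕜) ∞ ρ)
    {K : Set M} (hK : IsCompact K) (hρK : ∀ p, p ∉ K → ρ p = 0) :
    (fun p => ρ p • f p) ∈ TestSections 𝕜 EM F E := by
  refine ⟨mul_mem_smoothSections hf hρ, K, hK, closure_minimal (fun p hp => ?_) hK.isClosed⟩
  by_contra h
  exact hp (by simp [hρK p h])

/-- A smooth section is the limit of a sequence of its multiples by smooth compactly supported
functions. The sequence and its limit are regarded as a smooth family over `ℕ ∪ {∞}`. -/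
theorem exists_smoothFamily_approx [T2Space M] [SecondCountableTopology M]
    {f : ∀ p : M, Module.Dual 𝕜 (E p)} (hf : f ∈ SmoothSections 𝕜 EM F E) :
    ∃ c : OnePoint ℕ → ∀ p : M, Module.Dual 𝕜 (E p), SmoothFamily 𝕜 EM F E c ∧
      c OnePoint.infty = f ∧ ∀ n : ℕ, c n ∈ TestSections 𝕜 EM F E ∧
        ∃ ρ : M → 𝕜, ∀ p, c n p = ρ p • f p := by
  have : LocallyCompactSpace M := Manifold.locallyCompact_of_finiteDimensional 𝓘(ℝ, EM)
  let X : CompactExhaustion M := default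
  choose K ρ hK _ hρ h1 h0 using fun n => exists_cutoff 𝕜 EM (X.isCompact n) isOpen_univ
    (subset_univ _)
  let c : OnePoint ℕ → ∀ p : M, Module.Dual 𝕜 (E p) := fun t =>
    match t with
    | none => f
    | some n => fun p => ρ n p • f p
  have hcn : ∀ n : ℕ, c n = fun p => ρ n p • f p := fun n => rfl
  refine ⟨c, fun p₀ v m => ParamContDiffOn.of_forall_mem ?_, rfl, fun n =>
    ⟨mul_mem_testSections_of_compact hf (hρ n) (hK n) (h0 n), ρ n, fun p => rfl⟩⟩
  rintro ⟨t, y⟩ ⟨-, hy⟩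
  have hD := isOpen_coordDomain (EM := EM) (F := F) (E := E) p₀
  rcases t with _ | n
  · -- at infinity: all but finitely many of the cutoff functions are `1` near the given point
    obtain ⟨N, hN⟩ : ∃ N, (chartAt EM p₀).symm y ∈ X N := by
      simpa using X.iUnion_eq.ge (mem_univ ((chartAt EM p₀).symm y))
    have hN' := X.subset_interior_succ N hN
    let Ω := coordDomain EM F E p₀ ∩ (chartAt EM p₀).symm ⁻¹' interior (X (N + 1))
    have hΩ : IsOpen Ω := (contMDiffOn_chartAt_symm_coordDomain (EM := EM) (F := F) (E := E)
      p₀).continuousOn.isOpen_inter_preimage hD isOpen_interior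
    let S : Set (OnePoint ℕ) := ((fun n : ℕ => (n : OnePoint ℕ)) '' Iic N)ᶜ
    have hS : IsOpen S := OnePoint.isOpen_compl_image_coe.2
      ⟨(finite_Iic N).isClosed, (finite_Iic N).isCompact⟩
    refine ⟨S ×ˢ Ω, hS.prod hΩ, ⟨OnePoint.infty_notMem_image_coe, hy, hN'⟩, ?_⟩
    refine (ParamContDiffOn.of_contDiffOn (T := OnePoint ℕ) (contDiffOn_coordRep hf p₀ v) hD
      fun p hp => hp.2.1).congr (hS.prod hΩ) ?_
    rintro t z ⟨ht, hz⟩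
    rcases t with _ | n
    · rfl
    · have hn : N + 1 ≤ n := by
        by_contra h
        exact ht ⟨n, by simp only [mem_Iic]; omega, rfl⟩
      have h2 := (h1 n).self_of_nhdsSet ((chartAt EM p₀).symm z)
        (X.subset hn (interior_subset hz.2))
      change ρ n _ • coordRep 𝕜 EM F E f p₀ v z = _
      rw [h2, one_smul]
  · let S : Set (OnePoint ℕ) := {(n : OnePoint ℕ)}
    have hS : IsOpen S := by
      have := OnePoint.isOpen_image_coe.2 (isOpen_discrete ({n} : Set ℕ))
      simpa using this
    refine ⟨S ×ˢ coordDomain EM F E p₀, hS.prod hD, ⟨rfl, hy⟩, ?_⟩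
    refine (ParamContDiffOn.of_contDiffOn (T := OnePoint ℕ)
      (contDiffOn_coordRep (mul_mem_smoothSections hf (hρ n)) p₀ v) hD
      fun p hp => hp.2).congr (hS.prod hD) ?_
    rintro t z ⟨ht, hz⟩
    have : t = (n : OnePoint ℕ) := ht
    rw [this, hcn]

/-- Two distributions that agree along a sequence of sections agree on its limit. -/
theorem CompactFiberedDistribution.eq_of_approx (U : CompactFiberedDistribution 𝕜 EB EM F E r)
    (U' : CompactFiberedDistribution 𝕜 EB EM F E r)
    {c : OnePoint ℕ → ∀ p : M, Module.Dual 𝕜 (E p)} (hc : SmoothFamily 𝕜 EM F E c) (x : B)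
    (h : ∀ n : ℕ, U.toFun ⟨c n, hc.mem_smoothSections n⟩ x =
      U'.toFun ⟨c n, hc.mem_smoothSections n⟩ x) :
    U.toFun ⟨c OnePoint.infty, hc.mem_smoothSections _⟩ x =
      U'.toFun ⟨c OnePoint.infty, hc.mem_smoothSections _⟩ x := by
  have hcont : ∀ U : CompactFiberedDistribution 𝕜 EB EM F E r,
      Continuous fun t => U.toFun ⟨c t, hc.mem_smoothSections t⟩ x := fun U => by
    have := (U.paramSmoothOn_eval hc x).continuousOn.comp_continuous
      (f := fun t : OnePoint ℕ => (t, chartAt EB x x)) (by fun_prop)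
      fun t => ⟨mem_univ _, mem_chart_target EB x⟩
    refine this.congr fun t => ?_
    simp only [Function.comp_apply, (chartAt EB x).left_inv (mem_chart_source EB x)]
  exact congrFun (OnePoint.denseRange_coe.equalizer (hcont U) (hcont U') (funext h)) _

/-- By density of the test sections, the extension of `u` to smooth sections is unique. -/
theorem CompactFiberedDistribution.toFun_eq_of_extends [T2Space M] [SecondCountableTopology M]
    {U U' : CompactFiberedDistribution 𝕜 EB EM F E r} {u : FiberedDistribution 𝕜 EB EM F E r}
    (h : U.Extends u) (h' : U'.Extends u) (f : SmoothSections 𝕜 EM F E) (x : B) :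
    U.toFun f x = U'.toFun f x := by
  obtain ⟨c, hc, hcf, hn⟩ := exists_smoothFamily_approx f.2
  have := U.eq_of_approx U' hc x fun n => by
    have e1 := congrArg (fun g => g x) (h ⟨c n, (hn n).1⟩)
    have e2 := congrArg (fun g => g x) (h' ⟨c n, (hn n).1⟩)
    exact e1.trans e2.symm
  simpa only [hcf] using this

/-- The value of `⟨u^x, g⟩` is unique. If it is obtained once from `u` and once from an extension of
`u` to smooth sections, a test section with restriction `g` gives both values. -/
theorem FiberedDistribution.Pairs.unique [T2Space M] [SecondCountableTopology M]
    {u : FiberedDistribution 𝕜 EB EM F E r} {x : B}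
    {g : ∀ p : {p : M // r p = x}, Module.Dual 𝕜 (E p.1)} {a b : 𝕜} (ha : u.Pairs x g a)
    (hb : u.Pairs x g b) : a = b := by
  rcases ha with ⟨⟨f, hf⟩, ha⟩ | ⟨U, hU, ⟨f, hf⟩, ha⟩
  · rcases hb with ⟨-, hb⟩ | ⟨U', hU', -, hb⟩
    · rw [← ha f hf, ← hb f hf]
    · rw [← ha f hf, ← hb (TestSections.toSmooth 𝕜 EM F E f) hf, hU' f]
  · rcases hb with ⟨⟨f', hf'⟩, hb⟩ | ⟨U', hU', -, hb⟩
    · rw [← hb f' hf', ← ha (TestSections.toSmooth 𝕜 EM F E f') hf', hU f']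
    · rw [← ha f hf, ← hb f hf]
      exact CompactFiberedDistribution.toFun_eq_of_extends hU hU' f x

end Density

/-! ### Locality of distributions along the fibres of a submersion -/

/-- Extension by zero of a family which vanishes outside of a closed set. -/
theorem ParamSmoothOn.extend_zero {T A H : Type*} [TopologicalSpace T]
    [NormedAddCommGroup A] [NormedSpace ℝ A] [NormedAddCommGroup H] [NormedSpace ℝ H]
    {f g : T → A → H} {Ω C : Set A} (hf : ParamSmoothOn f (univ ×ˢ Ω)) (hΩ : IsOpen Ω)
    (hC : IsClosed C) (hCΩ : C ⊆ Ω) (hg : ∀ t, ∀ a ∈ Ω, g t a = f t a)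
    (hgC : ∀ t, ∀ a ∉ C, g t a = 0) : ParamSmoothOn g univ := by
  refine fun n => ParamContDiffOn.of_forall_mem ?_
  rintro ⟨t, a⟩ -
  by_cases ha : a ∈ C
  · exact ⟨univ ×ˢ Ω, isOpen_univ.prod hΩ, ⟨mem_univ _, hCΩ ha⟩,
      (hf n).congr (isOpen_univ.prod hΩ) fun t a h => hg t a h.2⟩
  · exact ⟨univ ×ˢ Cᶜ, isOpen_univ.prod hC.isOpen_compl, ⟨mem_univ _, ha⟩,
      ParamContDiffOn.zero.congr (isOpen_univ.prod hC.isOpen_compl) fun t a h => hgC t a h.2⟩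

section Fibres

universe w

variable {𝕜 : Type*} [RCLike 𝕜]
  {EB : Type*} [NormedAddCommGroup EB] [NormedSpace ℝ EB] [FiniteDimensional ℝ EB]
  {B : Type*} [TopologicalSpace B] [T2Space B] [SecondCountableTopology B]
  [ChartedSpace EB B] [IsManifold 𝓘(ℝ, EB) ∞ B]
  {EM : Type w} [NormedAddCommGroup EM] [NormedSpace ℝ EM] [FiniteDimensional ℝ EM]
  {M : Type*} [TopologicalSpace M] [T2Space M] [SecondCountableTopology M]
  [ChartedSpace EM M] [IsManifold 𝓘(ℝ, EM) ∞ M]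
  {F : Type*} [NormedAddCommGroup F] [NormedSpace ℝ F] [NormedSpace 𝕜 F] [IsScalarTower ℝ 𝕜 F]
  [FiniteDimensional ℝ F]
  {E : M → Type*} [TopologicalSpace (TotalSpace F E)] [∀ p, TopologicalSpace (E p)]
  [FiberBundle F E] [∀ p, AddCommGroup (E p)] [∀ p, Module ℝ (E p)] [∀ p, Module 𝕜 (E p)]
  [VectorBundle 𝕜 F E] [VectorBundle ℝ F E] [ContMDiffVectorBundle ∞ F E 𝓘(ℝ, EM)]
  {Z : Type*} [NormedAddCommGroup Z] [NormedSpace ℝ Z]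
  {r : M → B} {χ : OpenPartialHomeomorph M EM} {ψ : OpenPartialHomeomorph B EB}
  {Λ : EM ≃L[ℝ] EB × Z}
  {e : Trivialization F (π F E)} [MemTrivializationAtlas e] {L : Set EM}

/-- In the charts `χ` and `ψ`, and up to the linear isomorphism `Λ`, the map `r` is the projection
to the first factor. -/
structure IsSubmersionBox (r : M → B) (χ : OpenPartialHomeomorph M EM)
    (ψ : OpenPartialHomeomorph B EB) (Λ : EM ≃L[ℝ] EB × Z) : Prop where
  dom_mem : χ ∈ IsManifold.maximalAtlas 𝓘(ℝ, EM) ∞ M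
  cod_mem : ψ ∈ IsManifold.maximalAtlas 𝓘(ℝ, EB) ∞ B
  mapsTo : ∀ p ∈ χ.source, r p ∈ ψ.source
  eq_fst : ∀ p ∈ χ.source, ψ (r p) = (Λ (χ p)).1

theorem exists_isSubmersionBox (hr : Manifold.IsSubmersion 𝓘(ℝ, EM) 𝓘(ℝ, EB) ∞ r) (p : M) :
    ∃ (Z : Type w) (_ : NormedAddCommGroup Z) (_ : NormedSpace ℝ Z)
      (χ : OpenPartialHomeomorph M EM) (ψ : OpenPartialHomeomorph B EB) (Λ : EM ≃L[ℝ] EB × Z),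
      p ∈ χ.source ∧ IsSubmersionBox r χ ψ Λ := by
  have h := hr.isSubmersionAt p
  refine ⟨h.complement, inferInstance, inferInstance, h.domChart, h.codChart, h.equiv,
    h.mem_domChart_source, h.domChart_mem_maximalAtlas, h.codChart_mem_maximalAtlas,
    fun q hq => h.source_subset_preimage_source hq, fun q hq => ?_⟩
  have hq' : h.domChart q ∈ h.domChart.target := h.domChart.map_source hq
  have hq'' : h.domChart q ∈ (h.domChart.extend 𝓘(ℝ, EM)).target := by simpa using hq'
  have h1 := h.writtenInCharts hq''
  simpa [h.domChart.left_inv hq] using h1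

open scoped Classical in
/-- The component of a section of `E*` along the vector `v`, in the chart `χ` and the
trivialization `e`, extended by zero. -/
noncomputable def localCoord (χ : OpenPartialHomeomorph M EM) (e : Trivialization F (π F E))
    (g : ∀ p : M, Module.Dual 𝕜 (E p)) (v : F) (a : EM) : 𝕜 :=
  if a ∈ boxDomain χ e then g (χ.symm a) (e.symm (χ.symm a) v) else 0

theorem contDiff_localCoord (hχ : χ ∈ IsManifold.maximalAtlas 𝓘(ℝ, EM) ∞ M) (hL : IsCompact L)
    (hLD : L ⊆ boxDomain χ e) {g : ∀ p : M, Module.Dual 𝕜 (E p)}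
    (hg : g ∈ SmoothSections 𝕜 EM F E) (hgL : ∀ p ∉ χ.symm '' L, g p = 0) (v : F) :
    ContDiff ℝ ∞ (localCoord χ e g v) ∧ ∀ a ∉ L, localCoord χ e g v a = 0 := by
  have h0 : ∀ a ∉ L, localCoord χ e g v a = 0 := fun a ha => by
    by_cases h : a ∈ boxDomain χ e
    · have : χ.symm a ∉ χ.symm '' L := by
        rintro ⟨b, hb, hab⟩
        exact ha (χ.symm.injOn (hLD hb).1 h.1 hab ▸ hb)
      simp [localCoord, hgL _ this]
    · simp [localCoord, h]
  refine ⟨?_, h0⟩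
  have h1 : ContMDiffOn 𝓘(ℝ, EM) (𝓘(ℝ, EM).prod 𝓘(ℝ, F)) ∞
      (fun a => (⟨χ.symm a, e.symm (χ.symm a) v⟩ : TotalSpace F E)) (boxDomain χ e) :=
    contMDiffOn_symm_comp ((contMDiffOn_symm_of_mem_maximalAtlas hχ).mono inter_subset_left)
      (fun a ha => ha.2) v
  have h2 := (smoothFamily_const (T := Unit) hg).eval isOpen_boxDomain h1
  exact (h2.extend_zero (g := fun _ => localCoord χ e g v) isOpen_boxDomain hL.isClosed hLD
    (fun _ a ha => by simp [localCoord, ha]) fun _ => h0).contDiff ()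

/-- A section with support in the domain of a chart and of a trivialization is given by its
components. -/
theorem eq_sum_localSection {ι : Type*} [Fintype ι] (b : Module.Basis ι 𝕜 F)
    (hLD : L ⊆ boxDomain χ e) {g : ∀ p : M, Module.Dual 𝕜 (E p)}
    (hgL : ∀ p ∉ χ.symm '' L, g p = 0) :
    g = ∑ j, localSection χ e (b.coord j) (localCoord χ e g (b j)) := by
  ext p z
  rw [Finset.sum_apply, LinearMap.sum_apply]
  by_cases hp : p ∈ χ.source ∧ p ∈ e.baseSet
  · have ha : χ p ∈ boxDomain χ e := ⟨χ.map_source hp.1, by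
      rw [mem_preimage, χ.left_inv hp.1]; exact hp.2⟩
    rw [apply_eq_sum_coord b e hp.2 (g p) z]
    refine Finset.sum_congr rfl fun j _ => ?_
    rw [localSection_apply hp.1 hp.2, localCoord, if_pos ha, χ.left_inv hp.1, mul_comm]
  · have h0 : ∀ a, a ∈ L → χ.symm a ≠ p := fun a ha hap =>
      hp (hap ▸ ⟨χ.map_target (hLD ha).1, (hLD ha).2⟩)
    rw [hgL p fun ⟨a, ha, hap⟩ => h0 a ha hap]
    refine (Finset.sum_eq_zero fun j _ => ?_).symm
    rw [localSection]
    split_ifs with h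
    · have : p ∉ e.baseSet := fun h' => hp ⟨h, h'⟩
      have h1 : χ p ∉ boxDomain χ e := fun h' => this (by simpa [χ.left_inv h] using h'.2)
      simp [localCoord, h1]
    · rfl

namespace FiberedDistribution

variable (u : FiberedDistribution 𝕜 EB EM F E r)

/-- The pairing of `u` with a section divisible by a function of `r` that vanishes at `x₀` is zero
at `x₀`. -/
theorem eval_localSection_mul_eq_zero (hbox : IsSubmersionBox r χ ψ Λ) (hr : Continuous r)
    (hL : IsCompact L) (hLD : L ⊆ boxDomain χ e) {κ : EM → 𝕜} (hκ : ContDiff ℝ ∞ κ)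
    (hκL : ∀ a ∉ L, κ a = 0) (l : F →ₗ[𝕜] 𝕜) {x₀ : B} (ℓ : EB →L[ℝ] ℝ) :
    u.eval (localSection χ e l fun a => (ℓ ((Λ a).1 - ψ x₀) : 𝕜) * κ a) x₀ = 0 := by
  have hKc : IsCompact (r '' (χ.symm '' L)) := (isCompact_image_symm hL hLD).image hr
  have hKs : r '' (χ.symm '' L) ⊆ ψ.source := by
    rintro _ ⟨_, ⟨a, ha, rfl⟩, rfl⟩
    exact hbox.mapsTo _ (χ.map_target (hLD ha).1)
  obtain ⟨K', θ, hK', hK's, hθ, h1, h0⟩ := exists_cutoff 𝕜 EB hKc ψ.open_source hKs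
  -- the divisor, as a function on the base cut off outside of the chart domain
  have hH : ContMDiff 𝓘(ℝ, EB) 𝓘(ℝ, 𝕜) ∞ (fun x => θ x * (ℓ (ψ x - ψ x₀) : 𝕜)) := by
    intro x
    by_cases hx : x ∈ K'
    · refine hθ.contMDiffAt.mul_rclike ?_
      have h2 : ContDiff ℝ ∞ (fun y : EB => (ℓ (y - ψ x₀) : 𝕜)) :=
        (RCLike.ofRealCLM (K := 𝕜)).contDiff.comp (ℓ.contDiff.comp (contDiff_id.sub contDiff_const))
      exact h2.contMDiff.contMDiffAt.comp x ((contMDiffOn_of_mem_maximalAtlas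
        hbox.cod_mem).contMDiffAt (ψ.open_source.mem_nhds (hK's hx)))
    · refine (contMDiffAt_const (c := (0 : 𝕜))).congr_of_eventuallyEq ?_
      filter_upwards [hK'.isClosed.isOpen_compl.mem_nhds hx] with y hy
      simp [h0 y hy]
  have hκ' : ContDiff ℝ ∞ fun a => (ℓ ((Λ a).1 - ψ x₀) : 𝕜) * κ a := by
    refine ContDiff.mul ((RCLike.ofRealCLM (K := 𝕜)).contDiff.comp (ℓ.contDiff.comp
      ((contDiff_fst.comp Λ.contDiff).sub contDiff_const))) hκ
  rw [u.eval_mul (localSection_mem_testSections (l := l) hbox.dom_mem hL hLD hκ hκL)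
    (localSection_mem_testSections hbox.dom_mem hL hLD hκ' fun a ha => by simp [hκL a ha]) hH
    fun p => ?_]
  · simp
  · by_cases hp : p ∈ χ.symm '' L
    · have hps : p ∈ χ.source := by
        obtain ⟨a, ha, rfl⟩ := hp
        exact χ.map_target (hLD ha).1
      simp only [localSection, hps, if_true]
      rw [h1.self_of_nhdsSet _ (mem_image_of_mem r hp), hbox.eq_fst p hps, one_mul, smul_smul]
    · rw [localSection_eq_zero hκL hp, localSection_eq_zero (fun a ha => by simp [hκL a ha]) hp]
      simp

/-- If the coordinate function of a section vanishes on the fibre over `x₀`, the pairing with `u` is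
zero at `x₀`. The coordinate function is contracted to the fibre along the segments
`y₁ + τ (y - y₁)`, and the derivative of the pairing in `τ` vanishes because the derivative of the
section is divisible by `y - y₁`. -/
theorem eval_localSection_eq_zero (hbox : IsSubmersionBox r χ ψ Λ) (hr : Continuous r)
    {x₀ : B} {z₁ : Z} {ε : ℝ} (hε : 0 < ε)
    (hD : Λ.symm '' (Metric.closedBall (ψ x₀) (2 * ε) ×ˢ Metric.closedBall z₁ (2 * ε)) ⊆
      boxDomain χ e) {g : EM → 𝕜} (hg : ContDiff ℝ ∞ g)
    (hgL : ∀ a ∉ Λ.symm '' (Metric.closedBall (ψ x₀) ε ×ˢ Metric.closedBall z₁ (2 * ε)), g a = 0)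
    (hg0 : ∀ a, (Λ a).1 = ψ x₀ → g a = 0) (l : F →ₗ[𝕜] 𝕜) :
    u.eval (localSection χ e l g) x₀ = 0 := by
  have : FiniteDimensional ℝ (EB × Z) := LinearEquiv.finiteDimensional Λ.toLinearEquiv
  have : FiniteDimensional ℝ Z :=
    Module.Finite.of_surjective (LinearMap.snd ℝ EB Z) Prod.snd_surjective
  set y₁ := ψ x₀
  set L := Λ.symm '' (Metric.closedBall y₁ (2 * ε) ×ˢ Metric.closedBall z₁ (2 * ε)) with hLdef
  have hL : IsCompact L := ((isCompact_closedBall y₁ (2 * ε)).prod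
    (isCompact_closedBall z₁ (2 * ε))).image Λ.symm.continuous
  have hmemL : ∀ a, a ∈ L ↔ (Λ a).1 ∈ Metric.closedBall y₁ (2 * ε) ∧
      (Λ a).2 ∈ Metric.closedBall z₁ (2 * ε) := fun a => by
    rw [hLdef]
    constructor
    · rintro ⟨q, hq, rfl⟩; simpa using hq
    · exact fun h => ⟨Λ a, h, Λ.symm_apply_apply a⟩
  have hgL' : ∀ a, g a ≠ 0 → (Λ a).1 ∈ Metric.closedBall y₁ ε ∧
      (Λ a).2 ∈ Metric.closedBall z₁ (2 * ε) := fun a ha => by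
    by_contra h
    refine ha (hgL a ?_)
    rintro ⟨q, hq, rfl⟩
    exact h (by simpa using hq)
  let bump : ContDiffBump y₁ := ⟨ε, 2 * ε, hε, by linarith⟩
  let σ : ℝ × EM → EM := fun p => Λ.symm (y₁ + p.1 • ((Λ p.2).1 - y₁), (Λ p.2).2)
  have hσ : ContDiff ℝ ∞ σ := by
    refine Λ.symm.contDiff.comp (ContDiff.prodMk (contDiff_const.add (contDiff_fst.smul
      ((contDiff_fst.comp (Λ.contDiff.comp contDiff_snd)).sub contDiff_const)))
      (contDiff_snd.comp (Λ.contDiff.comp contDiff_snd)))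
  let f : Unit → ℝ × EM → 𝕜 := fun _ p => (bump (Λ p.2).1 : 𝕜) * g (σ p)
  have hbump : ContDiff ℝ ∞ fun a : EM => (bump (Λ a).1 : 𝕜) :=
    (RCLike.ofRealCLM (K := 𝕜)).contDiff.comp
      (bump.contDiff.comp (contDiff_fst.comp Λ.contDiff))
  have hf : ContDiff ℝ ∞ (f ()) := (hbump.comp contDiff_snd).mul (hg.comp hσ)
  have hf' : ParamSmoothOn f univ := fun n =>
    ParamContDiffOn.of_contDiffOn (g := f ()) hf.contDiffOn isOpen_univ (by simp)
  have hbumpL : ∀ (τ : ℝ) (a : EM), a ∉ L → bump (Λ a).1 = 0 ∨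
      (Λ a).2 ∉ Metric.closedBall z₁ (2 * ε) := fun τ a ha => by
    by_contra! h
    refine ha ((hmemL a).2 ⟨?_, h.2⟩)
    have : (Λ a).1 ∈ Function.support bump := h.1
    rw [bump.support_eq] at this
    exact Metric.ball_subset_closedBall this
  have hfL : ∀ t τ a, a ∉ L → f t (τ, a) = 0 := fun t τ a ha => by
    rcases hbumpL τ a ha with h | h
    · simp [f, h]
    · have : g (σ (τ, a)) = 0 := by
        by_contra h'
        exact h (by simpa [σ] using (hgL' _ h').2)
      simp [f, this]
  -- the derivative in `τ` is a combination of the components of `y - y₁`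
  let b := Module.finBasis ℝ EB
  let ℓ : Fin (Module.finrank ℝ EB) → EB →L[ℝ] ℝ := fun i =>
    LinearMap.toContinuousLinearMap (b.coord i)
  let κ : ℝ → Fin (Module.finrank ℝ EB) → EM → 𝕜 := fun τ i a =>
    (bump (Λ a).1 : 𝕜) * fderiv ℝ g (σ (τ, a)) (Λ.symm (b i, 0))
  have hκ : ∀ τ i, ContDiff ℝ ∞ (κ τ i) := fun τ i => by
    refine hbump.mul ?_
    have h1 : ContDiff ℝ ∞ fun a => fderiv ℝ g a (Λ.symm (b i, 0)) :=
      (hg.fderiv_right (m := ∞) (by simp)).clm_apply contDiff_const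
    exact h1.comp (hσ.comp (contDiff_const.prodMk contDiff_id))
  have hκL : ∀ τ i, ∀ a ∉ L, κ τ i a = 0 := fun τ i a ha => by
    rcases hbumpL τ a ha with h | h
    · simp [κ, h]
    · have : g =ᶠ[𝓝 (σ (τ, a))] fun _ => 0 := by
        have hopen : IsOpen {a : EM | (Λ a).2 ∉ Metric.closedBall z₁ (2 * ε)} :=
          (Metric.isClosed_closedBall.preimage
            (continuous_snd.comp Λ.continuous)).isOpen_compl
        filter_upwards [hopen.mem_nhds (show σ (τ, a) ∈ _ by simpa [σ] using h)] with a' ha'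
        by_contra h'
        exact ha' (hgL' _ h').2
      simp [κ, this.fderiv_eq]
  have hder : ∀ τ : ℝ, (fun a => fderiv ℝ (f ()) (τ, a) (1, 0)) =
      ∑ i, fun a => (ℓ i ((Λ a).1 - y₁) : 𝕜) * κ τ i a := fun τ => by
    ext a
    have hs : HasDerivAt (fun t : ℝ => σ (t, a)) (Λ.symm ((Λ a).1 - y₁, 0)) τ := by
      have h1 : HasDerivAt (fun t : ℝ => (y₁ + t • ((Λ a).1 - y₁), (Λ a).2))
          ((Λ a).1 - y₁, 0) τ := by
        refine HasDerivAt.prodMk ?_ (hasDerivAt_const _ _)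
        simpa using ((hasDerivAt_id τ).smul_const ((Λ a).1 - y₁)).const_add y₁
      exact (Λ.symm : EB × Z →L[ℝ] EM).hasFDerivAt.comp_hasDerivAt τ h1
    have h2 : HasDerivAt (fun t : ℝ => f () (t, a)) (fderiv ℝ (f ()) (τ, a) (1, 0)) τ :=
      ((hf.differentiable (by simp)).differentiableAt.hasFDerivAt).comp_hasDerivAt τ
        ((hasDerivAt_id τ).prodMk (hasDerivAt_const τ a))
    have h3 : HasDerivAt (fun t : ℝ => f () (t, a))
        ((bump (Λ a).1 : 𝕜) * fderiv ℝ g (σ (τ, a)) (Λ.symm ((Λ a).1 - y₁, 0))) τ :=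
      ((hg.differentiable (by simp)).differentiableAt.hasFDerivAt.comp_hasDerivAt τ hs).const_mul
        (bump (Λ a).1 : 𝕜)
    rw [h2.unique h3, Finset.sum_apply]
    have h4 : Λ.symm ((Λ a).1 - y₁, 0) = ∑ i, ℓ i ((Λ a).1 - y₁) • Λ.symm (b i, 0) := by
      have h5 := congrArg (fun y => Λ.symm (LinearMap.inl ℝ EB Z y)) (b.sum_repr ((Λ a).1 - y₁))
      simp only [map_sum, map_smul] at h5
      exact h5.symm
    rw [h4, map_sum, Finset.mul_sum]
    refine Finset.sum_congr rfl fun i _ => ?_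
    rw [map_smul, RCLike.real_smul_eq_coe_mul]
    simp only [κ]
    ring
  have hdz : ∀ τ : ℝ, HasDerivAt
      (fun τ => u.eval (localSection χ e l fun a => f () (τ, a)) x₀) 0 τ := fun τ => by
    have h1 := u.hasLineDerivAt_localDeriv (l := l) hbox.dom_mem hL hD hf' hfL x₀ 0 Fin.elim0
      (mem_chart_target EB x₀) () τ (1 : ℝ)
    have h2 : ∀ g : EM → 𝕜, u.localDeriv χ e l x₀ 0 Fin.elim0 g (chartAt EB x₀ x₀) =
        u.eval (localSection χ e l g) x₀ := fun g => by
      simp [localDeriv, (chartAt EB x₀).left_inv (mem_chart_source EB x₀)]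
    simp only [h2] at h1
    rw [hder τ] at h1
    have h3 : u.eval (localSection χ e l
        (∑ i, fun a => (ℓ i ((Λ a).1 - y₁) : 𝕜) * κ τ i a)) x₀ = 0 := by
      have h4 : localSection χ e l (∑ i, fun a => (ℓ i ((Λ a).1 - y₁) : 𝕜) * κ τ i a) =
          ∑ i, localSection χ e l (fun a => (ℓ i ((Λ a).1 - y₁) : 𝕜) * κ τ i a) := by
        exact map_sum (AddMonoidHom.mk' (fun g => localSection χ e l g)
          (localSection_add (𝕜 := 𝕜))) _ _
      rw [h4, u.eval_sum]
      · exact Finset.sum_eq_zero fun i _ => u.eval_localSection_mul_eq_zero hbox hr hL hD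
          (hκ τ i) (hκL τ i) l (ℓ i)
      · intro i _
        refine localSection_mem_testSections hbox.dom_mem hL hD (ContDiff.mul
          ((RCLike.ofRealCLM (K := 𝕜)).contDiff.comp ((ℓ i).contDiff.comp
          ((contDiff_fst.comp Λ.contDiff).sub contDiff_const))) (hκ τ i)) fun a ha => by
            simp [hκL τ i a ha]
    rw [h3] at h1
    have h5 : HasDerivAt (fun t : ℝ => u.eval (localSection χ e l fun a => f () (τ + t, a)) x₀)
        0 (τ - τ) := by simpa [HasLineDerivAt] using h1
    have h6 := h5.comp_sub_const τ τ
    simpa using h6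
  have hconst := is_const_of_deriv_eq_zero (fun τ => (hdz τ).differentiableAt)
    (fun τ => (hdz τ).deriv) 1 0
  have hf1 : (fun a => f () (1, a)) = g := by
    ext a
    have h1 : σ (1, a) = a := by simp [σ]
    simp only [f, h1]
    by_cases ha : g a = 0
    · simp [ha]
    · rw [bump.one_of_mem_closedBall (hgL' a ha).1]; simp
  have hf0 : (fun a => f () (0, a)) = 0 := by
    ext a
    have h1 : g (σ (0, a)) = 0 := hg0 _ (by simp [σ, y₁])
    simp [f, h1]
  have hz : localSection χ e l (0 : EM → 𝕜) = 0 := by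
    simpa using localSection_smul (χ := χ) (e := e) (l := l) (0 : 𝕜) (0 : EM → 𝕜)
  rw [hf1, hf0, hz, u.eval_zero] at hconst
  exact hconst

/-- The value of `u f` at `x₀` depends only on the restriction of `f` to the fibre over `x₀`. -/
theorem eval_eq_zero_of_restrict (hr : Manifold.IsSubmersion 𝓘(ℝ, EM) 𝓘(ℝ, EB) ∞ r)
    {f : ∀ p : M, Module.Dual 𝕜 (E p)} (hf : f ∈ TestSections 𝕜 EM F E) {x₀ : B}
    (h0 : ∀ p, r p = x₀ → f p = 0) : u.eval f x₀ = 0 := by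
  have hrc : Continuous r := hr.contMDiff.continuous
  have hfin := finiteDimensional_fiber 𝕜 F
  obtain ⟨K, hK, hfK⟩ := hf.2
  have key : ∀ p, ∃ N ∈ 𝓝 p, ∀ ρ : M → 𝕜, ContMDiff 𝓘(ℝ, EM) 𝓘(ℝ, 𝕜) ∞ ρ → tsupport ρ ⊆ N →
      u.eval (fun q => ρ q • f q) x₀ = 0 := by
    intro p
    by_cases hp : r p = x₀
    · -- a box in submersion coordinates, small enough for contractions to the fibre
      obtain ⟨Z, _, _, χ, ψ, Λ, hpχ, hbox⟩ := exists_isSubmersionBox hr p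
      let e := trivializationAt F E p
      have hD : IsOpen (Λ.symm ⁻¹' boxDomain χ e) :=
        (isOpen_boxDomain (χ := χ) (e := e)).preimage Λ.symm.continuous
      have hpD : Λ (χ p) ∈ Λ.symm ⁻¹' boxDomain χ e := by
        simp only [mem_preimage, Λ.symm_apply_apply]
        refine ⟨χ.map_source hpχ, ?_⟩
        rw [mem_preimage, χ.left_inv hpχ]
        exact mem_baseSet_trivializationAt F E p
      have hΛ1 : (Λ (χ p)).1 = ψ x₀ := by rw [← hbox.eq_fst p hpχ, hp]
      obtain ⟨δ, hδ, hball⟩ := Metric.isOpen_iff.1 hD _ hpD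
      set ε := δ / 4
      have hε : 0 < ε := by positivity
      have hD' : Λ.symm '' (Metric.closedBall (ψ x₀) (2 * ε) ×ˢ
          Metric.closedBall (Λ (χ p)).2 (2 * ε)) ⊆ boxDomain χ e := by
        rintro _ ⟨q, hq, rfl⟩
        refine hball ?_
        rw [← hΛ1, closedBall_prod_same] at hq
        exact Metric.closedBall_subset_ball (by simp only [ε]; linarith) hq
      set L' := Λ.symm '' (Metric.closedBall (ψ x₀) ε ×ˢ Metric.closedBall (Λ (χ p)).2 (2 * ε))
        with hL'def
      have : FiniteDimensional ℝ (EB × Z) := LinearEquiv.finiteDimensional Λ.toLinearEquiv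
      have : FiniteDimensional ℝ Z :=
        Module.Finite.of_surjective (LinearMap.snd ℝ EB Z) Prod.snd_surjective
      have hL' : IsCompact L' := ((isCompact_closedBall _ _).prod
        (isCompact_closedBall _ _)).image Λ.symm.continuous
      have hL'D : L' ⊆ boxDomain χ e := (image_mono (prod_mono
        (Metric.closedBall_subset_closedBall (by linarith)) subset_rfl)).trans hD'
      refine ⟨χ.symm '' L', ?_, fun ρ hρ hρN => ?_⟩
      · have h1 : L' ∈ 𝓝 (χ p) := by
          have h2 : Metric.closedBall (ψ x₀) ε ×ˢ Metric.closedBall (Λ (χ p)).2 (2 * ε) ∈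
              𝓝 (Λ (χ p)) := by
            rw [← hΛ1]
            exact prod_mem_nhds (Metric.closedBall_mem_nhds _ hε)
              (Metric.closedBall_mem_nhds _ (by positivity))
          refine mem_of_superset (Λ.continuous.continuousAt.preimage_mem_nhds h2) fun a ha => ?_
          exact ⟨Λ a, ha, Λ.symm_apply_apply a⟩
        have := χ.symm.image_mem_nhds (χ.map_source hpχ) h1
        rwa [χ.left_inv hpχ] at this
      · have hg := mul_mem_smoothSections hf.1 hρ
        have hgL : ∀ q ∉ χ.symm '' L', (fun q => ρ q • f q) q = 0 := fun q hq => by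
          have : ρ q = 0 := by
            by_contra h
            exact hq (hρN (subset_tsupport ρ h))
          simp [this]
        have hb := Module.finBasis 𝕜 F
        rw [eq_sum_localSection hb hL'D hgL, u.eval_sum]
        · refine Finset.sum_eq_zero fun j _ => ?_
          have hloc := contDiff_localCoord hbox.dom_mem hL' hL'D hg hgL (hb j)
          refine u.eval_localSection_eq_zero hbox hrc hε hD' hloc.1 hloc.2 (fun a ha => ?_) _
          rw [localCoord]
          split_ifs with h
          · have h3 : r (χ.symm a) = x₀ := by
              refine ψ.injOn (hbox.mapsTo _ (χ.map_target h.1)) ?_ ?_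
              · rw [← hp]; exact hbox.mapsTo p hpχ
              · rw [hbox.eq_fst _ (χ.map_target h.1), χ.right_inv h.1, ha]
            simp [h0 _ h3]
          · rfl
        · intro j _
          have hloc := contDiff_localCoord hbox.dom_mem hL' hL'D hg hgL (hb j)
          exact localSection_mem_testSections hbox.dom_mem hL' hL'D hloc.1 hloc.2
    · -- where `h ∘ r = 1` with `h x₀ = 0`, sections are unchanged by multiplication with `h ∘ r`
      obtain ⟨K', h, -, hK'U, hh, h1, h0'⟩ := exists_cutoff 𝕜 EB (isCompact_singleton (x := r p))
        (isOpen_compl_singleton (x := x₀)) (by simpa using Ne.symm hp)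
      rw [nhdsSet_singleton] at h1
      refine ⟨r ⁻¹' {x | h x = 1}, hrc.continuousAt.preimage_mem_nhds h1, fun ρ hρ hρN => ?_⟩
      have hg := mul_mem_testSections hf hρ
      rw [u.eval_mul hg hg hh fun q => ?_, h0' x₀ fun hx => hK'U hx rfl, zero_mul]
      by_cases hq : q ∈ tsupport ρ
      · rw [show h (r q) = 1 from hρN hq, one_smul]
      · simp [image_eq_zero_of_notMem_tsupport hq]
  choose N hN hNρ using key
  obtain ⟨s, ρ, -, hρ, hρN, hsum⟩ := exists_finite_partition 𝕜 EM hK fun p _ => hN p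
  rw [← sum_mul_eq hsum hfK, u.eval_sum _ fun i _ => mul_mem_testSections hf (hρ i)]
  exact Finset.sum_eq_zero fun i hi => hNρ i _ (hρ i) (hρN i hi)

theorem eval_congr_of_restrict (hr : Manifold.IsSubmersion 𝓘(ℝ, EM) 𝓘(ℝ, EB) ∞ r)
    {f g : ∀ p : M, Module.Dual 𝕜 (E p)} (hf : f ∈ TestSections 𝕜 EM F E)
    (hg : g ∈ TestSections 𝕜 EM F E) {x₀ : B} (h0 : ∀ p, r p = x₀ → f p = g p) :
    u.eval f x₀ = u.eval g x₀ := by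
  have h1 := u.eval_eq_zero_of_restrict hr (Submodule.sub_mem _ hf hg) (x₀ := x₀)
    fun p hp => by simp [h0 p hp]
  have h2 := u.eval_add (Submodule.sub_mem _ hf hg) hg x₀
  rw [sub_add_cancel, h1, zero_add] at h2
  exact h2

end FiberedDistribution

/-- The value of `U f` at `x₀` depends only on the restriction of `f` to the fibre over `x₀`. -/
theorem CompactFiberedDistribution.toFun_congr_of_restrict
    (hr : Manifold.IsSubmersion 𝓘(ℝ, EM) 𝓘(ℝ, EB) ∞ r)
    {U : CompactFiberedDistribution 𝕜 EB EM F E r} {u : FiberedDistribution 𝕜 EB EM F E r}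
    (hU : U.Extends u) (f g : SmoothSections 𝕜 EM F E) {x₀ : B}
    (h0 : ∀ p, r p = x₀ → f.1 p = g.1 p) : U.toFun f x₀ = U.toFun g x₀ := by
  obtain ⟨c, hc, hcf, hn⟩ := exists_smoothFamily_approx (f - g).2
  have hcont : Continuous fun t => U.toFun ⟨c t, hc.mem_smoothSections t⟩ x₀ := by
    have := (U.paramSmoothOn_eval hc x₀).continuousOn.comp_continuous
      (f := fun t : OnePoint ℕ => (t, chartAt EB x₀ x₀)) (by fun_prop)
      fun t => ⟨mem_univ _, mem_chart_target EB x₀⟩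
    refine this.congr fun t => ?_
    simp only [Function.comp_apply, (chartAt EB x₀).left_inv (mem_chart_source EB x₀)]
  have hval : ∀ n : ℕ, U.toFun ⟨c n, hc.mem_smoothSections n⟩ x₀ = 0 := fun n => by
    obtain ⟨hcn, ρ, hρ⟩ := hn n
    have h1 := congrArg (fun g => g x₀) (hU ⟨c n, hcn⟩)
    refine h1.trans ?_
    rw [← u.eval_coe]
    refine u.eval_eq_zero_of_restrict hr hcn fun p hp => ?_
    rw [hρ]
    simp [h0 p hp]
  have h2 := congrFun (OnePoint.denseRange_coe.equalizer hcont continuous_const (funext hval))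
    OnePoint.infty
  simp only [hcf] at h2
  have h3 := U.isModuleMap.map_add (f - g) g x₀
  rw [show f - g + g = f from Subtype.ext (sub_add_cancel f.1 g.1)] at h3
  have h4 : U.toFun (f - g) x₀ = 0 := h2
  rw [h3, h4, zero_add]

end Fibres

/-! ### The inner pairing of the convolution formula, locally -/

section InnerPairing

universe w

variable {𝕜 : Type*} [RCLike 𝕜]
  {EG : Type w} [NormedAddCommGroup EG] [NormedSpace ℝ EG] [FiniteDimensional ℝ EG]
  {EB : Type*} [NormedAddCommGroup EB] [NormedSpace ℝ EB] [FiniteDimensional ℝ EB]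
  {G : Type*} [TopologicalSpace G] [T2Space G] [SecondCountableTopology G]
  [ChartedSpace EG G] [IsManifold 𝓘(ℝ, EG) ∞ G]
  {B : Type*} [TopologicalSpace B] [T2Space B] [SecondCountableTopology B]
  [ChartedSpace EB B] [IsManifold 𝓘(ℝ, EB) ∞ B]
  {F : Type*} [NormedAddCommGroup F] [NormedSpace ℝ F] [NormedSpace 𝕜 F] [IsScalarTower ℝ 𝕜 F]
  [FiniteDimensional ℝ F]
  {E : G → Type*} [TopologicalSpace (TotalSpace F E)] [∀ γ, TopologicalSpace (E γ)]
  [FiberBundle F E] [∀ γ, AddCommGroup (E γ)] [∀ γ, Module ℝ (E γ)] [∀ γ, Module 𝕜 (E γ)]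
  [VectorBundle 𝕜 F E] [VectorBundle ℝ F E] [ContMDiffVectorBundle ∞ F E 𝓘(ℝ, EG)]
  {𝒢 : LieGroupoid EG EB G B} {T : Type*} [TopologicalSpace T]

theorem LieGroupoid.inv_mul_mul (𝒢 : LieGroupoid EG EB G B) {γ η : G} (h : 𝒢.s γ = 𝒢.r η) :
    𝒢.mul (𝒢.inv γ) (𝒢.mul γ η) = η := by
  rw [← 𝒢.mul_assoc _ _ _ (𝒢.s_inv γ) h, 𝒢.inv_mul, h, 𝒢.one_mul]

/-- `f` is a smooth compactly supported section, and its restriction to the fibre over `s γ` is the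
contraction with `e` of `m^* φ (γ, ·)`. -/
structure IsPullbackExtension (m : MultiplicativeStructure 𝕜 F E 𝒢)
    (φ : ∀ γ : G, Module.Dual 𝕜 (E γ)) (γ : G) (e : E γ) (f : ∀ γ : G, Module.Dual 𝕜 (E γ)) :
    Prop where
  mem : f ∈ TestSections 𝕜 EG F E
  eq : ∀ η, 𝒢.s γ = 𝒢.r η → f η = (φ (𝒢.mul γ η)).comp (m.mulMap γ η e)

/-- For families `c` of sections supported near `ζ₁`, and `γ` near `γ₁`, there is a smooth family of
extensions of `m^* c (γ, ·)`. If `ζ₁ = γ₁ η₁`, such extensions are obtained near `η₁` by means of a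
local retraction to the fibre over `s γ`. -/
theorem exists_local_extension (m : MultiplicativeStructure 𝕜 F E 𝒢)
    (v : FiberedDistribution 𝕜 EB EG F E 𝒢.r) (p₀ : G) {y₁ : EG}
    (hy₁ : y₁ ∈ coordDomain EG F E p₀) (w : F) (ζ₁ : G) :
    ∃ N ∈ 𝓝 ζ₁, ∃ Y : Set EG, IsOpen Y ∧ y₁ ∈ Y ∧ Y ⊆ coordDomain EG F E p₀ ∧
      ∀ c : T → ∀ γ : G, Module.Dual 𝕜 (E γ), SmoothFamily 𝕜 EG F E c → (∀ t, supp (c t) ⊆ N) →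
        ∃ f : T → EG → ∀ γ : G, Module.Dual 𝕜 (E γ),
          (∀ t, ∀ y ∈ Y, IsPullbackExtension m (c t) ((chartAt EG p₀).symm y)
            ((trivializationAt F E p₀).symm ((chartAt EG p₀).symm y) w) (f t y)) ∧
          ParamSmoothOn (fun t y => v.eval (f t y) (𝒢.s ((chartAt EG p₀).symm y)))
            (univ ×ˢ Y) := by
  set D := coordDomain EG F E p₀
  have hDo : IsOpen D := isOpen_coordDomain p₀
  let Γ : EG → G := (chartAt EG p₀).symm
  have hΓ : ContMDiffOn 𝓘(ℝ, EG) 𝓘(ℝ, EG) ∞ Γ D := contMDiffOn_chartAt_symm_coordDomain p₀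
  have hsc : ContMDiff 𝓘(ℝ, EG) 𝓘(ℝ, EB) ∞ 𝒢.s := 𝒢.isSubmersion_s.contMDiff
  have hrc : ContMDiff 𝓘(ℝ, EG) 𝓘(ℝ, EB) ∞ 𝒢.r := 𝒢.isSubmersion_r.contMDiff
  by_cases hcase : 𝒢.r (Γ y₁) = 𝒢.r ζ₁
  swap
  · -- `r (γ η) = r γ` stays away from `r ζ₁`, so `m^* c (γ, ·)` is zero
    obtain ⟨U, W, hU, hW, h1, h2, hUW⟩ := t2_separation hcase
    refine ⟨𝒢.r ⁻¹' W, (hW.preimage hrc.continuous).mem_nhds h2, D ∩ (fun y => 𝒢.r (Γ y)) ⁻¹' U,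
      (hrc.continuous.comp_continuousOn hΓ.continuousOn).isOpen_inter_preimage hDo hU,
      ⟨hy₁, h1⟩, inter_subset_left, fun c hc hcN => ⟨fun _ _ => 0, fun t y hy =>
        ⟨Submodule.zero_mem _, fun η hη => ?_⟩, ?_⟩⟩
    · have h3 : c t (𝒢.mul (Γ y) η) = 0 := eq_zero_of_notMem_supp fun h => by
        have h4 := hcN t h
        rw [mem_preimage, 𝒢.r_mul _ _ hη] at h4
        exact disjoint_left.1 hUW hy.2 h4
      change _ = (c t (𝒢.mul (Γ y) η)).comp _
      rw [h3]; rfl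
    · simp only [v.eval_zero]
      exact fun n => ParamContDiffOn.zero
  -- coordinates near `η₁ = γ₁⁻¹ ζ₁`
  set γ₁ := Γ y₁
  set η₁ := 𝒢.mul (𝒢.inv γ₁) ζ₁
  have hη₁ : 𝒢.r η₁ = 𝒢.s γ₁ := by
    rw [𝒢.r_mul _ _ (by rw [𝒢.s_inv, hcase]), 𝒢.r_inv]
  obtain ⟨Z, _, _, χ, ψ, Λ, hηχ, hbox⟩ := exists_isSubmersionBox 𝒢.isSubmersion_r η₁
  let e₀ := trivializationAt F E p₀
  let e₁ := trivializationAt F E η₁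
  have hfin := finiteDimensional_fiber 𝕜 F
  let b := Module.finBasis 𝕜 F
  let W : EG × EG → EG := fun p => Λ.symm (ψ (𝒢.s (Γ p.1)), (Λ p.2).2)
  let D' : Set EG := D ∩ (fun y => 𝒢.s (Γ y)) ⁻¹' ψ.source
  have hD' : IsOpen D' :=
    (hsc.continuous.comp_continuousOn hΓ.continuousOn).isOpen_inter_preimage hDo ψ.open_source
  have hWs : ContMDiffOn 𝓘(ℝ, EG × EG) 𝓘(ℝ, EG) ∞ W (D' ×ˢ univ) := by
    have h1 : ContDiffOn ℝ ∞ (fun y => ψ (𝒢.s (Γ y))) D' := by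
      rw [← contMDiffOn_iff_contDiffOn]
      exact (contMDiffOn_of_mem_maximalAtlas hbox.cod_mem).comp
        (hsc.comp_contMDiffOn (hΓ.mono inter_subset_left)) fun y hy => hy.2
    rw [contMDiffOn_iff_contDiffOn]
    exact Λ.symm.contDiff.comp_contDiffOn ((h1.comp contDiffOn_fst fun p hp => hp.1).prodMk
      (contDiff_snd.comp (Λ.contDiff.comp contDiff_snd)).contDiffOn)
  let Ω : Set (EG × EG) := (D' ×ˢ univ) ∩ W ⁻¹' boxDomain χ e₁
  have hΩ : IsOpen Ω := hWs.continuousOn.isOpen_inter_preimage (hD'.prod isOpen_univ)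
    isOpen_boxDomain
  let ϖ : EG × EG → G := fun p => χ.symm (W p)
  have hϖ : ContMDiffOn 𝓘(ℝ, EG × EG) 𝓘(ℝ, EG) ∞ ϖ Ω :=
    (contMDiffOn_symm_of_mem_maximalAtlas hbox.dom_mem).comp (hWs.mono inter_subset_left)
      fun p hp => hp.2.1
  have hϖr : ∀ p ∈ Ω, 𝒢.s (Γ p.1) = 𝒢.r (ϖ p) := fun p hp => by
    refine ψ.injOn hp.1.1.2 (hbox.mapsTo _ (χ.map_target hp.2.1)) ?_
    rw [hbox.eq_fst _ (χ.map_target hp.2.1), χ.right_inv hp.2.1]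
    simp [W]
  have hϖη : ∀ y, ∀ η ∈ χ.source, 𝒢.s (Γ y) = 𝒢.r η → ϖ (y, χ η) = η := fun y η hη hyη => by
    have h1 : W (y, χ η) = χ η := by
      simp only [W]
      rw [hyη, hbox.eq_fst η hη]
      exact Λ.symm_apply_apply _
    simp only [ϖ]
    rw [h1, χ.left_inv hη]
  -- the components of the extension, before multiplication by cutoff functions
  let q : Fin (Module.finrank 𝕜 F) → EG × EG → TotalSpace F E := fun j p =>
    ⟨𝒢.mul (Γ p.1) (ϖ p), m.mulMap (Γ p.1) (ϖ p) (e₀.symm (Γ p.1) w) (e₁.symm (ϖ p) (b j))⟩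
  have hq : ∀ j, ContMDiffOn 𝓘(ℝ, EG × EG) (𝓘(ℝ, EG).prod 𝓘(ℝ, F)) ∞ (q j) Ω := fun j => by
    have h1 : ContMDiffOn 𝓘(ℝ, EG × EG) 𝓘(ℝ, EG) ∞ (fun p : EG × EG => Γ p.1) Ω :=
      hΓ.comp contDiff_fst.contMDiff.contMDiffOn fun p hp => hp.1.1.1
    have h2 := contMDiffOn_symm_comp (e := e₀) (F := F) (E := E) h1 (fun p hp => hp.1.1.1.2) w
    have h3 := contMDiffOn_symm_comp (e := e₁) (F := F) (E := E) hϖ (fun p hp => hp.2.2) (b j)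
    exact m.contMDiffOn_mulMap.comp (h2.prodMk h3) fun p hp => hϖr p hp
  set a₁ := χ η₁
  have ha₁ : a₁ ∈ boxDomain χ e₁ := ⟨χ.map_source hηχ, by
    rw [mem_preimage, χ.left_inv hηχ]; exact mem_baseSet_trivializationAt F E η₁⟩
  have hW₁ : W (y₁, a₁) = a₁ := by
    change Λ.symm (ψ (𝒢.s γ₁), (Λ a₁).2) = a₁
    rw [← hη₁, hbox.eq_fst η₁ hηχ]
    exact Λ.symm_apply_apply _
  have hmem : (y₁, a₁) ∈ Ω ∩ univ ×ˢ boxDomain χ e₁ := by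
    refine ⟨⟨⟨⟨hy₁, ?_⟩, mem_univ _⟩, ?_⟩, mem_univ _, ha₁⟩
    · change 𝒢.s γ₁ ∈ ψ.source
      rw [← hη₁]; exact hbox.mapsTo _ hηχ
    · rw [mem_preimage, hW₁]; exact ha₁
  obtain ⟨δ', hδ', hball⟩ := Metric.isOpen_iff.1 (hΩ.inter (isOpen_univ.prod isOpen_boxDomain)) _
    hmem
  set δ := δ' / 2
  have hδ : 0 < δ := by positivity
  have hCball : Metric.closedBall y₁ δ ×ˢ Metric.closedBall a₁ δ ⊆ Metric.ball (y₁, a₁) δ' := by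
    rw [closedBall_prod_same]
    exact Metric.closedBall_subset_ball (by simp only [δ]; linarith)
  have hCΩ : Metric.closedBall y₁ δ ×ˢ Metric.closedBall a₁ δ ⊆ Ω := fun p hp =>
    (hball (hCball hp)).1
  have hLc : IsCompact (Metric.closedBall a₁ δ) := isCompact_closedBall _ _
  have hL : Metric.closedBall a₁ δ ⊆ boxDomain χ e₁ := fun a ha =>
    (hball (hCball (show (y₁, a) ∈ _ from ⟨Metric.mem_closedBall_self hδ.le, ha⟩))).2.2
  let β₀ : ContDiffBump y₁ := ⟨δ / 2, δ, by positivity, by linarith⟩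
  let β₁ : ContDiffBump a₁ := ⟨δ / 2, δ, by positivity, by linarith⟩
  have hβ : ContDiff ℝ ∞ fun p : EG × EG => ((β₀ p.1 * β₁ p.2 : ℝ) : 𝕜) :=
    (RCLike.ofRealCLM (K := 𝕜)).contDiff.comp
      ((β₀.contDiff.comp contDiff_fst).mul (β₁.contDiff.comp contDiff_snd))
  have hβ₁ : ∀ a ∉ Metric.closedBall a₁ δ, β₁ a = 0 := fun a ha => by
    by_contra h
    have : a ∈ Function.support β₁ := h
    rw [β₁.support_eq] at this
    exact ha (Metric.ball_subset_closedBall this)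
  have hβ₀ : ∀ y ∉ Metric.closedBall y₁ δ, β₀ y = 0 := fun y hy => by
    by_contra h
    have : y ∈ Function.support β₀ := h
    rw [β₀.support_eq] at this
    exact hy (Metric.ball_subset_closedBall this)
  -- the neighbourhoods are chosen such that `γ η ∈ N` forces `η` to be close to `η₁`
  let R : Set G := (χ.source ∩ e₁.baseSet) ∩ χ ⁻¹' Metric.closedBall a₁ (δ / 2)
  have hR : R ∈ 𝓝 η₁ := by
    refine inter_mem ((χ.open_source.inter e₁.open_baseSet).mem_nhds
      ⟨hηχ, mem_baseSet_trivializationAt F E η₁⟩) ?_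
    exact (χ.continuousAt hηχ).preimage_mem_nhds (Metric.closedBall_mem_nhds _ (by positivity))
  have hmul : ∀ᶠ p in 𝓝 (y₁, ζ₁), p.1 ∈ D → 𝒢.r (Γ p.1) = 𝒢.r p.2 →
      𝒢.mul (𝒢.inv (Γ p.1)) p.2 ∈ R := by
    have h1 : ContinuousWithinAt (fun p : EG × G => 𝒢.mul (𝒢.inv (Γ p.1)) p.2)
        {p | p.1 ∈ D ∧ 𝒢.r (Γ p.1) = 𝒢.r p.2} (y₁, ζ₁) := by
      have h2 : ContinuousOn (fun p : EG × G => (𝒢.inv (Γ p.1), p.2))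
          {p | p.1 ∈ D ∧ 𝒢.r (Γ p.1) = 𝒢.r p.2} :=
        (𝒢.contMDiff_inv.continuous.comp_continuousOn
          (hΓ.continuousOn.comp continuousOn_fst fun p hp => hp.1)).prodMk continuousOn_snd
      exact (𝒢.contMDiffOn_mul.continuousOn.comp h2 fun p hp => by
        simpa [𝒢.s_inv] using hp.2) (y₁, ζ₁) ⟨hy₁, hcase⟩
    have h3 := h1.preimage_mem_nhdsWithin hR
    filter_upwards [mem_nhdsWithin_iff_eventually.1 h3] with p hp h4 h5 using hp ⟨h4, h5⟩
  obtain ⟨Y₀, hY₀, N, hN, hYN⟩ := mem_nhds_prod_iff.1 hmul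
  let x₀ := 𝒢.s γ₁
  let Y : Set EG := (D ∩ (fun y => 𝒢.s (Γ y)) ⁻¹' (chartAt EB x₀).source) ∩
    (interior Y₀ ∩ Metric.ball y₁ (δ / 2))
  have hYo' : IsOpen (D ∩ (fun y => 𝒢.s (Γ y)) ⁻¹' (chartAt EB x₀).source) :=
    (hsc.continuous.comp_continuousOn hΓ.continuousOn).isOpen_inter_preimage hDo
      (chartAt EB x₀).open_source
  have hYo : IsOpen Y := hYo'.inter (isOpen_interior.inter Metric.isOpen_ball)
  refine ⟨N, hN, Y, hYo, ⟨⟨hy₁, mem_chart_source EB x₀⟩, mem_interior_iff_mem_nhds.2 hY₀,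
    Metric.mem_ball_self (by positivity)⟩, fun y hy => hy.1.1, fun c hc hcN => ?_⟩
  let f : Fin (Module.finrank 𝕜 F) → T → EG × EG → 𝕜 := fun j t p =>
    ((β₀ p.1 * β₁ p.2 : ℝ) : 𝕜) * c t (q j p).proj (q j p).2
  have hf : ∀ j, ParamSmoothOn (f j) univ := fun j => by
    have h1 : ParamSmoothOn (f j) (univ ×ˢ Ω) := fun n =>
      ParamContDiffOn.bilinear (ContinuousLinearMap.mul ℝ 𝕜)
        (ParamContDiffOn.of_contDiffOn hβ.contDiffOn isOpen_univ (by simp))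
        (hc.eval hΩ (hq j) n) (isOpen_univ.prod hΩ)
    refine h1.extend_zero hΩ (Metric.isClosed_closedBall.prod Metric.isClosed_closedBall) hCΩ
      (fun _ _ _ => rfl) fun t p hp => ?_
    by_cases h : p.2 ∈ Metric.closedBall a₁ δ
    · have : p.1 ∉ Metric.closedBall y₁ δ := fun h' => hp ⟨h', h⟩
      simp [f, hβ₀ _ this]
    · simp [f, hβ₁ _ h]
  have hfL : ∀ j t y a, a ∉ Metric.closedBall a₁ δ → f j t (y, a) = 0 := fun j t y a ha => by
    simp [f, hβ₁ _ ha]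
  have hftest : ∀ j t y, localSection χ e₁ (b.coord j) (fun a => f j t (y, a)) ∈
      TestSections 𝕜 EG F E := fun j t y =>
    localSection_mem_testSections hbox.dom_mem hLc hL ((hf j).contDiff_slice t y) (hfL j t y)
  refine ⟨fun t y => ∑ j, localSection χ e₁ (b.coord j) (fun a => f j t (y, a)), fun t y hy =>
    ⟨Submodule.sum_mem _ fun j _ => hftest j t y, fun η hη => ?_⟩, ?_⟩
  · change (∑ j, localSection χ e₁ (b.coord j) (fun a => f j t (y, a))) η =
      (c t (𝒢.mul (Γ y) η)).comp (m.mulMap (Γ y) η (e₀.symm (Γ y) w))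
    have hηs : 𝒢.s (Γ y) = 𝒢.r η := hη
    have hval : ∀ j, η ∈ χ.source → f j t (y, χ η) = ((β₀ y * β₁ (χ η) : ℝ) : 𝕜) *
        c t (𝒢.mul (Γ y) η) (m.mulMap (Γ y) η (e₀.symm (Γ y) w) (e₁.symm η (b j))) :=
      fun j hηχ => congrArg (fun η' => ((β₀ y * β₁ (χ η) : ℝ) : 𝕜) *
        c t (𝒢.mul (Γ y) η') (m.mulMap (Γ y) η' (e₀.symm (Γ y) w) (e₁.symm η' (b j))))
        (hϖη y η hηχ hηs)
    -- where `m^* c (γ, ·)` vanishes so do the components; elsewhere the cutoff functions are `1`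
    by_cases hzero : c t (𝒢.mul (Γ y) η) = 0
    · rw [hzero, LinearMap.zero_comp, Finset.sum_apply]
      refine Finset.sum_eq_zero fun j _ => ?_
      rw [localSection]
      split_ifs with h
      · rw [hval j h, hzero]; simp
      · rfl
    · have hηR : η ∈ R := by
        have h1 : 𝒢.mul (Γ y) η ∈ N := hcN t (subset_closure hzero)
        have h2 := hYN (show (y, 𝒢.mul (Γ y) η) ∈ Y₀ ×ˢ N from ⟨interior_subset hy.2.1, h1⟩)
          hy.1.1 (𝒢.r_mul _ _ hηs).symm
        rwa [𝒢.inv_mul_mul hηs] at h2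
      ext z
      rw [Finset.sum_apply, LinearMap.sum_apply, apply_eq_sum_coord b e₁ hηR.1.2]
      refine Finset.sum_congr rfl fun j _ => ?_
      rw [localSection_apply hηR.1.1 hηR.1.2, hval j hηR.1.1,
        β₀.one_of_mem_closedBall (Metric.ball_subset_closedBall hy.2.2),
        β₁.one_of_mem_closedBall hηR.2]
      simp [mul_comm]
  · -- composition with `y ↦ (y, s (γ y))`
    intro n
    have hφ : ContDiffOn ℝ ∞ (fun y => (y, chartAt EB x₀ (𝒢.s (Γ y)))) Y := by
      refine contDiffOn_id.prodMk ?_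
      rw [← contMDiffOn_iff_contDiffOn]
      exact (contMDiffOn_chart (I := 𝓘(ℝ, EB)) (x := x₀)).comp
        (hsc.comp_contMDiffOn (hΓ.mono fun y hy => hy.1.1)) fun y hy => hy.1.2
    refine (ParamContDiffOn.sum (s := Finset.univ) (fun j _ =>
      (v.paramSmoothOn_eval_localSection_prod (l := b.coord j) hbox.dom_mem hLc hL (hf j) (hfL j)
        x₀ n).comp hφ hYo (isOpen_univ.prod hYo) fun p hp => ⟨hp.2, mem_univ _, mem_univ _,
          (chartAt EB x₀).map_source hp.2.1.2⟩) (isOpen_univ.prod hYo)).congr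
            (isOpen_univ.prod hYo) fun t y hy => ?_
    rw [v.eval_sum _ fun j _ => hftest j t y]
    simp only [Γ] at *
    rw [(chartAt EB x₀).left_inv hy.2.1.2]

end InnerPairing

/-! ### Supports of distributions -/

section Support

variable {𝕜 : Type*} [RCLike 𝕜]
  {EB : Type*} [NormedAddCommGroup EB] [NormedSpace ℝ EB] [FiniteDimensional ℝ EB]
  {B : Type*} [TopologicalSpace B] [ChartedSpace EB B] [IsManifold 𝓘(ℝ, EB) ∞ B]
  {EM : Type*} [NormedAddCommGroup EM] [NormedSpace ℝ EM] [FiniteDimensional ℝ EM]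
  {M : Type*} [TopologicalSpace M] [T2Space M] [SecondCountableTopology M]
  [ChartedSpace EM M] [IsManifold 𝓘(ℝ, EM) ∞ M]
  {F : Type*} [NormedAddCommGroup F] [NormedSpace ℝ F] [NormedSpace 𝕜 F] [IsScalarTower ℝ 𝕜 F]
  [FiniteDimensional ℝ F]
  {E : M → Type*} [TopologicalSpace (TotalSpace F E)] [∀ p, TopologicalSpace (E p)]
  [FiberBundle F E] [∀ p, AddCommGroup (E p)] [∀ p, Module ℝ (E p)] [∀ p, Module 𝕜 (E p)]
  [VectorBundle 𝕜 F E] [VectorBundle ℝ F E] [ContMDiffVectorBundle ∞ F E 𝓘(ℝ, EM)]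
  {r : M → B}

theorem FiberedDistribution.exists_of_notMem_support {u : FiberedDistribution 𝕜 EB EM F E r}
    {p : M} (hp : p ∉ u.support) : ∃ V : Set M, IsOpen V ∧ p ∈ V ∧
      ∀ f : TestSections 𝕜 EM F E, supp f.1 ⊆ V → u.toFun f = 0 := by
  by_contra! h
  exact hp fun V hV hpV => h V hV hpV

theorem FiberedDistribution.isClosed_support (u : FiberedDistribution 𝕜 EB EM F E r) :
    IsClosed u.support := by
  rw [← isOpen_compl_iff, isOpen_iff_forall_mem_open]
  intro p hp
  obtain ⟨V, hV, hpV, h⟩ := exists_of_notMem_support hp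
  refine ⟨V, fun q hq hqu => ?_, hV, hpV⟩
  obtain ⟨f, hf, hf0⟩ := hqu V hV hq
  exact hf0 (h f hf)

theorem FiberedDistribution.eval_eq_zero_of_disjoint_support
    (u : FiberedDistribution 𝕜 EB EM F E r) {f : ∀ p : M, Module.Dual 𝕜 (E p)}
    (hf : f ∈ TestSections 𝕜 EM F E) (h : Disjoint (supp f) u.support) (x : B) :
    u.eval f x = 0 := by
  obtain ⟨K, hK, hfK⟩ := hf.2
  have hc : IsCompact (supp f) := hK.of_isClosed_subset isClosed_closure hfK
  have key : ∀ p, ∃ N : Set M, p ∈ supp f → N ∈ 𝓝 p ∧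
      ∀ g ∈ TestSections 𝕜 EM F E, supp g ⊆ N → u.eval g x = 0 := fun p => by
    by_cases hp : p ∈ supp f
    · obtain ⟨V, hV, hpV, h⟩ := exists_of_notMem_support (disjoint_left.1 h hp)
      refine ⟨V, fun _ => ⟨hV.mem_nhds hpV, fun g hg hgV => ?_⟩⟩
      rw [u.eval_of_mem hg, h ⟨g, hg⟩ hgV]
      rfl
    · exact ⟨univ, fun h => absurd h hp⟩
  choose N hN using key
  obtain ⟨s, ρ, hs, hρ, hρN, hsum⟩ := exists_finite_partition 𝕜 EM hc fun p hp => (hN p hp).1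
  rw [← sum_mul_eq hsum subset_rfl, u.eval_sum _ fun i _ => mul_mem_testSections hf (hρ i)]
  exact Finset.sum_eq_zero fun i hi => (hN i (hs i hi)).2 _ (mul_mem_testSections hf (hρ i))
    (((supp_mul_subset (ρ i) f).trans inter_subset_left).trans (hρN i hi))

end Support

/-! ### The section of inner pairings -/

section InnerPairing

universe w

variable {𝕜 : Type*} [RCLike 𝕜]
  {EG : Type w} [NormedAddCommGroup EG] [NormedSpace ℝ EG] [FiniteDimensional ℝ EG]
  {EB : Type*} [NormedAddCommGroup EB] [NormedSpace ℝ EB] [FiniteDimensional ℝ EB]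
  {G : Type*} [TopologicalSpace G] [T2Space G] [SecondCountableTopology G]
  [ChartedSpace EG G] [IsManifold 𝓘(ℝ, EG) ∞ G]
  {B : Type*} [TopologicalSpace B] [T2Space B] [SecondCountableTopology B]
  [ChartedSpace EB B] [IsManifold 𝓘(ℝ, EB) ∞ B]
  {F : Type*} [NormedAddCommGroup F] [NormedSpace ℝ F] [NormedSpace 𝕜 F] [IsScalarTower ℝ 𝕜 F]
  [FiniteDimensional ℝ F]
  {E : G → Type*} [TopologicalSpace (TotalSpace F E)] [∀ γ, TopologicalSpace (E γ)]
  [FiberBundle F E] [∀ γ, AddCommGroup (E γ)] [∀ γ, Module ℝ (E γ)] [∀ γ, Module 𝕜 (E γ)]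
  [VectorBundle 𝕜 F E] [VectorBundle ℝ F E] [ContMDiffVectorBundle ∞ F E 𝓘(ℝ, EG)]
  {𝒢 : LieGroupoid EG EB G B} {T : Type*} [TopologicalSpace T]

/-- The local extensions, glued with a partition of unity over a compact set that contains the
supports of the family. -/
theorem exists_extension (m : MultiplicativeStructure 𝕜 F E 𝒢)
    (v : FiberedDistribution 𝕜 EB EG F E 𝒢.r) {K : Set G} (hK : IsCompact K) (p₀ : G) {y₁ : EG}
    (hy₁ : y₁ ∈ coordDomain EG F E p₀) (w : F) :
    ∃ Y : Set EG, IsOpen Y ∧ y₁ ∈ Y ∧ Y ⊆ coordDomain EG F E p₀ ∧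
      ∀ c : T → ∀ γ : G, Module.Dual 𝕜 (E γ), SmoothFamily 𝕜 EG F E c → (∀ t, supp (c t) ⊆ K) →
        ∃ f : T → EG → ∀ γ : G, Module.Dual 𝕜 (E γ),
          (∀ t, ∀ y ∈ Y, IsPullbackExtension m (c t) ((chartAt EG p₀).symm y)
            ((trivializationAt F E p₀).symm ((chartAt EG p₀).symm y) w) (f t y)) ∧
          ParamSmoothOn (fun t y => v.eval (f t y) (𝒢.s ((chartAt EG p₀).symm y)))
            (univ ×ˢ Y) := by
  choose N hN Y hYo hY₁ hYD hext using
    fun ζ₁ => exists_local_extension (T := T) m v p₀ hy₁ w ζ₁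
  obtain ⟨s, ρ, -, hρ, hρN, hsum⟩ := exists_finite_partition 𝕜 EG hK fun p _ => hN p
  let Y' := coordDomain EG F E p₀ ∩ ⋂ i ∈ s, Y i
  have hY'o : IsOpen Y' := (isOpen_coordDomain p₀).inter (isOpen_biInter_finset fun i _ => hYo i)
  have hY' : ∀ y ∈ Y', ∀ i ∈ s, y ∈ Y i := fun y hy i hi => by
    simpa using mem_iInter₂.1 hy.2 i hi
  refine ⟨Y', hY'o, ⟨hy₁, mem_iInter₂.2 fun i _ => hY₁ i⟩,
    inter_subset_left, fun c hc hcK => ?_⟩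
  have h1 : ∀ i : s, ∃ f : T → EG → ∀ γ : G, Module.Dual 𝕜 (E γ),
      (∀ t, ∀ y ∈ Y i, IsPullbackExtension m (fun p => ρ i p • c t p) ((chartAt EG p₀).symm y)
        ((trivializationAt F E p₀).symm ((chartAt EG p₀).symm y) w) (f t y)) ∧
      ParamSmoothOn (fun t y => v.eval (f t y) (𝒢.s ((chartAt EG p₀).symm y)))
        (univ ×ˢ Y i) := fun i =>
    hext i _ (hc.mul (hρ i)) fun t => ((supp_mul_subset _ _).trans inter_subset_left).trans
      (hρN i i.2)
  choose f hf hfs using h1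
  refine ⟨fun t y => ∑ i, f i t y, fun t y hy =>
    ⟨Submodule.sum_mem _ fun i _ => (hf i t y (hY' y hy i i.2)).mem, fun η hη => ?_⟩, fun n => ?_⟩
  · have h2 := congrFun (sum_mul_eq hsum (hcK t)) (𝒢.mul ((chartAt EG p₀).symm y) η)
    change (∑ i, f i t y) η = _
    rw [← h2]
    ext z
    rw [← Finset.sum_coe_sort s, Finset.sum_apply, Finset.sum_apply, LinearMap.sum_apply,
      LinearMap.comp_apply, LinearMap.sum_apply]
    refine Finset.sum_congr rfl fun i _ => ?_
    rw [(hf i t y (hY' y hy i i.2)).eq η hη]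
    rfl
  · have hV : IsOpen (univ ×ˢ Y' : Set (T × EG)) := isOpen_univ.prod hY'o
    refine (ParamContDiffOn.sum (s := Finset.univ) (fun i _ =>
      (hfs i n).mono (prod_mono subset_rfl fun y hy => hY' y hy i i.2)) hV).congr hV
        fun t y hy => ?_
    exact v.eval_sum _ (fun i _ => (hf i t y (hY' y hy.2 i i.2)).mem) _

theorem exists_isPullbackExtension (m : MultiplicativeStructure 𝕜 F E 𝒢)
    (v : FiberedDistribution 𝕜 EB EG F E 𝒢.r) {φ : ∀ γ : G, Module.Dual 𝕜 (E γ)}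
    (hφ : φ ∈ TestSections 𝕜 EG F E) (γ : G) (e : E γ) : ∃ f, IsPullbackExtension m φ γ e f := by
  obtain ⟨hs, K, hK, hφK⟩ := hφ
  have hγ := mem_chart_source EG γ
  have hγe := mem_baseSet_trivializationAt F E γ
  obtain ⟨Y, -, hyY, -, hext⟩ := exists_extension (T := Unit) m v hK γ (y₁ := chartAt EG γ γ)
    ⟨(chartAt EG γ).map_source hγ, by rw [mem_preimage, (chartAt EG γ).left_inv hγ]; exact hγe⟩
    (trivializationAt F E γ ⟨γ, e⟩).2
  obtain ⟨f, hf, -⟩ := hext _ (smoothFamily_const hs) fun _ => hφK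
  have h1 := hf () _ hyY
  rw [(chartAt EG γ).left_inv hγ, Trivialization.symm_apply_apply_mk _ hγe] at h1
  exact ⟨_, h1⟩

section

variable {m : MultiplicativeStructure 𝕜 F E 𝒢} {φ φ' f f' : ∀ γ : G, Module.Dual 𝕜 (E γ)} {γ : G}
  {e e' : E γ}

theorem IsPullbackExtension.eval_eq (v : FiberedDistribution 𝕜 EB EG F E 𝒢.r)
    (hf : IsPullbackExtension m φ γ e f) (hf' : IsPullbackExtension m φ γ e f') :
    v.eval f (𝒢.s γ) = v.eval f' (𝒢.s γ) :=
  v.eval_congr_of_restrict 𝒢.isSubmersion_r hf.mem hf'.mem fun η hη => by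
    rw [hf.eq η hη.symm, hf'.eq η hη.symm]

theorem IsPullbackExtension.add_vector (hf : IsPullbackExtension m φ γ e f)
    (hf' : IsPullbackExtension m φ γ e' f') : IsPullbackExtension m φ γ (e + e') (f + f') where
  mem := Submodule.add_mem _ hf.mem hf'.mem
  eq η hη := by rw [Pi.add_apply, hf.eq η hη, hf'.eq η hη, map_add, LinearMap.comp_add]

theorem IsPullbackExtension.smul_vector (a : 𝕜) (hf : IsPullbackExtension m φ γ e f) :
    IsPullbackExtension m φ γ (a • e) (a • f) where
  mem := Submodule.smul_mem _ a hf.mem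
  eq η hη := by rw [Pi.smul_apply, hf.eq η hη, map_smul, LinearMap.comp_smul]

theorem IsPullbackExtension.add (hf : IsPullbackExtension m φ γ e f)
    (hf' : IsPullbackExtension m φ' γ e f') : IsPullbackExtension m (φ + φ') γ e (f + f') where
  mem := Submodule.add_mem _ hf.mem hf'.mem
  eq η hη := by rw [Pi.add_apply, hf.eq η hη, hf'.eq η hη, Pi.add_apply, LinearMap.add_comp]

/-- Since `r (γ η) = r γ`, the multiplication of `φ` with `h ∘ r` multiplies `m^* φ (γ, ·)` with
the constant `h (r γ)`. -/
theorem IsPullbackExtension.mul {h : B → 𝕜} (hφ : ∀ p, φ' p = h (𝒢.r p) • φ p)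
    (hf : IsPullbackExtension m φ γ e f) :
    IsPullbackExtension m φ' γ e (h (𝒢.r γ) • f) where
  mem := Submodule.smul_mem _ _ hf.mem
  eq η hη := by rw [Pi.smul_apply, hf.eq η hη, hφ, 𝒢.r_mul _ _ hη, LinearMap.smul_comp]

end

open scoped Classical in
/-- The value at `γ` of the section `γ ↦ ⟨v^{s γ}(η), m^* φ (γ, η)⟩` of `E*`. The restriction of
`m^* φ (γ, ·)` to the fibre over `s γ` is extended to a test section on which `v` is evaluated; the
value `0` for sections `φ` that are not test sections is irrelevant. -/
noncomputable def innerPairing (m : MultiplicativeStructure 𝕜 F E 𝒢)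
    (v : FiberedDistribution 𝕜 EB EG F E 𝒢.r) (φ : ∀ γ : G, Module.Dual 𝕜 (E γ)) (γ : G) :
    Module.Dual 𝕜 (E γ) :=
  if hφ : φ ∈ TestSections 𝕜 EG F E then
    { toFun := fun e => v.eval (exists_isPullbackExtension m v hφ γ e).choose (𝒢.s γ)
      map_add' := fun e e' => by
        have h1 := (exists_isPullbackExtension m v hφ γ e).choose_spec
        have h2 := (exists_isPullbackExtension m v hφ γ e').choose_spec
        have h3 := (exists_isPullbackExtension m v hφ γ (e + e')).choose_spec
        rw [h3.eval_eq v (h1.add_vector h2), v.eval_add h1.mem h2.mem]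
      map_smul' := fun a e => by
        have h1 := (exists_isPullbackExtension m v hφ γ e).choose_spec
        have h3 := (exists_isPullbackExtension m v hφ γ (a • e)).choose_spec
        rw [h3.eval_eq v (h1.smul_vector a), v.eval_smul h1.mem]
        rfl }
  else 0

section

variable {m : MultiplicativeStructure 𝕜 F E 𝒢} {v : FiberedDistribution 𝕜 EB EG F E 𝒢.r}
  {φ φ' : ∀ γ : G, Module.Dual 𝕜 (E γ)}

theorem innerPairing_apply (hφ : φ ∈ TestSections 𝕜 EG F E) {γ : G} {e : E γ}
    {f : ∀ γ : G, Module.Dual 𝕜 (E γ)} (hf : IsPullbackExtension m φ γ e f) :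
    innerPairing m v φ γ e = v.eval f (𝒢.s γ) := by
  have h1 := (exists_isPullbackExtension m v hφ γ e).choose_spec
  rw [← h1.eval_eq v hf]
  simp [innerPairing, hφ]

theorem pairs_innerPairing (hφ : φ ∈ TestSections 𝕜 EG F E) (γ : G) (e : E γ) :
    v.Pairs (𝒢.s γ) (mulPullback m φ γ e) (innerPairing m v φ γ e) := by
  obtain ⟨f, hf⟩ := exists_isPullbackExtension m v hφ γ e
  refine Or.inl ⟨⟨⟨f, hf.mem⟩, funext fun η => hf.eq η.1 η.2.symm⟩, fun g hg => ?_⟩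
  rw [← v.eval_coe]
  refine (innerPairing_apply hφ ⟨g.2, fun η hη => ?_⟩).symm
  exact congrFun hg ⟨η, hη.symm⟩

theorem innerPairing_add (hφ : φ ∈ TestSections 𝕜 EG F E) (hφ' : φ' ∈ TestSections 𝕜 EG F E) :
    innerPairing m v (φ + φ') = innerPairing m v φ + innerPairing m v φ' := by
  ext γ e
  obtain ⟨f, hf⟩ := exists_isPullbackExtension m v hφ γ e
  obtain ⟨f', hf'⟩ := exists_isPullbackExtension m v hφ' γ e
  rw [innerPairing_apply (Submodule.add_mem _ hφ hφ') (hf.add hf'), v.eval_add hf.mem hf'.mem,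
    Pi.add_apply, LinearMap.add_apply, innerPairing_apply hφ hf, innerPairing_apply hφ' hf']

theorem innerPairing_mul (hφ : φ ∈ TestSections 𝕜 EG F E) (hφ' : φ' ∈ TestSections 𝕜 EG F E)
    {h : B → 𝕜} (hh : ∀ p, φ' p = h (𝒢.r p) • φ p) (γ : G) :
    innerPairing m v φ' γ = h (𝒢.r γ) • innerPairing m v φ γ := by
  ext e
  obtain ⟨f, hf⟩ := exists_isPullbackExtension m v hφ γ e
  rw [innerPairing_apply hφ' (hf.mul hh), v.eval_smul hf.mem, LinearMap.smul_apply,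
    innerPairing_apply hφ hf]
  rfl

/-- The inner pairings form a smooth section, which depends smoothly on `φ`. -/
theorem smoothFamily_innerPairing {c : T → ∀ γ : G, Module.Dual 𝕜 (E γ)}
    (hc : SmoothFamily 𝕜 EG F E c) {K : Set G} (hK : IsCompact K) (hcK : ∀ t, supp (c t) ⊆ K) :
    SmoothFamily 𝕜 EG F E (fun t => innerPairing m v (c t)) := by
  refine fun p₀ w n => ParamContDiffOn.of_forall_mem ?_
  rintro ⟨t, y₁⟩ ⟨-, hy₁⟩
  obtain ⟨Y, hY, hyY, -, hext⟩ := exists_extension (T := T) m v hK p₀ hy₁ w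
  obtain ⟨f, hf, hfs⟩ := hext c hc hcK
  exact ⟨univ ×ˢ Y, isOpen_univ.prod hY, ⟨mem_univ _, hyY⟩,
    (hfs n).congr (isOpen_univ.prod hY) fun t y hy =>
      innerPairing_apply (hc.mem_testSections hK hcK t) (hf t y hy.2)⟩

theorem innerPairing_mem_smoothSections (hφ : φ ∈ TestSections 𝕜 EG F E) :
    innerPairing m v φ ∈ SmoothSections 𝕜 EG F E := by
  obtain ⟨hs, K, hK, hφK⟩ := hφ
  exact (smoothFamily_innerPairing (smoothFamily_const (T := Unit) hs) hK
    fun _ => hφK).mem_smoothSections ()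

/-- If `s` is proper on the support of `v`, the section of inner pairings is supported in the
compact set of the products `ζ η⁻¹` with `ζ ∈ K` and `η ∈ supp v ∩ s⁻¹(s(K))`. -/
theorem exists_supp_innerPairing_subset (hv : IsProperlySupported v) {K : Set G}
    (hK : IsCompact K) : ∃ Q : Set G, IsCompact Q ∧ ∀ φ ∈ TestSections 𝕜 EG F E, supp φ ⊆ K →
      supp (innerPairing m v φ) ⊆ Q := by
  have hsc : Continuous 𝒢.s := 𝒢.isSubmersion_s.contMDiff.continuous
  have hrc : Continuous 𝒢.r := 𝒢.isSubmersion_r.contMDiff.continuous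
  let S : Set G := v.support ∩ 𝒢.s ⁻¹' (𝒢.s '' K)
  have hS : IsCompact S := by
    have h1 := (hv.2.isCompact_preimage (hK.image hsc)).image continuous_subtype_val
    convert h1 using 1
    ext η
    simp [S, and_comm]
  let KS : Set (G × G) := (K ×ˢ S) ∩ {p | 𝒢.s p.1 = 𝒢.s p.2}
  have hKS : IsCompact KS := (hK.prod hS).inter_right
    (isClosed_eq (hsc.comp continuous_fst) (hsc.comp continuous_snd))
  let Q : Set G := (fun p : G × G => 𝒢.mul p.1 (𝒢.inv p.2)) '' KS
  have hQ : IsCompact Q := hKS.image_of_continuousOn <|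
    𝒢.contMDiffOn_mul.continuousOn.comp (f := fun p : G × G => (p.1, 𝒢.inv p.2))
      (continuous_fst.prodMk (𝒢.contMDiff_inv.continuous.comp continuous_snd)).continuousOn
      fun p hp => by simpa [𝒢.r_inv] using hp.2
  refine ⟨Q, hQ, fun φ hφ hφK => closure_minimal (fun γ hγ => ?_) hQ.isClosed⟩
  by_contra hγQ
  refine hγ (LinearMap.ext fun e => ?_)
  obtain ⟨f, hf⟩ := exists_isPullbackExtension m v hφ γ e
  -- the closed subset of the fibre over `s γ` that carries `m^* φ (γ, ·)`
  let C : Set G := (fun ζ => 𝒢.mul (𝒢.inv γ) ζ) '' (K ∩ {ζ | 𝒢.r ζ = 𝒢.r γ})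
  have hC : IsCompact C := by
    refine (hK.inter_right (isClosed_eq hrc continuous_const)).image_of_continuousOn ?_
    exact 𝒢.contMDiffOn_mul.continuousOn.comp (f := fun ζ : G => (𝒢.inv γ, ζ))
      (by fun_prop) fun ζ hζ => by simpa [𝒢.s_inv] using hζ.2.symm
  have hCv : C ⊆ v.supportᶜ := by
    rintro _ ⟨ζ, ⟨hζK, hζr⟩, rfl⟩ hηv
    have hζr' : 𝒢.r ζ = 𝒢.r γ := hζr
    have h1 : 𝒢.s (𝒢.inv γ) = 𝒢.r ζ := by rw [𝒢.s_inv, hζr']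
    have h2 : 𝒢.s γ = 𝒢.r (𝒢.mul (𝒢.inv γ) ζ) := by rw [𝒢.r_mul _ _ h1, 𝒢.r_inv]
    have h3 : 𝒢.mul γ (𝒢.mul (𝒢.inv γ) ζ) = ζ := by
      rw [← 𝒢.mul_assoc _ _ _ (𝒢.r_inv γ).symm h1, 𝒢.mul_inv, ← hζr', 𝒢.one_mul]
    have h4 : 𝒢.s (𝒢.mul (𝒢.inv γ) ζ) = 𝒢.s ζ := 𝒢.s_mul _ _ h1
    refine hγQ ⟨(ζ, 𝒢.mul (𝒢.inv γ) ζ), ⟨⟨hζK, hηv, ζ, hζK, h4.symm⟩, h4.symm⟩, ?_⟩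
    change 𝒢.mul ζ (𝒢.inv (𝒢.mul (𝒢.inv γ) ζ)) = γ
    have h5 := 𝒢.mul_assoc _ _ _ h2 (𝒢.r_inv _).symm
    rwa [h3, 𝒢.mul_inv, ← h2, 𝒢.mul_one] at h5
  obtain ⟨K', ρ, hK', hK'v, hρ, h1, h0⟩ :=
    exists_cutoff 𝕜 EG hC v.isClosed_support.isOpen_compl hCv
  -- the extension cut off by `ρ` is still an extension, and avoids the support of `v`
  have hρf : IsPullbackExtension m φ γ e (fun η => ρ η • f η) := by
    refine ⟨mul_mem_testSections hf.mem hρ, fun η hη => ?_⟩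
    rw [← hf.eq η hη]
    by_cases hz : φ (𝒢.mul γ η) = 0
    · rw [hf.eq η hη, hz, LinearMap.zero_comp, smul_zero]
    · have : η ∈ C := ⟨𝒢.mul γ η, ⟨hφK (subset_closure hz), 𝒢.r_mul _ _ hη⟩, 𝒢.inv_mul_mul hη⟩
      rw [h1.self_of_nhdsSet η this, one_smul]
  rw [innerPairing_apply hφ hρf, LinearMap.zero_apply]
  refine v.eval_eq_zero_of_disjoint_support hρf.mem ?_ _
  refine disjoint_left.2 fun η hη hηv => hK'v ?_ hηv
  refine closure_minimal (fun q hq => ?_) hK'.isClosed hη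
  by_contra h
  exact hq (by simp [h0 q h])

/-- If `L φ` is given by the outer pairings of `u` with the section of inner pairings, `L` is the
unique convolution of `u` and `v`. -/
theorem existsUnique_isConvolution (u : FiberedDistribution 𝕜 EB EG F E 𝒢.r)
    (L : TestSections 𝕜 EG F E → C^∞⟮𝓘(ℝ, EB), B; 𝓘(ℝ, 𝕜), 𝕜⟯) (hL : IsModuleMap 𝒢.r L)
    (hsm : ∀ K : Set G, IsCompact K → ∀ x₀ : B, ParamSmoothOn
      (fun (f : SectionsSupportedIn 𝕜 EG F E K) y => L f.1 ((chartAt EB x₀).symm y))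
      (univ ×ˢ (chartAt EB x₀).target))
    (hpairs : ∀ φ x, u.Pairs x (restrictFiber 𝒢.r x (innerPairing m v φ.1)) (L φ x)) :
    ∃! w : FiberedDistribution 𝕜 EB EG F E 𝒢.r, IsConvolution m u v w := by
  refine ⟨⟨L, hL, continuous_testTopology_functionTopology hL.map_add (fun a f x => ?_) hsm⟩,
    fun φ => ⟨⟨innerPairing m v φ.1, innerPairing_mem_smoothSections φ.2⟩,
      pairs_innerPairing φ.2, hpairs φ⟩, fun w hw => ?_⟩
  · rw [hL.map_smul ⟨fun _ => (a : 𝕜), contMDiff_const⟩ f (a • f) (fun p => ?_) x,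
      RCLike.real_smul_eq_coe_mul]
    · rfl
    · ext z
      change a • f.1 p z = (a : 𝕜) * f.1 p z
      rw [RCLike.real_smul_eq_coe_mul]
  · refine FiberedDistribution.ext (funext fun φ => ContMDiffMap.ext fun x => ?_)
    obtain ⟨ψ, hψ, hx⟩ := hw φ
    have h1 : ψ.1 = innerPairing m v φ.1 := funext fun γ => LinearMap.ext fun e =>
      (hψ γ e).unique (pairs_innerPairing φ.2 γ e)
    have h2 := hx x
    rw [h1] at h2
    exact h2.unique (hpairs φ x)

end

end InnerPairing
end FiberedConvolution

/-! ### Existence and uniqueness of the convolution -/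

open FiberedConvolution in
theorem mainTheorem6 {𝕜 : Type*} [RCLike 𝕜]
    {EG : Type*} [NormedAddCommGroup EG] [NormedSpace ℝ EG] [FiniteDimensional ℝ EG]
    {EB : Type*} [NormedAddCommGroup EB] [NormedSpace ℝ EB] [FiniteDimensional ℝ EB]
    {G : Type*} [TopologicalSpace G] [T2Space G] [SecondCountableTopology G]
    [ChartedSpace EG G] [IsManifold 𝓘(ℝ, EG) ∞ G]
    {B : Type*} [TopologicalSpace B] [T2Space B] [SecondCountableTopology B]
    [ChartedSpace EB B] [IsManifold 𝓘(ℝ, EB) ∞ B]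
    {F : Type*} [NormedAddCommGroup F] [NormedSpace ℝ F] [NormedSpace 𝕜 F] [IsScalarTower ℝ 𝕜 F]
    [FiniteDimensional ℝ F]
    {E : G → Type*} [TopologicalSpace (TotalSpace F E)] [∀ γ, TopologicalSpace (E γ)]
    [FiberBundle F E] [∀ γ, AddCommGroup (E γ)] [∀ γ, Module ℝ (E γ)] [∀ γ, Module 𝕜 (E γ)]
    [∀ γ, IsScalarTower ℝ 𝕜 (E γ)] [VectorBundle 𝕜 F E] [VectorBundle ℝ F E]
    [ContMDiffVectorBundle ∞ F E 𝓘(ℝ, EG)]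
    (𝒢 : FiberedConvolution.LieGroupoid EG EB G B)
    (m : FiberedConvolution.MultiplicativeStructure 𝕜 F E 𝒢)
    (u v : FiberedConvolution.FiberedDistribution 𝕜 EB EG F E 𝒢.r)
    (huv : (u.MemCompact ∧ FiberedConvolution.IsProperlySupported u) ∨
      (v.MemCompact ∧ FiberedConvolution.IsProperlySupported v)) :
    ∃! w : FiberedConvolution.FiberedDistribution 𝕜 EB EG F E 𝒢.r,
      FiberedConvolution.IsConvolution m u v w := by
  rcases huv with ⟨⟨U, hU⟩, -⟩ | ⟨-, hv⟩
  · -- the section of inner pairings is smooth, and `u` is defined on all smooth sections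
    have hI : ∀ φ : TestSections 𝕜 EG F E, innerPairing m v φ.1 ∈ SmoothSections 𝕜 EG F E :=
      fun φ => innerPairing_mem_smoothSections φ.2
    refine existsUnique_isConvolution u (fun φ => U.toFun ⟨innerPairing m v φ.1, hI φ⟩) ⟨?_, ?_⟩
      (fun K hK x₀ => U.paramSmoothOn_eval (smoothFamily_innerPairing
        (smoothFamily_sectionsSupportedIn K) hK fun f => f.2) x₀) fun φ x =>
        Or.inr ⟨U, hU, ⟨⟨_, hI φ⟩, rfl⟩, fun f hf => ?_⟩
    · intro f g x
      rw [← U.isModuleMap.map_add]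
      congr 2
      exact Subtype.ext (innerPairing_add f.2 g.2)
    · intro h f f' hf x
      exact U.isModuleMap.map_smul h ⟨_, hI f⟩ ⟨_, hI f'⟩ (innerPairing_mul f.2 f'.2 hf) x
    · exact U.toFun_congr_of_restrict 𝒢.isSubmersion_r hU f ⟨_, hI φ⟩ fun p hp =>
        congrFun hf ⟨p, hp⟩
  · -- the section of inner pairings is compactly supported
    have hI : ∀ φ : TestSections 𝕜 EG F E, innerPairing m v φ.1 ∈ TestSections 𝕜 EG F E :=
      fun φ => by
        obtain ⟨K, hK, hφK⟩ := φ.2.2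
        obtain ⟨Q, hQ, hsub⟩ := exists_supp_innerPairing_subset (m := m) hv hK
        exact ⟨innerPairing_mem_smoothSections φ.2, Q, hQ, hsub _ φ.2 hφK⟩
    refine existsUnique_isConvolution u (fun φ => u.toFun ⟨innerPairing m v φ.1, hI φ⟩) ⟨?_, ?_⟩
      (fun K hK x₀ => ?_) fun φ x => Or.inl ⟨⟨⟨_, hI φ⟩, rfl⟩, fun f hf => ?_⟩
    · intro f g x
      rw [← u.isModuleMap.map_add]
      congr 2
      exact Subtype.ext (innerPairing_add f.2 g.2)
    · intro h f f' hf x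
      exact u.isModuleMap.map_smul h ⟨_, hI f⟩ ⟨_, hI f'⟩ (innerPairing_mul f.2 f'.2 hf) x
    · obtain ⟨Q, hQ, hsub⟩ := exists_supp_innerPairing_subset (m := m) hv hK
      have := u.paramSmoothOn_eval (smoothFamily_innerPairing (m := m) (v := v)
        (smoothFamily_sectionsSupportedIn K) hK fun f => f.2) hQ
        (fun f => hsub _ f.1.2 f.2) x₀
      simpa only [u.eval_of_mem (hI _)] using this
    · rw [← u.eval_coe, ← u.eval_of_mem (hI φ)]
      exact u.eval_congr_of_restrict 𝒢.isSubmersion_r f.2 (hI φ) fun p hp => congrFun hf ⟨p, hp⟩
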